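/- Let $\mathcal H$ be an infinite dimensional separable complex Hilbert space and let $\{e_i\}_{i\ge1}$ be the standard basis of $\ell^2$. A sequence $\{f_i\}_{i\ge 1}$ in a closed subspace $\mathcal K\subseteq\mathcal H$ is a *frame in $\mathcal K$* if there are $A,B>0$ with $A\|h\|^2\le\sum_i|\langle h,f_i\rangle|^2\le B\|h\|^2$ for all $h\in\mathcal K$, and a *Parseval frame in $\mathcal K$* if this holds with $A=B=1$. Its *synthesis operator* is the bounded operator $F:\ell^2\to\mathcal H$ with $Fe_i=f_i$. For orthogonal projections $P,Q$ on $\ell^2$, $(P,Q)$ is a *Fredholm pair* if $QP|_{\mathrm{ran}P}:\mathrm{ran}\,P\to\mathrm{ran}\,Q$ is Fredholm, and then $j(P,Q)=\dim(\ker Q\cap\mathrm{ran}\,P)-\dim(\mathrm{ran}\,Q\cap\ker P)$. Let $\{f_i\}$ be a frame in a closed subspace $\mathcal K\subseteq\mathcal H$ with synthesis operator $F$, let $F=U|F|$ be its polar decomposition ($U$ is the partial isometry with $\ker U=\ker F$), and put $u_i=Ue_i$. Let $\{s_j\}_{j=1}^{\alpha}$ be the nonzero singular values of $F$, that is, the nonzero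 eigenvalues of $|F|$, each repeated according to its multiplicity. Let $\mathcal Q_{\mathcal F}$ be the set of all sequences $\{x_i\}$ that are a Parseval frame in some closed subspace of $\mathcal H$ and satisfy $\sum_i\|x_i-f_i\|^2<\infty$, and for an integer $k$ let $\mathcal Q_{\mathcal F}^k$ be the set of those $\{x_i\}\in\mathcal Q_{\mathcal F}$, with synthesis operator $X$, for which $(U^*U,X^*X)$ is a Fredholm pair with $j(U^*U,X^*X)=k$. A *symmetric approximation of $\{f_i\}$ in $\mathcal Q_{\mathcal F}^k$* is a $\{y_i\}\in\mathcal Q_{\mathcal F}^k$ such that $\sum_i\|f_i-y_i\|^2$ is finite and $\sum_i\|f_i-y_i\|^2\le\sum_i\|f_i-x_i\|^2$ for all $\{x_i\}\in\mathcal Q_{\mathcal F}^k$. **Theorem.** Assume that $\mathcal Q_{\mathcal F}\neq\emptyset$. Then for every integer $k$ with $1\le k\le\alpha$: i) There is a symmetric approximation of $\{f_i\}$ in $\mathcal Q_{\mathcal F}^k$ if and only if there are distinct indices $n_1,\dots,n_k$ with $s_{n_1}\le\dots\le s_{n_k}\le s_j$ for all $j\ne n_1,\dots,n_k$. ii) Assume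 that $n_1,\dots,n_k$ are such indices, and put $\mathbb A=\{j: s_j<s_{n_k}\}$ and $\mathbb B=\{j: s_j=s_{n_k}\}$. Let $E_0$ be the orthogonal projection of $\ell^2$ onto the (orthogonal) sum of the eigenspaces $\ker(|F|-s_jI)$, $j\in\mathbb A$. Then the symmetric approximations of $\{f_i\}$ in $\mathcal Q_{\mathcal F}^k$ are exactly the sequences $\{u_i-U(E_0+E_1)e_i\}$, where $E_1$ is any orthogonal projection with $\mathrm{ran}(E_1)\subseteq\ker(|F|-s_{n_k}I)$ and $\mathrm{rank}(E_1)=k-\#\mathbb A$. There is a unique symmetric approximation if and only if $\#\mathbb A+\#\mathbb B=k$. Otherwise there are infinitely many symmetric approximations. -/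

import Mathlib

open scoped ENNReal InnerProductSpace

noncomputable section

namespace FrameApprox

/-- The complex Hilbert space `ℓ²` of square summable sequences. -/
abbrev EllTwo : Type := lp (fun _ : ℕ => ℂ) 2

/-- The standard basis vectors `e_i` of `ℓ²`. -/
def stdBasis (i : ℕ) : EllTwo := lp.single 2 i (1 : ℂ)

section General

variable {E H : Type*}
  [NormedAddCommGroup E] [InnerProductSpace ℂ E] [CompleteSpace E]
  [NormedAddCommGroup H] [InnerProductSpace ℂ H] [CompleteSpace H]

/-! ### Frames in closed subspaces -/

/-- `f` is a sequence in the closed subspace `K` such that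
`A ‖h‖² ≤ ∑ |⟪h, f_i⟫|² ≤ B ‖h‖²` for all `h ∈ K`. -/
structure HasFrameBounds (f : ℕ → H) (K : Submodule ℂ H) (A B : ℝ) : Prop where
  isClosed : IsClosed (K : Set H)
  mem : ∀ i, f i ∈ K
  summable : ∀ h ∈ K, Summable fun i => ‖⟪h, f i⟫_ℂ‖ ^ 2
  lower : ∀ h ∈ K, A * ‖h‖ ^ 2 ≤ ∑' i, ‖⟪h, f i⟫_ℂ‖ ^ 2
  upper : ∀ h ∈ K, ∑' i, ‖⟪h, f i⟫_ℂ‖ ^ 2 ≤ B * ‖h‖ ^ 2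

/-- `f` is a frame in the closed subspace `K`. -/
def IsFrameIn (f : ℕ → H) (K : Submodule ℂ H) : Prop :=
  ∃ A B : ℝ, 0 < A ∧ 0 < B ∧ HasFrameBounds f K A B

/-- `f` is a Parseval frame in the closed subspace `K` (frame bounds `A = B = 1`). -/
def IsParsevalFrameIn (f : ℕ → H) (K : Submodule ℂ H) : Prop :=
  HasFrameBounds f K 1 1

/-- `F : ℓ² → H` is bounded, linear and sends `e_i` to `f_i`. -/
def IsSynthesis (f : ℕ → H) (F : EllTwo →L[ℂ] H) : Prop :=
  ∀ i, F (stdBasis i) = f i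

open Classical in
/-- The synthesis operator of `f`: the bounded operator `F : ℓ² → H` with `F e_i = f_i`
(the zero operator if there is none, which does not happen for a frame). -/
def synthesisOperator (f : ℕ → H) : EllTwo →L[ℂ] H :=
  if h : ∃ F, IsSynthesis f F then h.choose else 0


theorem IsSynthesis.unique {f : ℕ → H} {F G : EllTwo →L[ℂ] H}
    (hF : IsSynthesis f F) (hG : IsSynthesis f G) : F = G := by
  refine lp.ext_continuousLinearMap ENNReal.ofNat_ne_top fun i => ?_
  ext
  simpa [stdBasis] using (hF i).trans (hG i).symm

theorem IsFrameIn.exists_isSynthesis {f : ℕ → H} {K : Submodule ℂ H} (hf : IsFrameIn f K) :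
    ∃ F, IsSynthesis f F := by
  obtain ⟨A, B, -, hB, hK⟩ := hf
  have : CompleteSpace K := hK.isClosed.completeSpace_coe
  have hmem : ∀ v : K, Memℓp (fun i : ℕ => ⟪f i, (v : H)⟫_ℂ) 2 := fun v => by
    rw [memℓp_gen_iff (by norm_num)]
    simpa [norm_inner_symm] using hK.summable v v.2
  let T₀ : K →ₗ[ℂ] EllTwo :=
    { toFun := fun v => ⟨fun i => ⟪f i, (v : H)⟫_ℂ, hmem v⟩
      map_add' := fun v w => by ext i; exact inner_add_right _ _ _
      map_smul' := fun c v => by ext i; exact inner_smul_right _ _ _ }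
  have hT₀ : ∀ v i, T₀ v i = ⟪f i, (v : H)⟫_ℂ := fun v i => rfl
  let T : K →L[ℂ] EllTwo := T₀.mkContinuous (Real.sqrt B) fun v => by
    have h1 : ‖T₀ v‖ ^ 2 ≤ B * ‖v‖ ^ 2 := by
      have h2 := lp.norm_rpow_eq_tsum (p := 2) (by norm_num) (T₀ v)
      have h3 := hK.upper v v.2
      simp only [ENNReal.toReal_ofNat, Real.rpow_ofNat, hT₀, norm_inner_symm (f _)] at h2
      rw [h2]
      exact h3
    calc ‖T₀ v‖ = Real.sqrt (‖T₀ v‖ ^ 2) := (Real.sqrt_sq (norm_nonneg _)).symm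
      _ ≤ Real.sqrt (B * ‖v‖ ^ 2) := Real.sqrt_le_sqrt h1
      _ = Real.sqrt B * ‖v‖ := by rw [Real.sqrt_mul hB.le, Real.sqrt_sq (norm_nonneg _)]
  refine ⟨K.subtypeL ∘L ContinuousLinearMap.adjoint T, fun i => ?_⟩
  have key : ContinuousLinearMap.adjoint T (stdBasis i) = ⟨f i, hK.mem i⟩ := by
    refine ext_inner_left ℂ fun v => ?_
    rw [ContinuousLinearMap.adjoint_inner_right, stdBasis, lp.inner_single_right]
    have : T v i = ⟪f i, (v : H)⟫_ℂ := rfl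
    rw [this]
    simp
  simp [key]

/-- The synthesis operator of a frame does what it should. -/
theorem IsFrameIn.isSynthesis {f : ℕ → H} {K : Submodule ℂ H} (hf : IsFrameIn f K) :
    IsSynthesis f (synthesisOperator f) := by
  have h := hf.exists_isSynthesis
  rw [synthesisOperator, dif_pos h]
  exact h.choose_spec

/-! ### Absolute value and polar decomposition -/

/-- `|F| = (F* F)^{1/2}`. -/
def absOp (F : E →L[ℂ] H) : E →L[ℂ] E :=
  CFC.sqrt (ContinuousLinearMap.adjoint F ∘L F)

/-- `U` is the partial isometry of the polar decomposition of `F`: it is isometric on the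
orthogonal complement of its kernel, `F = U |F|` and `ker U = ker F`. -/
structure IsPolarFactor (F U : E →L[ℂ] H) : Prop where
  isometry_on : ∀ x ∈ (LinearMap.ker U.toLinearMap)ᗮ, ‖U x‖ = ‖x‖
  eq_comp : F = U ∘L absOp F
  ker_eq : LinearMap.ker U.toLinearMap = LinearMap.ker F.toLinearMap

theorem isSelfAdjoint_absOp (F : E →L[ℂ] H) : IsSelfAdjoint (absOp F) :=
  (CFC.sqrt_nonneg _).isSelfAdjoint

theorem norm_absOp_apply (F : E →L[ℂ] H) (x : E) : ‖absOp F x‖ = ‖F x‖ := by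
  have hpos : (0 : E →L[ℂ] E) ≤ ContinuousLinearMap.adjoint F ∘L F := by
    rw [ContinuousLinearMap.nonneg_iff_isPositive]
    exact ContinuousLinearMap.isPositive_adjoint_comp_self F
  have hmul : absOp F * absOp F = ContinuousLinearMap.adjoint F ∘L F :=
    CFC.sqrt_mul_sqrt_self _ hpos
  have h : ‖absOp F x‖ ^ 2 = ‖F x‖ ^ 2 := by
    have h1 : ⟪absOp F x, absOp F x⟫_ℂ = ⟪F x, F x⟫_ℂ := by
      rw [← ContinuousLinearMap.adjoint_inner_right, (isSelfAdjoint_absOp F).adjoint_eq,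
        ← mul_apply_eq_comp, hmul, ContinuousLinearMap.comp_apply,
        ContinuousLinearMap.adjoint_inner_right]
    rw [inner_self_eq_norm_sq_to_K, inner_self_eq_norm_sq_to_K] at h1
    exact_mod_cast h1
  exact (sq_eq_sq₀ (norm_nonneg _) (norm_nonneg _)).1 h

theorem ker_absOp (F : E →L[ℂ] H) :
    LinearMap.ker (absOp F).toLinearMap = LinearMap.ker F.toLinearMap := by
  ext x
  have h := norm_absOp_apply F x
  constructor
  · intro hx
    have hx' : absOp F x = 0 := hx
    rw [hx', norm_zero] at h
    exact norm_eq_zero.1 h.symm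
  · intro hx
    have hx' : F x = 0 := hx
    rw [hx', norm_zero] at h
    exact norm_eq_zero.1 h

theorem closure_range_absOp (F : E →L[ℂ] H) :
    (LinearMap.range (absOp F).toLinearMap).topologicalClosure =
      (LinearMap.ker F.toLinearMap)ᗮ := by
  rw [← ker_absOp, ContinuousLinearMap.orthogonal_ker, (isSelfAdjoint_absOp F).adjoint_eq]

theorem existsUnique_isPolarFactor (F : E →L[ℂ] H) : ∃! U, IsPolarFactor F U := by
  set M : Submodule ℂ E := (LinearMap.range (absOp F).toLinearMap).topologicalClosure with hM
  have hMK : M = (LinearMap.ker F.toLinearMap)ᗮ := closure_range_absOp F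
  have hMc : IsClosed (M : Set E) := Submodule.isClosed_topologicalClosure _
  have : CompleteSpace M := hMc.completeSpace_coe
  have hle : ∀ x, absOp F x ∈ M := fun x => Submodule.le_topologicalClosure _ ⟨x, rfl⟩
  let e : E →ₗ[ℂ] M := (absOp F).toLinearMap.codRestrict M hle
  have he : ∀ x, (e x : E) = absOp F x := fun x => rfl
  have hdense : DenseRange e := by
    intro y
    rw [Metric.mem_closure_iff]
    intro ε hε
    have hy : (y : E) ∈ closure (LinearMap.range (absOp F).toLinearMap : Set E) := y.2
    obtain ⟨_, ⟨x, rfl⟩, hx⟩ := Metric.mem_closure_iff.1 hy ε hε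
    exact ⟨e x, ⟨x, rfl⟩, hx⟩
  have hnorm : ∀ x, ‖F.toLinearMap x‖ = ‖e x‖ := fun x => (norm_absOp_apply F x).symm
  let V : M →L[ℂ] H := F.toLinearMap.extendOfNorm e
  have hV : ∀ x, V (e x) = F x := fun x =>
    LinearMap.extendOfNorm_eq hdense ⟨1, fun x => by rw [one_mul, hnorm]⟩ x
  have hVn : ∀ y, ‖V y‖ = ‖y‖ := by
    refine hdense.induction ?_ (isClosed_eq (by fun_prop) (by fun_prop))
    rintro _ ⟨x, rfl⟩
    rw [hV]
    exact hnorm x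
  let U : E →L[ℂ] H := V ∘L M.orthogonalProjectionOnto
  have hUM : ∀ y : M, U y = V y := fun y => by
    simp [U]
  have hUk : LinearMap.ker U.toLinearMap = Mᗮ := by
    ext x
    have h1 : U x = 0 ↔ M.orthogonalProjectionOnto x = 0 := by
      rw [← norm_eq_zero, ← norm_eq_zero (a := M.orthogonalProjectionOnto x), ← hVn]
      rfl
    rw [LinearMap.mem_ker]
    exact h1.trans Submodule.orthogonalProjectionOnto_eq_zero_iff
  have hFk : IsClosed (LinearMap.ker F.toLinearMap : Set E) := F.isClosed_ker
  have : CompleteSpace (LinearMap.ker F.toLinearMap) := hFk.completeSpace_coe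
  refine ⟨U, ⟨?_, ?_, ?_⟩, ?_⟩
  · intro x hx
    rw [hUk, Submodule.orthogonal_orthogonal] at hx
    exact (congrArg norm (hUM ⟨x, hx⟩)).trans (hVn ⟨x, hx⟩)
  · ext x
    exact ((hUM (e x)).trans (hV x)).symm
  · rw [hUk, hMK, Submodule.orthogonal_orthogonal]
  · intro W hW
    have hag : ∀ y : M, W y = V y := by
      refine hdense.induction ?_ (isClosed_eq (by fun_prop) (by fun_prop))
      rintro _ ⟨x, rfl⟩
      rw [hV, he]
      exact (DFunLike.congr_fun hW.eq_comp x).symm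
    ext x
    have hx : x = M.orthogonalProjectionOnto x + (x - M.orthogonalProjectionOnto x) := by abel
    have h0 : W (x - M.orthogonalProjectionOnto x) = 0 := by
      have hm : x - M.orthogonalProjectionOnto x ∈ LinearMap.ker W.toLinearMap := by
        rw [hW.ker_eq, ← Submodule.orthogonal_orthogonal (LinearMap.ker F.toLinearMap), ← hMK]
        exact Submodule.sub_starProjection_mem_orthogonal x
      exact hm
    conv_lhs => rw [hx]
    rw [map_add, h0, add_zero, hag]
    rfl

/-- The partial isometry `U` of the polar decomposition `F = U |F|`. -/
def polarFactor (F : E →L[ℂ] H) : E →L[ℂ] H := (existsUnique_isPolarFactor F).choose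

theorem isPolarFactor_polarFactor (F : E →L[ℂ] H) : IsPolarFactor F (polarFactor F) :=
  (existsUnique_isPolarFactor F).choose_spec.1

/-! ### Singular values -/

/-- `ker (|F| - t I)`. -/
def singularSpace (F : E →L[ℂ] H) (t : ℝ) : Submodule ℂ E :=
  LinearMap.ker (absOp F - (t : ℂ) • ContinuousLinearMap.id ℂ E).toLinearMap

/-- The dimension of a subspace, as a natural number or `∞`. -/
def dimENat (V : Submodule ℂ E) : ℕ∞ := Cardinal.toENat (Module.rank ℂ V)

/-- The family `s` lists the nonzero singular values of `F`, that is, the nonzero eigenvalues of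
`|F|`, each repeated according to its multiplicity `dim ker (|F| - t I)`. -/
structure IsNonzeroSingularValues {ι : Type*} (F : E →L[ℂ] H) (s : ι → ℝ) : Prop where
  pos : ∀ j, 0 < s j
  multiplicity : ∀ t : ℝ, 0 < t → {j | s j = t}.encard = dimENat (singularSpace F t)

/-- Such a listing by a countable index set always exists. -/
theorem exists_isNonzeroSingularValues [TopologicalSpace.SeparableSpace E] (F : E →L[ℂ] H) :
    ∃ (ι : Type) (_ : Countable ι) (s : ι → ℝ), IsNonzeroSingularValues F s := by
  set m : ℝ → ℕ∞ := fun t => dimENat (singularSpace F t) with hm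
  have hcount : {t : ℝ | m t ≠ 0}.Countable := by
    have hex : ∀ t : {t : ℝ | m t ≠ 0}, ∃ v ∈ singularSpace F t, ‖v‖ = 1 := by
      rintro ⟨t, ht⟩
      have hne : singularSpace F t ≠ ⊥ := by
        intro hbot
        apply ht
        simp [hm, dimENat, hbot]
      obtain ⟨v, hv, hv0⟩ := Submodule.exists_mem_ne_zero_of_ne_bot hne
      exact ⟨(‖v‖⁻¹ : ℂ) • v, Submodule.smul_mem _ _ hv, by
        rw [norm_smul]; simp [norm_ne_zero_iff.2 hv0]⟩
    choose v hv hv1 using hex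
    have happ : ∀ t, absOp F (v t) = ((t : ℝ) : ℂ) • v t := fun t => by
      have h := hv t
      rw [singularSpace, LinearMap.mem_ker] at h
      exact sub_eq_zero.1 h
    have horth : ∀ t r, t ≠ r → ⟪v t, v r⟫_ℂ = 0 := by
      intro t r htr
      have h1 : ⟪absOp F (v t), v r⟫_ℂ = ⟪v t, absOp F (v r)⟫_ℂ := by
        rw [← ContinuousLinearMap.adjoint_inner_right, (isSelfAdjoint_absOp F).adjoint_eq]
      rw [happ, happ, inner_smul_left, inner_smul_right, Complex.conj_ofReal] at h1
      have h2 : (((t : ℝ) : ℂ) - ((r : ℝ) : ℂ)) * ⟪v t, v r⟫_ℂ = 0 := by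
        rw [sub_mul, h1, sub_self]
      refine (mul_eq_zero.1 h2).resolve_left fun h3 => htr (Subtype.ext ?_)
      exact_mod_cast sub_eq_zero.1 h3
    have hdist : ∀ t r, t ≠ r → 1 < dist (v t) (v r) := by
      intro t r htr
      have h1 := norm_sub_sq (𝕜 := ℂ) (v t) (v r)
      rw [horth t r htr, hv1, hv1] at h1
      rw [dist_eq_norm]
      norm_num at h1
      nlinarith [norm_nonneg (v t - v r)]
    have hpd : Pairwise (Function.onFun Disjoint fun t => Metric.ball (v t) (1 / 2)) := by
      intro t r htr
      refine Metric.ball_disjoint_ball ?_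
      have := hdist t r htr
      linarith
    have := Pairwise.countable_of_isOpen_disjoint hpd (fun _ => Metric.isOpen_ball)
      (fun t => ⟨v t, Metric.mem_ball_self (by norm_num)⟩)
    exact Set.countable_coe_iff.1 this
  have hfib : ∀ a : ℕ∞, {i : ℕ | (i : ℕ∞) < a}.encard = a := by
    intro a
    cases a with
    | top => simp
    | coe a =>
      have : {i : ℕ | (i : ℕ∞) < (a : ℕ∞)} = (Finset.range a : Set ℕ) := by ext; simp
      rw [this, Set.encard_coe_eq_coe_finsetCard, Finset.card_range]
  let I : Set (ℝ × ℕ) := {p | 0 < p.1 ∧ (p.2 : ℕ∞) < m p.1}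
  have hI : I.Countable := by
    refine (hcount.prod Set.countable_univ).mono ?_
    rintro ⟨t, i⟩ ⟨-, h⟩
    exact ⟨(bot_le.trans_lt h).ne', trivial⟩
  refine ⟨I, hI.to_subtype, fun p => p.1.1, fun p => p.2.1, fun t ht => ?_⟩
  have hset : (Subtype.val '' {j : I | j.1.1 = t} : Set (ℝ × ℕ)) =
      Prod.mk t '' {i : ℕ | (i : ℕ∞) < m t} := by
    ext ⟨r, i⟩
    constructor
    · rintro ⟨⟨⟨r, i⟩, h⟩, rfl, ⟨⟩⟩
      exact ⟨i, h.2, rfl⟩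
    · rintro ⟨i, h, ⟨⟩⟩
      exact ⟨⟨(t, i), ht, h⟩, rfl, rfl⟩
  rw [← Subtype.val_injective.encard_image, hset, (Prod.mk_right_injective t).encard_image, hfib]

/-- `s_{n_1} ≤ … ≤ s_{n_k}` are `k` lowest members of the family `s`
(with distinct indices `n_1, …, n_k`): they are `≤ s_j` for every other index `j`. -/
structure IsLowest {ι : Type*} {k : ℕ} (s : ι → ℝ) (n : Fin k → ι) : Prop where
  injective : Function.Injective n
  monotone : Monotone (s ∘ n)
  le_other : ∀ j, j ∉ Set.range n → ∀ i, s (n i) ≤ s j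

/-! ### Fredholm pairs of projections -/

/-- The operator `Q P|_{ran P} : ran P → ran Q`. -/
def pairOperator (P Q : E →L[ℂ] E) :
    LinearMap.range P.toLinearMap →L[ℂ] LinearMap.range Q.toLinearMap :=
  ((Q ∘L P) ∘L (LinearMap.range P.toLinearMap).subtypeL).codRestrict
    (LinearMap.range Q.toLinearMap) fun x => ⟨P x, rfl⟩

/-- `(P, Q)` is a Fredholm pair. -/
def IsFredholmPair (P Q : E →L[ℂ] E) : Prop := (pairOperator P Q).IsFredholm

/-- The index `j(P, Q) = dim (ker Q ∩ ran P) - dim (ran Q ∩ ker P)` of a Fredholm pair of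
orthogonal projections (both dimensions are finite for such a pair). -/
def pairIndex (P Q : E →L[ℂ] E) : ℤ :=
  (Module.finrank ℂ ↥(LinearMap.ker Q.toLinearMap ⊓ LinearMap.range P.toLinearMap) : ℤ) -
    Module.finrank ℂ ↥(LinearMap.range Q.toLinearMap ⊓ LinearMap.ker P.toLinearMap)

/-- The initial projection `U* U`. -/
def initialProj (U : E →L[ℂ] H) : E →L[ℂ] E := ContinuousLinearMap.adjoint U ∘L U

/-! ### Quadratically close Parseval frames and symmetric approximation -/

/-- `∑ ‖f_i - x_i‖²`, with values in `[0, ∞]`. -/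
def sqDist (f x : ℕ → H) : ℝ≥0∞ := ∑' i, ‖f i - x i‖ₑ ^ 2

/-- `𝒬_F`: all Parseval frames in closed subspaces of `H` that are quadratically close to `f`. -/
def closeParseval (f : ℕ → H) : Set (ℕ → H) :=
  {x | (∃ L : Submodule ℂ H, IsParsevalFrameIn x L) ∧ sqDist f x < ∞}

/-- `𝒬_F^k`: the members of `𝒬_F` whose synthesis operator `X` satisfies `j(U* U, X* X) = k`,
where `F = U |F|` is the polar decomposition of the synthesis operator of `f`. -/
def closeParsevalIndex (f : ℕ → H) (k : ℤ) : Set (ℕ → H) :=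
  {x ∈ closeParseval f |
    IsFredholmPair (initialProj (polarFactor (synthesisOperator f)))
      (initialProj (synthesisOperator x)) ∧
    pairIndex (initialProj (polarFactor (synthesisOperator f)))
      (initialProj (synthesisOperator x)) = k}

/-- `y` is a symmetric approximation of `f` in the family `S`. -/
structure IsSymmetricApprox (f : ℕ → H) (S : Set (ℕ → H)) (y : ℕ → H) : Prop where
  mem : y ∈ S
  finite : sqDist f y < ∞
  le : ∀ x ∈ S, sqDist f y ≤ sqDist f x

end General

end FrameApprox

end

/-! A sequence is a Parseval frame in a closed subspace exactly when its synthesis operator `X` is a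
partial isometry, and `∑ ‖f_i - x_i‖²` is the squared Hilbert–Schmidt norm of `F - X`. The problem
is thus to approximate `F` in this norm by partial isometries whose initial projection `Q = X* X`
has index `k` relative to `P = U* U`.

If one such `X` exists, then `F* F - Q` is Hilbert–Schmidt. The lower frame bound turns this into
`|F| - P` being Hilbert–Schmidt, hence compact, so `|F|` is diagonal in an orthonormal basis `g_j`
of `ran P` with eigenvalues `s_j` (`exists_singular_basis`).

For a pair of projections, `tr P(1 - Q)P - tr Q(1 - P)Q = j(P, Q)` (`hsNormSq_pair`). Expanding `‖F
- X‖²` along `g` and inserting this relation gives `‖F - X‖² + k = ‖F - U‖² + ∑ s_j d_j`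
(`Admissible.identity`), where `d_j = ‖(U - X) g_j‖² + ‖(1 - Q) g_j‖²` is the defect. The task
becomes to minimize the linear functional `∑ s_j d_j`.

The constraint on the `d_j` comes from `N = ker Q ∩ ran P`, of dimension at least `k`: every unit
vector of `N` has defect 2. For a finite set `S` of indices, `N` contains at least `k - #S`
orthonormal vectors orthogonal to all `g_j`, `j ∈ S`, whence `∑_{j ∉ S} d_j ≥ 2(k - #S)`
(`le_card_add_tsum_defect`). Summation by layers (`sum_add_le_tsum_mul`) bounds `∑ s_j d_j` below by
twice the sum of the `k` lowest `s_j`, when these exist. The operator `U - U R`, with `R` a rank `k`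
projection below `P`, has `d_j = 2‖R g_j‖²`, so the bound is attained.

Conversely, optimality forces `∑ d_j ≤ 2k`. The space `N` alone accounts for this amount, so `X`
agrees with `U` off `N` and `X = U - U R` (`Admissible.exists_eq_sub`). The equality case of the
weighted sum then says that `R` fixes `g_j` for `s_j < σ` and kills it for `s_j > σ`, with freedom
only in the eigenspace of `σ = s_{n_k}`. If the `k` lowest values do not exist, some infimum of
remaining singular values is not attained; reaching the corresponding infimum of the cost would make
the defect vanish off fewer than `k` indices, against the tail bound (`IsOptimal.exists_min`). -/

open scoped ENNReal InnerProductSpace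

set_option linter.unusedSectionVars false

noncomputable section

namespace FrameApprox

/-! ### Hilbert–Schmidt norms with values in `[0, ∞]` -/

section HilbertSchmidt

open ContinuousLinearMap

variable {E H G : Type*}
  [NormedAddCommGroup E] [InnerProductSpace ℂ E] [CompleteSpace E]
  [NormedAddCommGroup H] [InnerProductSpace ℂ H] [CompleteSpace H]
  [NormedAddCommGroup G] [InnerProductSpace ℂ G] [CompleteSpace G]

theorem enorm_sq_eq_ofReal {V : Type*} [SeminormedAddCommGroup V] (x : V) :
    ‖x‖ₑ ^ 2 = ENNReal.ofReal (‖x‖ ^ 2) := by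
  rw [← ofReal_norm, ENNReal.ofReal_pow (norm_nonneg _)]

/-- `v` is an orthonormal basis of the range of the projection `P`. -/
structure IsBasisOf {ι : Type*} (v : ι → E) (P : E →L[ℂ] E) : Prop where
  orthonormal : Orthonormal ℂ v
  hasSum : ∀ x, HasSum (fun i => ⟪v i, x⟫_ℂ • v i) (P x)

theorem IsBasisOf.apply_self {ι : Type*} {v : ι → E} {P : E →L[ℂ] E} (h : IsBasisOf v P) (i : ι) :
    P (v i) = v i := by
  classical
  refine (h.hasSum (v i)).unique ?_
  have : (fun j => ⟪v j, v i⟫_ℂ • v j) = fun j => if j = i then v i else 0 := by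
    ext j
    rw [orthonormal_iff_ite.1 h.orthonormal]
    split_ifs with hj
    · rw [hj, one_smul]
    · rw [zero_smul]
  rw [this]
  exact hasSum_ite_eq i (v i)

theorem IsBasisOf.hasSum_norm_sq {ι : Type*} {v : ι → E} {P : E →L[ℂ] E} (h : IsBasisOf v P)
    (x : E) : HasSum (fun i => ‖⟪v i, x⟫_ℂ‖ ^ 2) (‖P x‖ ^ 2) := by
  have h1 := (h.hasSum x).mapL (innerSL ℂ (P x))
  simp only [innerSL_apply_apply, inner_smul_right] at h1
  -- Self-adjointness of `P` is not among the hypotheses, so the coefficients of `P x` are read off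
  -- from the expansion.
  have h2 : ∀ i, ⟪P x, v i⟫_ℂ = ⟪x, v i⟫_ℂ := by
    intro i
    have h3 := (h.hasSum x).mapL (innerSL ℂ (v i))
    simp only [innerSL_apply_apply, inner_smul_right] at h3
    classical
    simp only [orthonormal_iff_ite.1 h.orthonormal] at h3
    have h4 : HasSum (fun j => ⟪v j, x⟫_ℂ * if i = j then 1 else 0) ⟪v i, x⟫_ℂ := by
      have := hasSum_ite_eq i ⟪v i, x⟫_ℂ
      convert! this using 2 with j
      by_cases hj : j = i
      · simp [hj]
      · simp [hj, Ne.symm hj]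
    have h5 := h3.unique h4
    rw [← inner_conj_symm, h5, inner_conj_symm]
  simp only [h2] at h1
  have h3 := Complex.hasSum_re h1
  have h4 : (⟪P x, P x⟫_ℂ).re = ‖P x‖ ^ 2 := by
    rw [inner_self_eq_norm_sq_to_K]; norm_cast
  rw [h4] at h3
  convert! h3 using 2 with i
  rw [← inner_conj_symm x, ← Complex.normSq_eq_norm_sq, Complex.mul_conj]
  norm_cast

theorem IsBasisOf.tsum_enorm_sq {ι : Type*} {v : ι → E} {P : E →L[ℂ] E} (h : IsBasisOf v P)
    (x : E) : ∑' i, ‖⟪v i, x⟫_ℂ‖ₑ ^ 2 = ‖P x‖ₑ ^ 2 := by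
  simp only [enorm_sq_eq_ofReal]
  rw [← (h.hasSum_norm_sq x).tsum_eq, ENNReal.ofReal_tsum_of_nonneg (fun _ => by positivity)
    (h.hasSum_norm_sq x).summable]

theorem tsum_enorm_inner_sq_le {ι : Type*} {v : ι → E} (h : Orthonormal ℂ v) (x : E) :
    ∑' i, ‖⟪v i, x⟫_ℂ‖ₑ ^ 2 ≤ ‖x‖ₑ ^ 2 := by
  simp only [enorm_sq_eq_ofReal]
  rw [← ENNReal.ofReal_tsum_of_nonneg (fun _ => by positivity) (h.inner_products_summable x)]
  exact ENNReal.ofReal_le_ofReal (h.tsum_inner_products_le x)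

theorem isBasisOf_hilbertBasis {ι : Type*} {M : Submodule ℂ E} [CompleteSpace M]
    (b : HilbertBasis ι ℂ M) : IsBasisOf (fun i => (b i : E)) M.starProjection where
  orthonormal := b.orthonormal.comp_linearIsometry M.subtypeₗᵢ
  hasSum x := (b.hasSum_orthogonalProjectionOnto x).mapL M.subtypeL

theorem isBasisOf_hilbertBasis_one {ι : Type*} (b : HilbertBasis ι ℂ E) :
    IsBasisOf b (1 : E →L[ℂ] E) where
  orthonormal := b.orthonormal
  hasSum x := by
    change HasSum _ x
    simpa only [← b.repr_apply_apply] using b.hasSum_repr x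

theorem exists_isBasisOf {P : E →L[ℂ] E} (hP : IsStarProjection P) :
    ∃ (w : Set (LinearMap.range P.toLinearMap))
      (b : HilbertBasis w ℂ (LinearMap.range P.toLinearMap)),
      IsBasisOf (fun i => (b i : E)) P := by
  obtain ⟨h1, h2⟩ := isStarProjection_iff_eq_starProjection_range.1 hP
  have : IsClosed (LinearMap.range P.toLinearMap : Set E) := by
    have := hP.isIdempotentElem.isClosed_range
    simpa using this
  have : CompleteSpace (LinearMap.range P.toLinearMap) := this.completeSpace_coe
  obtain ⟨w, b, -⟩ := exists_hilbertBasis ℂ (LinearMap.range P.toLinearMap)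
  refine ⟨w, b, ?_⟩
  have h3 := isBasisOf_hilbertBasis b
  have h4 : (LinearMap.range P.toLinearMap).starProjection = P := h2.symm
  rwa [h4] at h3

/-- Tonelli for the double sum of `|⟪c j, T (v i)⟫|²`. The right side no longer involves `v`, which
yields both independence of the basis and invariance under adjoints. -/
theorem tsum_enorm_sq_adjoint {ι κ : Type*} {v : ι → E} {P : E →L[ℂ] E} (h : IsBasisOf v P)
    (T : E →L[ℂ] H) (c : HilbertBasis κ ℂ H) :
    ∑' i, ‖T (v i)‖ₑ ^ 2 = ∑' j, ‖P (adjoint T (c j))‖ₑ ^ 2 := by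
  have h1 : ∀ i, ‖T (v i)‖ₑ ^ 2 = ∑' j, ‖⟪c j, T (v i)⟫_ℂ‖ₑ ^ 2 := fun i =>
    ((isBasisOf_hilbertBasis_one c).tsum_enorm_sq (T (v i))).symm
  have h2 : ∀ j, ‖P (adjoint T (c j))‖ₑ ^ 2 = ∑' i, ‖⟪c j, T (v i)⟫_ℂ‖ₑ ^ 2 := fun j => by
    rw [← h.tsum_enorm_sq]
    refine tsum_congr fun i => ?_
    rw [adjoint_inner_right, ← ofReal_norm, ← ofReal_norm, norm_inner_symm]
  simp only [h1, h2]
  exact ENNReal.tsum_comm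

/-- The square of the Hilbert–Schmidt norm, with values in `[0, ∞]`. -/
def hsNormSq (T : E →L[ℂ] H) : ℝ≥0∞ :=
  ∑' i, ‖T ((exists_hilbertBasis ℂ E).choose_spec.choose i)‖ₑ ^ 2

theorem hsNormSq_eq_tsum {ι : Type*} (T : E →L[ℂ] H) (b : HilbertBasis ι ℂ E) :
    hsNormSq T = ∑' i, ‖T (b i)‖ₑ ^ 2 := by
  have c := (exists_hilbertBasis ℂ H).choose_spec.choose
  rw [hsNormSq, tsum_enorm_sq_adjoint (isBasisOf_hilbertBasis_one _) T c,
    tsum_enorm_sq_adjoint (isBasisOf_hilbertBasis_one _) T c]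

theorem hsNormSq_adjoint (T : E →L[ℂ] H) : hsNormSq (adjoint T) = hsNormSq T := by
  have c := (exists_hilbertBasis ℂ H).choose_spec.choose
  have b := (exists_hilbertBasis ℂ E).choose_spec.choose
  rw [hsNormSq_eq_tsum T b, tsum_enorm_sq_adjoint (isBasisOf_hilbertBasis_one _) T c,
    hsNormSq_eq_tsum _ c]
  rfl

theorem tsum_enorm_sq_eq_hsNormSq {ι : Type*} {v : ι → E} {P : E →L[ℂ] E} (h : IsBasisOf v P)
    (hP : IsStarProjection P) (T : E →L[ℂ] H) :
    ∑' i, ‖T (v i)‖ₑ ^ 2 = hsNormSq (T ∘L P) := by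
  have c := (exists_hilbertBasis ℂ H).choose_spec.choose
  rw [tsum_enorm_sq_adjoint h T c, ← hsNormSq_adjoint, hsNormSq_eq_tsum _ c, adjoint_comp,
    hP.isSelfAdjoint.adjoint_eq]
  rfl

theorem tsum_enorm_sq_le_hsNormSq {ι : Type*} {v : ι → E} (h : Orthonormal ℂ v)
    (T : E →L[ℂ] H) : ∑' i, ‖T (v i)‖ₑ ^ 2 ≤ hsNormSq T := by
  have c := (exists_hilbertBasis ℂ H).choose_spec.choose
  have h1 : ∀ i, ‖T (v i)‖ₑ ^ 2 = ∑' j, ‖⟪v i, adjoint T (c j)⟫_ℂ‖ₑ ^ 2 := fun i => by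
    have : ∑' j, ‖⟪c j, T (v i)⟫_ℂ‖ₑ ^ 2 = ‖T (v i)‖ₑ ^ 2 :=
      (isBasisOf_hilbertBasis_one c).tsum_enorm_sq (T (v i))
    rw [← this]
    refine tsum_congr fun j => ?_
    rw [adjoint_inner_right, ← ofReal_norm, ← ofReal_norm, norm_inner_symm]
  simp only [h1]
  rw [ENNReal.tsum_comm, ← hsNormSq_adjoint, hsNormSq_eq_tsum _ c]
  exact ENNReal.tsum_le_tsum fun j => tsum_enorm_inner_sq_le h _

theorem hsNormSq_mono {T : E →L[ℂ] H} {S : E →L[ℂ] G} (h : ∀ x, ‖T x‖ ≤ ‖S x‖) :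
    hsNormSq T ≤ hsNormSq S := by
  refine ENNReal.tsum_le_tsum fun i => ?_
  gcongr
  rw [← ofReal_norm, ← ofReal_norm]
  exact ENNReal.ofReal_le_ofReal (h _)

theorem hsNormSq_congr {T : E →L[ℂ] H} {S : E →L[ℂ] G} (h : ∀ x, ‖T x‖ = ‖S x‖) :
    hsNormSq T = hsNormSq S :=
  le_antisymm (hsNormSq_mono fun x => (h x).le) (hsNormSq_mono fun x => (h x).ge)

theorem hsNormSq_comp_le (S : H →L[ℂ] G) (T : E →L[ℂ] H) :
    hsNormSq (S ∘L T) ≤ ‖S‖ₑ ^ 2 * hsNormSq T := by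
  rw [hsNormSq, hsNormSq, ← ENNReal.tsum_mul_left]
  refine ENNReal.tsum_le_tsum fun i => ?_
  rw [← mul_pow]
  gcongr
  exact S.le_opENorm _

theorem hsNormSq_comp_le' (T : H →L[ℂ] G) (S : E →L[ℂ] H) :
    hsNormSq (T ∘L S) ≤ ‖S‖ₑ ^ 2 * hsNormSq T := by
  rw [← hsNormSq_adjoint, adjoint_comp, ← hsNormSq_adjoint T]
  have : ‖S‖ₑ = ‖adjoint S‖ₑ := by
    rw [← ofReal_norm, ← ofReal_norm, LinearIsometryEquiv.norm_map]
  rw [this]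
  exact hsNormSq_comp_le _ _

theorem hsNormSq_comp_lt_top (S : H →L[ℂ] G) {T : E →L[ℂ] H} (hT : hsNormSq T < ∞) :
    hsNormSq (S ∘L T) < ∞ :=
  (hsNormSq_comp_le S T).trans_lt (ENNReal.mul_lt_top (by simp) hT)

theorem hsNormSq_comp_lt_top' {T : H →L[ℂ] G} (S : E →L[ℂ] H) (hT : hsNormSq T < ∞) :
    hsNormSq (T ∘L S) < ∞ :=
  (hsNormSq_comp_le' T S).trans_lt (ENNReal.mul_lt_top (by simp) hT)

theorem hsNormSq_add_lt_top {S T : E →L[ℂ] H} (hS : hsNormSq S < ∞) (hT : hsNormSq T < ∞) :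
    hsNormSq (S + T) < ∞ := by
  have h : hsNormSq (S + T) ≤ 2 * (hsNormSq S + hsNormSq T) := by
    rw [hsNormSq, hsNormSq, hsNormSq, ← ENNReal.tsum_add, ← ENNReal.tsum_mul_left]
    refine ENNReal.tsum_le_tsum fun i => ?_
    generalize (exists_hilbertBasis ℂ E).choose_spec.choose i = x
    rw [enorm_sq_eq_ofReal, enorm_sq_eq_ofReal, enorm_sq_eq_ofReal,
      ← ENNReal.ofReal_add (by positivity) (by positivity),
      show (2 : ℝ≥0∞) = ENNReal.ofReal 2 by simp, ← ENNReal.ofReal_mul (by norm_num)]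
    refine ENNReal.ofReal_le_ofReal ?_
    have h1 : ‖(S + T) x‖ ≤ ‖S x‖ + ‖T x‖ := norm_add_le _ _
    nlinarith [norm_nonneg ((S + T) x), norm_nonneg (S x), norm_nonneg (T x),
      sq_nonneg (‖S x‖ - ‖T x‖)]
  exact h.trans_lt (ENNReal.mul_lt_top (by simp) (ENNReal.add_lt_top.2 ⟨hS, hT⟩))

theorem hsNormSq_neg (T : E →L[ℂ] H) : hsNormSq (-T) = hsNormSq T :=
  hsNormSq_congr fun x => by simp

theorem hsNormSq_sub_lt_top {S T : E →L[ℂ] H} (hS : hsNormSq S < ∞) (hT : hsNormSq T < ∞) :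
    hsNormSq (S - T) < ∞ := by
  rw [sub_eq_add_neg]
  exact hsNormSq_add_lt_top hS (by rwa [hsNormSq_neg])

theorem norm_sq_eq_add {P : E →L[ℂ] E} (hP : IsStarProjection P) (x : E) :
    ‖x‖ ^ 2 = ‖P x‖ ^ 2 + ‖x - P x‖ ^ 2 := by
  have h1 : ⟪P x, x - P x⟫_ℂ = 0 := by
    rw [inner_sub_right, ← adjoint_inner_right, ← adjoint_inner_right,
      hP.isSelfAdjoint.adjoint_eq, ← mul_apply_eq_comp,
      hP.isIdempotentElem.eq, sub_self]
  have h2 := norm_add_sq_eq_norm_sq_add_norm_sq_of_inner_eq_zero _ _ h1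
  rw [add_sub_cancel] at h2
  simpa [sq] using h2

theorem enorm_sq_eq_add {P : E →L[ℂ] E} (hP : IsStarProjection P) (x : E) :
    ‖x‖ₑ ^ 2 = ‖P x‖ₑ ^ 2 + ‖x - P x‖ₑ ^ 2 := by
  simp only [enorm_sq_eq_ofReal]
  rw [← ENNReal.ofReal_add (by positivity) (by positivity), norm_sq_eq_add hP]

/-- Pythagoras acts on values, while `P` stands on the side of the argument; passing to adjoints
moves it to the other side. -/
theorem hsNormSq_eq_add {P : E →L[ℂ] E} (hP : IsStarProjection P) (T : E →L[ℂ] H) :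
    hsNormSq T = hsNormSq (T ∘L P) + hsNormSq (T ∘L (1 - P)) := by
  rw [← hsNormSq_adjoint T, ← hsNormSq_adjoint (T ∘L P), ← hsNormSq_adjoint (T ∘L (1 - P)),
    adjoint_comp, adjoint_comp, hP.isSelfAdjoint.adjoint_eq,
    hP.one_sub.isSelfAdjoint.adjoint_eq, hsNormSq, hsNormSq, hsNormSq, ← ENNReal.tsum_add]
  exact tsum_congr fun i => enorm_sq_eq_add hP _

theorem card_hilbertBasis_eq_dimENat {M : Submodule ℂ E} {ι : Type*} (b : HilbertBasis ι ℂ M) :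
    dimENat M = ENat.card ι := by
  rw [dimENat]
  rcases finite_or_infinite ι with hι | hι
  · have := Fintype.ofFinite ι
    have h := b.toOrthonormalBasis.toBasis.mk_eq_rank
    have h2 := congrArg Cardinal.toENat h
    simpa using h2.symm
  · have h := b.orthonormal.linearIndependent.cardinal_lift_le_rank
    rw [ENat.card_eq_top_of_infinite, Cardinal.toENat_eq_top]
    have h1 : Cardinal.aleph0 ≤ Cardinal.lift (Cardinal.mk ι) := by
      rw [Cardinal.aleph0_le_lift]
      exact Cardinal.aleph0_le_mk ι
    have h2 := h1.trans h
    rwa [Cardinal.aleph0_le_lift] at h2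

/-- Turns dimensions into Hilbert–Schmidt norms, so that the two can be added in `[0, ∞]` without
finiteness assumptions. -/
theorem hsNormSq_starProjection {P : E →L[ℂ] E} (hP : IsStarProjection P) :
    hsNormSq P = (dimENat (LinearMap.range P.toLinearMap) : ℝ≥0∞) := by
  obtain ⟨w, b, hb⟩ := exists_isBasisOf hP
  have h1 := tsum_enorm_sq_eq_hsNormSq hb hP (1 : E →L[ℂ] E)
  rw [card_hilbertBasis_eq_dimENat b]
  have h2 : (1 : E →L[ℂ] E) ∘L P = P := by ext; rfl
  rw [h2] at h1
  rw [← h1]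
  have h3 : ∀ i, ‖(1 : E →L[ℂ] E) (b i : E)‖ₑ ^ 2 = 1 := fun i => by
    have h4 : ‖(1 : E →L[ℂ] E) (b i : E)‖ = 1 := hb.orthonormal.1 i
    rw [enorm_sq_eq_ofReal, h4]; simp
  simp only [h3]
  rw [ENNReal.tsum_const, mul_one]

end HilbertSchmidt

/-! ### Hilbert–Schmidt operators are compact -/

section Compact

open ContinuousLinearMap Filter

variable {E H : Type*}
  [NormedAddCommGroup E] [InnerProductSpace ℂ E] [CompleteSpace E]
  [NormedAddCommGroup H] [InnerProductSpace ℂ H] [CompleteSpace H]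

theorem enorm_opNorm_sq_le_hsNormSq (T : E →L[ℂ] H) : ‖T‖ₑ ^ 2 ≤ hsNormSq T := by
  by_cases hT : hsNormSq T = ∞
  · simp [hT]
  have h1 : ∀ x, ‖x‖ = 1 → ‖T x‖ₑ ^ 2 ≤ hsNormSq T := by
    intro x hx
    have ho : Orthonormal ℂ (fun _ : Unit => x) :=
      ⟨fun _ => hx, fun i j hij => absurd (Subsingleton.elim i j) hij⟩
    simpa using tsum_enorm_sq_le_hsNormSq ho T
  have h2 : ‖T‖ ≤ Real.sqrt (hsNormSq T).toReal := by
    refine T.opNorm_le_of_unit_norm (Real.sqrt_nonneg _) fun x hx => ?_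
    refine Real.le_sqrt_of_sq_le ?_
    have h3 := h1 x hx
    rw [enorm_sq_eq_ofReal] at h3
    exact (ENNReal.ofReal_le_iff_le_toReal hT).1 h3
  rw [enorm_sq_eq_ofReal, ENNReal.ofReal_le_iff_le_toReal hT]
  exact (Real.le_sqrt (norm_nonneg _) ENNReal.toReal_nonneg).1 h2

theorem isCompactOperator_smulRight (c : E →L[ℂ] ℂ) (y : H) :
    IsCompactOperator (c.smulRight y) := by
  have h := (isCompactOperator_id (E := ℂ)).clm_comp (ContinuousLinearMap.toSpanSingleton ℂ y)
  exact h.comp_clm c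

/-- The truncations of `T` to finitely many basis vectors have finite rank, and they converge in
operator norm because the Hilbert–Schmidt norm of the error is the tail of a convergent sum. -/
theorem isCompactOperator_of_hsNormSq_lt_top {T : E →L[ℂ] H} (hT : hsNormSq T < ∞) :
    IsCompactOperator T := by
  classical
  obtain ⟨w, b, -⟩ := exists_hilbertBasis ℂ E
  let S : Finset w → E →L[ℂ] H := fun s => ∑ i ∈ s, (innerSL ℂ (b i)).smulRight (T (b i))
  have hS : ∀ s, IsCompactOperator (S s) := by
    intro s
    induction s using Finset.induction_on with
    | empty => exact isCompactOperator_zero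
    | insert a s ha ih =>
      have : S (insert a s) = (innerSL ℂ (b a)).smulRight (T (b a)) + S s := Finset.sum_insert ha
      rw [this]
      exact (isCompactOperator_smulRight _ _).add ih
  have hSb : ∀ s j, S s (b j) = if j ∈ s then T (b j) else 0 := by
    intro s j
    have h1 : S s (b j) = ∑ i ∈ s, ⟪b i, b j⟫_ℂ • T (b i) := by simp [S]
    rw [h1]
    simp only [orthonormal_iff_ite.1 b.orthonormal, ite_smul, one_smul, zero_smul]
    rw [Finset.sum_ite_eq' s j]
  have hle : ∀ s, ‖S s - T‖ₑ ^ 2 ≤ ∑' i : {i // i ∉ s}, ‖T (b i)‖ₑ ^ 2 := by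
    intro s
    refine (enorm_opNorm_sq_le_hsNormSq _).trans (le_of_eq ?_)
    rw [hsNormSq_eq_tsum _ b]
    have : ∀ i, ‖(S s - T) (b i)‖ₑ ^ 2 =
        Set.indicator {i | i ∉ s} (fun i => ‖T (b i)‖ₑ ^ 2) i := by
      intro i
      rw [sub_apply, hSb]
      by_cases hi : i ∈ s <;> simp [hi]
    simp only [this]
    exact (tsum_subtype {i | i ∉ s} fun i => ‖T (b i)‖ₑ ^ 2).symm
  have hlim : Tendsto (fun s => ‖S s - T‖ₑ ^ 2) atTop (nhds 0) := by
    refine tendsto_of_tendsto_of_tendsto_of_le_of_le tendsto_const_nhds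
      (ENNReal.tendsto_tsum_compl_atTop_zero (f := fun i => ‖T (b i)‖ₑ ^ 2) ?_)
      (fun _ => bot_le) hle
    rw [← hsNormSq_eq_tsum T b]
    exact hT.ne
  refine isCompactOperator_of_tendsto (F := S) (l := atTop) ?_ (Eventually.of_forall hS)
  rw [tendsto_iff_norm_sub_tendsto_zero]
  have h3 := (ENNReal.tendsto_toReal (by simp : (0 : ℝ≥0∞) ≠ ∞)).comp hlim
  have h4 := h3.sqrt
  simpa [Function.comp_def, Real.sqrt_sq] using h4

end Compact

/-! ### Partial isometries, initial projections and polar factors -/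

section PartialIsometry

open ContinuousLinearMap

variable {E H G : Type*}
  [NormedAddCommGroup E] [InnerProductSpace ℂ E] [CompleteSpace E]
  [NormedAddCommGroup H] [InnerProductSpace ℂ H] [CompleteSpace H]
  [NormedAddCommGroup G] [InnerProductSpace ℂ G] [CompleteSpace G]

theorem initialProj_apply (U : E →L[ℂ] H) (x : E) : initialProj U x = adjoint U (U x) := rfl

theorem IsStarProjection.apply_apply {P : E →L[ℂ] E} (hP : IsStarProjection P) (x : E) :
    P (P x) = P x := congrArg (fun T : E →L[ℂ] E => T x) hP.isIdempotentElem.eq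

theorem IsStarProjection.inner_left {P : E →L[ℂ] E} (hP : IsStarProjection P) (x y : E) :
    ⟪P x, y⟫_ℂ = ⟪x, P y⟫_ℂ := by
  rw [← adjoint_inner_right, hP.isSelfAdjoint.adjoint_eq]

theorem IsStarProjection.mem_range_iff {P : E →L[ℂ] E} (hP : IsStarProjection P) {x : E} :
    x ∈ LinearMap.range P.toLinearMap ↔ P x = x :=
  ⟨by rintro ⟨y, rfl⟩; exact IsStarProjection.apply_apply hP y, fun h => ⟨x, h⟩⟩

theorem IsStarProjection.norm_apply_le {P : E →L[ℂ] E} (hP : IsStarProjection P) (x : E) :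
    ‖P x‖ ≤ ‖x‖ := by
  have := norm_sq_eq_add hP x
  nlinarith [norm_nonneg x, norm_nonneg (P x), sq_nonneg ‖x - P x‖]

theorem inner_self_eq_norm_sq_complex (x : E) : ⟪x, x⟫_ℂ = ((‖x‖ ^ 2 : ℝ) : ℂ) := by
  rw [inner_self_eq_norm_sq_to_K]; norm_cast

theorem IsStarProjection.norm_sq_eq_inner {P : E →L[ℂ] E} (hP : IsStarProjection P) (x : E) :
    ((‖P x‖ ^ 2 : ℝ) : ℂ) = ⟪x, P x⟫_ℂ := by
  rw [← inner_self_eq_norm_sq_complex, IsStarProjection.inner_left hP,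
    IsStarProjection.apply_apply hP]

theorem inner_map_map (U : E →L[ℂ] H) (x y : E) : ⟪U x, U y⟫_ℂ = ⟪x, initialProj U y⟫_ℂ := by
  rw [initialProj_apply, adjoint_inner_right]

theorem norm_map_of_isStarProjection {U : E →L[ℂ] H} (hU : IsStarProjection (initialProj U))
    (x : E) : ‖U x‖ = ‖initialProj U x‖ := by
  refine (sq_eq_sq₀ (norm_nonneg _) (norm_nonneg _)).1 ?_
  have h1 := inner_map_map U x x
  rw [inner_self_eq_norm_sq_complex, ← IsStarProjection.norm_sq_eq_inner hU] at h1
  exact_mod_cast h1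

theorem map_initialProj {U : E →L[ℂ] H} (hU : IsStarProjection (initialProj U)) (x : E) :
    U (initialProj U x) = U x := by
  have h : ‖U (x - initialProj U x)‖ = 0 := by
    rw [norm_map_of_isStarProjection hU, map_sub, IsStarProjection.apply_apply hU, sub_self,
      norm_zero]
  rw [norm_eq_zero, map_sub, sub_eq_zero] at h
  exact h.symm

theorem map_eq_zero_iff_initialProj {U : E →L[ℂ] H} (hU : IsStarProjection (initialProj U))
    (x : E) : U x = 0 ↔ initialProj U x = 0 := by
  rw [← norm_eq_zero, norm_map_of_isStarProjection hU, norm_eq_zero]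

theorem isStarProjection_of_idempotent_inner {P : E →L[ℂ] E} (h1 : ∀ x, P (P x) = P x)
    (h2 : adjoint P = P) : IsStarProjection P :=
  ⟨ContinuousLinearMap.ext h1, h2⟩

theorem adjoint_initialProj (U : E →L[ℂ] H) : adjoint (initialProj U) = initialProj U := by
  rw [initialProj, adjoint_comp, adjoint_adjoint]

theorem isStarProjection_initialProj_adjoint {U : E →L[ℂ] H}
    (hU : IsStarProjection (initialProj U)) : IsStarProjection (initialProj (adjoint U)) := by
  refine isStarProjection_of_idempotent_inner (fun x => ?_) (adjoint_initialProj _)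
  simp only [initialProj_apply, adjoint_adjoint]
  rw [← initialProj_apply, map_initialProj hU]

theorem isStarProjection_sub {P I : E →L[ℂ] E} (hP : IsStarProjection P)
    (hI : IsStarProjection I) (h : ∀ x, P (I x) = I x) :
    IsStarProjection (P - I) ∧ ∀ x, I (P x) = I x := by
  have h' : ∀ x, I (P x) = I x := by
    intro x
    refine ext_inner_left ℂ fun y => ?_
    rw [← IsStarProjection.inner_left hI, ← IsStarProjection.inner_left hP, h,
      IsStarProjection.inner_left hI]
  refine ⟨isStarProjection_of_idempotent_inner (fun x => ?_) ?_, h'⟩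
  · simp only [sub_apply, map_sub, h, h', IsStarProjection.apply_apply hP,
      IsStarProjection.apply_apply hI]
    abel
  · rw [map_sub, hP.isSelfAdjoint.adjoint_eq, hI.isSelfAdjoint.adjoint_eq]

/-- Over `ℂ` an operator is determined by its quadratic form, and the two quadratic forms are `‖U
x‖²` and `‖P x‖²`. -/
theorem initialProj_eq_of_norm {U : E →L[ℂ] H} {P : E →L[ℂ] E} (hP : IsStarProjection P)
    (h : ∀ x, ‖U x‖ = ‖P x‖) : initialProj U = P := by
  have : (initialProj U).toLinearMap = P.toLinearMap := by
    rw [← ext_inner_map]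
    intro x
    change ⟪initialProj U x, x⟫_ℂ = ⟪P x, x⟫_ℂ
    rw [initialProj_apply, adjoint_inner_left, IsStarProjection.inner_left hP,
      ← IsStarProjection.norm_sq_eq_inner hP, ← h, inner_self_eq_norm_sq_complex]
  exact ContinuousLinearMap.coe_injective this

theorem IsPolarFactor.isStarProjection_initialProj {F U : E →L[ℂ] H} (h : IsPolarFactor F U) :
    IsStarProjection (initialProj U) := by
  have hc : IsClosed (LinearMap.ker U.toLinearMap : Set E) := U.isClosed_ker
  have : CompleteSpace (LinearMap.ker U.toLinearMap) := hc.completeSpace_coe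
  set P := (LinearMap.ker U.toLinearMap)ᗮ.starProjection with hPdef
  have hP : IsStarProjection P := isStarProjection_starProjection
  have h1 : ∀ x, U x = U (P x) := by
    intro x
    have h2 : x - P x ∈ (LinearMap.ker U.toLinearMap)ᗮᗮ :=
      Submodule.sub_starProjection_mem_orthogonal x
    rw [Submodule.orthogonal_orthogonal] at h2
    have h3 : U (x - P x) = 0 := h2
    rwa [map_sub, sub_eq_zero] at h3
  rw [initialProj_eq_of_norm hP fun x => by
    rw [h1]
    exact h.isometry_on _ (Submodule.starProjection_apply_mem _ x)]
  exact hP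

theorem IsPolarFactor.map_eq_zero_iff {F U : E →L[ℂ] H} (h : IsPolarFactor F U) (x : E) :
    U x = 0 ↔ F x = 0 := by
  have := h.ker_eq
  rw [SetLike.ext_iff] at this
  exact this x

theorem IsPolarFactor.apply_absOp {F U : E →L[ℂ] H} (h : IsPolarFactor F U) (x : E) :
    U (absOp F x) = F x := (DFunLike.congr_fun h.eq_comp x).symm

theorem IsPolarFactor.adjoint_apply {F U : E →L[ℂ] H} (h : IsPolarFactor F U) (y : H) :
    adjoint F y = absOp F (adjoint U y) := by
  conv_lhs => rw [h.eq_comp, adjoint_comp, (isSelfAdjoint_absOp F).adjoint_eq]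
  rfl

theorem absOp_eq_zero_iff (F : E →L[ℂ] H) (x : E) : absOp F x = 0 ↔ F x = 0 := by
  rw [← norm_eq_zero, norm_absOp_apply, norm_eq_zero]

/-- From `F* = |F| U*`: if `F* y = 0`, then `U* y` lies in `ker |F| = ker U`, so `‖U* y‖² = ⟪y, U U*
y⟫ = 0`. -/
theorem IsPolarFactor.adjoint_eq_zero_iff {F U : E →L[ℂ] H} (h : IsPolarFactor F U) (y : H) :
    adjoint U y = 0 ↔ adjoint F y = 0 := by
  rw [h.adjoint_apply]
  refine ⟨fun h1 => by rw [h1, map_zero], fun h1 => ?_⟩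
  rw [absOp_eq_zero_iff, ← h.map_eq_zero_iff] at h1
  have h2 : ‖adjoint U y‖ ^ 2 = 0 := by
    have : ⟪adjoint U y, adjoint U y⟫_ℂ = 0 := by
      rw [adjoint_inner_left, h1, inner_zero_right]
    rw [inner_self_eq_norm_sq_complex] at this
    exact_mod_cast this
  rwa [sq_eq_zero_iff, norm_eq_zero] at h2

end PartialIsometry

/-! ### The trace formula for the index of a pair of projections -/

section PairOfProjections

open ContinuousLinearMap

variable {E : Type*} [NormedAddCommGroup E] [InnerProductSpace ℂ E] [CompleteSpace E]

/-- `I` projects onto `(ker Q P)ᗮ`, so `P - I` projects onto `ker Q ∩ ran P`. There `1 - Q` is the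
identity, and its contribution is the dimension. -/
theorem hsNormSq_one_sub_comp {P Q I : E →L[ℂ] E} (hP : IsStarProjection P)
    (hI : IsStarProjection I) (hker : ∀ x, I x = 0 ↔ Q (P x) = 0) :
    (∀ x, P (I x) = I x) ∧ hsNormSq ((1 - Q) ∘L P) = hsNormSq ((1 - Q) ∘L I) +
      dimENat (LinearMap.ker Q.toLinearMap ⊓ LinearMap.range P.toLinearMap) := by
  have h1 : ∀ x, I (P x) = I x := by
    intro x
    have : I (x - P x) = 0 := by
      rw [hker, map_sub, IsStarProjection.apply_apply hP, sub_self, map_zero]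
    rw [map_sub, sub_eq_zero] at this
    exact this.symm
  have h2 : ∀ x, P (I x) = I x := by
    intro x
    refine ext_inner_left ℂ fun y => ?_
    rw [← IsStarProjection.inner_left hP, ← IsStarProjection.inner_left hI, h1,
      IsStarProjection.inner_left hI]
  refine ⟨h2, ?_⟩
  have hN := (isStarProjection_sub hP hI h2).1
  have hrange : LinearMap.range (P - I).toLinearMap =
      LinearMap.ker Q.toLinearMap ⊓ LinearMap.range P.toLinearMap := by
    ext x
    rw [Submodule.mem_inf, IsStarProjection.mem_range_iff hN, IsStarProjection.mem_range_iff hP,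
      LinearMap.mem_ker, sub_apply]
    change _ ↔ Q x = 0 ∧ _
    constructor
    · intro h
      have h3 : P x = x := by
        have := congrArg P h
        rw [map_sub, IsStarProjection.apply_apply hP, h2] at this
        exact this.symm.trans h
      refine ⟨?_, h3⟩
      rw [h3, sub_eq_self, hker, h3] at h
      exact h
    · rintro ⟨h3, h4⟩
      have : I x = 0 := by rw [hker, h4, h3]
      rw [this, h4, sub_zero]
  rw [hsNormSq_eq_add hI, ← hrange, ← hsNormSq_starProjection hN]
  congr 1
  · refine hsNormSq_congr fun x => ?_
    simp only [ContinuousLinearMap.comp_apply, h2]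
  · refine hsNormSq_congr fun x => ?_
    have h3 : P ((1 - I) x) = (P - I) x := by
      change P (x - I x) = P x - I x
      rw [map_sub, h2]
    have h4 : Q ((P - I) x) = 0 := by
      have : (P - I) x ∈ LinearMap.ker Q.toLinearMap ⊓ LinearMap.range P.toLinearMap :=
        hrange ▸ ⟨x, rfl⟩
      exact this.1
    rw [ContinuousLinearMap.comp_apply, ContinuousLinearMap.comp_apply, h3]
    change ‖(P - I) x - Q ((P - I) x)‖ = _
    rw [h4, sub_zero]

theorem norm_sub_apply_sq {P : E →L[ℂ] E} (hP : IsStarProjection P) (x : E) :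
    ‖x - P x‖ ^ 2 = ‖x‖ ^ 2 - ‖P x‖ ^ 2 := by
  rw [norm_sq_eq_add hP x]; ring

/-- The traces of `P (1 - Q) P` and `Q (1 - P) Q` differ by the index of the pair `(P, Q)`. -/
theorem hsNormSq_pair {P Q : E →L[ℂ] E} (hP : IsStarProjection P) (hQ : IsStarProjection Q) :
    hsNormSq ((1 - P) ∘L Q) +
        dimENat (LinearMap.ker Q.toLinearMap ⊓ LinearMap.range P.toLinearMap) =
      hsNormSq ((1 - Q) ∘L P) +
        dimENat (LinearMap.range Q.toLinearMap ⊓ LinearMap.ker P.toLinearMap) := by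
  set B := Q ∘L P with hB
  -- The polar factor `V` of `Q P` maps the part of `ran P` orthogonal to `ker Q` isometrically onto
  -- the part of `ran Q` orthogonal to `ker P`. What remains on either side is the dimension term
  -- split off in `h1` and `h2`.
  obtain ⟨V, hV⟩ := (existsUnique_isPolarFactor B).exists
  have hI := hV.isStarProjection_initialProj
  have hJ := isStarProjection_initialProj_adjoint hI
  have hBadj : adjoint B = P ∘L Q := by
    rw [hB, adjoint_comp, hP.isSelfAdjoint.adjoint_eq, hQ.isSelfAdjoint.adjoint_eq]
  obtain ⟨hPI, h1⟩ := hsNormSq_one_sub_comp hP hI fun x => by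
    rw [← map_eq_zero_iff_initialProj hI, hV.map_eq_zero_iff]; rfl
  obtain ⟨hQJ, h2⟩ := hsNormSq_one_sub_comp hQ hJ fun x => by
    rw [← map_eq_zero_iff_initialProj hJ, hV.adjoint_eq_zero_iff, hBadj]; rfl
  have hJ' : ∀ y, initialProj (adjoint V) y = V (adjoint V y) := fun y => by
    rw [initialProj_apply, adjoint_adjoint]
  have hQV : ∀ x, Q (V x) = V x := fun x => by
    have := hQJ (V x)
    rwa [hJ', ← initialProj_apply, map_initialProj hI] at this
  -- `P V x = (Q P)* V x = |Q P| V* V x` has the norm of `Q V* V x`, and `V x` has the norm of `V* V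
  -- x`; hence the complementary parts also agree.
  have h3 : ∀ x, ‖((1 - P) ∘L V) x‖ = ‖((1 - Q) ∘L initialProj V) x‖ := by
    intro x
    change ‖V x - P (V x)‖ = ‖initialProj V x - Q (initialProj V x)‖
    refine (sq_eq_sq₀ (norm_nonneg _) (norm_nonneg _)).1 ?_
    rw [norm_sub_apply_sq hP, norm_sub_apply_sq hQ, norm_map_of_isStarProjection hI]
    have h4 : P (V x) = absOp B (initialProj V x) := by
      rw [initialProj_apply, ← hV.adjoint_apply, hBadj, ContinuousLinearMap.comp_apply, hQV]
    rw [h4, norm_absOp_apply, hB, ContinuousLinearMap.comp_apply, hPI]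
  -- `(1 - P) V V*` and `(1 - P) V` arise from each other by composing on the right with the
  -- contractions `V` and `V*`.
  have h5 : hsNormSq ((1 - P) ∘L initialProj (adjoint V)) =
      hsNormSq ((1 - Q) ∘L initialProj V) := by
    rw [← hsNormSq_congr h3]
    have hnorm : ∀ {G K : Type _} [NormedAddCommGroup G] [InnerProductSpace ℂ G]
        [CompleteSpace G] [NormedAddCommGroup K] [InnerProductSpace ℂ K] [CompleteSpace K]
        (W : G →L[ℂ] K), IsStarProjection (initialProj W) → ‖W‖ₑ ^ 2 ≤ 1 := by
      intro G K _ _ _ _ _ _ W hW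
      have : ‖W‖ ≤ 1 := W.opNorm_le_bound zero_le_one fun x => by
        rw [norm_map_of_isStarProjection hW, one_mul]
        exact IsStarProjection.norm_apply_le hW x
      rw [enorm_sq_eq_ofReal, ENNReal.ofReal_le_one]
      nlinarith [norm_nonneg W]
    have e1 : (1 - P) ∘L initialProj (adjoint V) = ((1 - P) ∘L V) ∘L adjoint V := by
      ext x
      simp only [ContinuousLinearMap.comp_apply, hJ']
    have e2 : (1 - P) ∘L V = ((1 - P) ∘L initialProj (adjoint V)) ∘L V := by
      ext x
      simp only [ContinuousLinearMap.comp_apply, hJ']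
      rw [← initialProj_apply, map_initialProj hI]
    refine le_antisymm ?_ ?_
    · rw [e1]
      exact (hsNormSq_comp_le' _ _).trans (mul_le_of_le_one_left' (hnorm _ hJ))
    · conv_lhs => rw [e2]
      exact (hsNormSq_comp_le' _ _).trans (mul_le_of_le_one_left' (hnorm _ hI))
  rw [h1, h2, h5, inf_comm (LinearMap.ker P.toLinearMap)]
  ring

end PairOfProjections

/-! ### Diagonalization of `|F|` -/

section Spectral

open ContinuousLinearMap Filter
open scoped ComplexOrder

variable {E H : Type*}
  [NormedAddCommGroup E] [InnerProductSpace ℂ E] [CompleteSpace E]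
  [NormedAddCommGroup H] [InnerProductSpace ℂ H] [CompleteSpace H]

/-- By Bessel, each `b n` has nonzero inner product with only countably many `v i`; by Parseval,
each `v i` has one with some `b n`. -/
theorem countable_of_orthonormal {ι κ : Type*} [Countable κ] (b : HilbertBasis κ ℂ E)
    {v : ι → E} (hv : Orthonormal ℂ v) : Countable ι := by
  have h1 : ∀ n, {i | ‖⟪v i, b n⟫_ℂ‖ ^ 2 ≠ 0}.Countable := fun n =>
    (hv.inner_products_summable (b n)).countable_support
  rw [← Set.countable_univ_iff]
  refine (Set.countable_iUnion h1).mono fun i _ => ?_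
  rw [Set.mem_iUnion]
  by_contra hcon
  push Not at hcon
  have h2 : ∀ n, ‖⟪b n, v i⟫_ℂ‖ₑ ^ 2 = 0 := fun n => by
    have h3 : ‖⟪v i, b n⟫_ℂ‖ ^ 2 = 0 := by
      by_contra h
      exact hcon n h
    rw [enorm_sq_eq_ofReal, norm_inner_symm, h3, ENNReal.ofReal_zero]
  have h4 : ∑' n, ‖⟪b n, v i⟫_ℂ‖ₑ ^ 2 = ‖v i‖ₑ ^ 2 :=
    (isBasisOf_hilbertBasis_one b).tsum_enorm_sq (v i)
  rw [enorm_sq_eq_ofReal, hv.1 i] at h4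
  simp [h2] at h4

/-- Multiplicities are only recorded in `ℕ∞`, which does not separate infinite cardinals.
Countability is what allows an orthonormal basis of an eigenspace to be indexed by the `j` with `s j
= t`. -/
theorem nonempty_equiv_of_card_eq {α β : Type*} [Countable α] [Countable β]
    (h : ENat.card α = ENat.card β) : Nonempty (α ≃ β) := by
  rcases finite_or_infinite α with hα | hα
  · have hβ : Finite β := by
      rw [← ENat.card_lt_top, ← h, ENat.card_lt_top]; exact hα
    refine Finite.card_eq.1 ?_
    rw [ENat.card_eq_coe_natCard, ENat.card_eq_coe_natCard] at h
    exact_mod_cast h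
  · have hβ : Infinite β := by
      rw [← ENat.card_eq_top, ← h, ENat.card_eq_top]; exact hα
    exact nonempty_equiv_of_countable

theorem isBasisOf_of_total {ι : Type*} {v : ι → E} {P : E →L[ℂ] E} (hv : Orthonormal ℂ v)
    (hP : IsStarProjection P) (hPv : ∀ i, P (v i) = v i)
    (htot : ∀ x, P x = x → (∀ i, ⟪v i, x⟫_ℂ = 0) → x = 0) : IsBasisOf v P := by
  obtain ⟨h1, h2⟩ := isStarProjection_iff_eq_starProjection_range.1 hP
  set M := LinearMap.range P.toLinearMap with hM
  have hc : IsClosed (M : Set E) := by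
    have := hP.isIdempotentElem.isClosed_range
    simpa using this
  have : CompleteSpace M := hc.completeSpace_coe
  let v' : ι → M := fun i => ⟨v i, (IsStarProjection.mem_range_iff hP).2 (hPv i)⟩
  have hv' : Orthonormal ℂ v' := by
    have : Orthonormal ℂ (M.subtypeₗᵢ ∘ v') := hv
    rwa [LinearIsometry.orthonormal_comp_iff] at this
  have hb : (Submodule.span ℂ (Set.range v'))ᗮ = ⊥ := by
    rw [Submodule.eq_bot_iff]
    intro x hx
    have h3 : ∀ i, ⟪v i, (x : E)⟫_ℂ = 0 := fun i =>
      (Submodule.mem_orthogonal _ _).1 hx (v' i) (Submodule.subset_span ⟨i, rfl⟩)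
    exact Subtype.ext (htot x ((IsStarProjection.mem_range_iff hP).1 x.2) h3)
  have h4 := isBasisOf_hilbertBasis (HilbertBasis.mkOfOrthogonalEqBot hv' hb)
  rw [HilbertBasis.coe_mkOfOrthogonalEqBot] at h4
  have h5 : M.starProjection = P := h2.symm
  rw [h5] at h4
  exact h4

theorem IsBasisOf.eq_zero {ι : Type*} {v : ι → E} {P : E →L[ℂ] E} (h : IsBasisOf v P) {x : E}
    (hx : P x = x) (h0 : ∀ i, ⟪v i, x⟫_ℂ = 0) : x = 0 := by
  have h1 := h.hasSum x
  simp only [h0, zero_smul, hx] at h1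
  exact h1.unique hasSum_zero

theorem IsBasisOf.apply_eq_zero {ι : Type*} {v : ι → E} {P : E →L[ℂ] E} (h : IsBasisOf v P) {x : E}
    (h0 : ∀ i, ⟪v i, x⟫_ℂ = 0) : P x = 0 := by
  have h1 := h.hasSum x
  simp only [h0, zero_smul] at h1
  exact h1.unique hasSum_zero

theorem mem_singularSpace {F : E →L[ℂ] H} {t : ℝ} {x : E} :
    x ∈ singularSpace F t ↔ absOp F x = (t : ℂ) • x := by
  rw [singularSpace, LinearMap.mem_ker]
  exact sub_eq_zero

theorem isClosed_singularSpace (F : E →L[ℂ] H) (t : ℝ) : IsClosed (singularSpace F t : Set E) :=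
  (absOp F - (t : ℂ) • ContinuousLinearMap.id ℂ E).isClosed_ker

theorem inner_absOp_left (F : E →L[ℂ] H) (x y : E) : ⟪absOp F x, y⟫_ℂ = ⟪x, absOp F y⟫_ℂ := by
  rw [← adjoint_inner_right, (isSelfAdjoint_absOp F).adjoint_eq]

theorem IsPolarFactor.absOp_initialProj {F U : E →L[ℂ] H} (h : IsPolarFactor F U) (x : E) :
    absOp F (initialProj U x) = absOp F x := by
  have h1 : absOp F (x - initialProj U x) = 0 := by
    rw [absOp_eq_zero_iff, ← h.map_eq_zero_iff, map_sub,
      map_initialProj h.isStarProjection_initialProj, sub_self]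
  rw [map_sub, sub_eq_zero] at h1
  exact h1.symm

theorem IsPolarFactor.initialProj_absOp {F U : E →L[ℂ] H} (h : IsPolarFactor F U) (x : E) :
    initialProj U (absOp F x) = absOp F x := by
  refine ext_inner_left ℂ fun y => ?_
  rw [← IsStarProjection.inner_left h.isStarProjection_initialProj, ← inner_absOp_left,
    h.absOp_initialProj, inner_absOp_left]

theorem IsPolarFactor.initialProj_of_mem {F U : E →L[ℂ] H} (h : IsPolarFactor F U) {t : ℝ}
    (ht : 0 < t) {x : E} (hx : x ∈ singularSpace F t) : initialProj U x = x := by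
  rw [mem_singularSpace] at hx
  have h1 := h.initialProj_absOp x
  rw [hx, map_smul] at h1
  exact smul_right_injective E (by exact_mod_cast ht.ne' : (t : ℂ) ≠ 0) h1

theorem inner_eq_zero_of_mem_singularSpace {F : E →L[ℂ] H} {t r : ℝ} (htr : t ≠ r) {x y : E}
    (hx : x ∈ singularSpace F t) (hy : y ∈ singularSpace F r) : ⟪x, y⟫_ℂ = 0 := by
  rw [mem_singularSpace] at hx hy
  have h1 := inner_absOp_left F x y
  rw [hx, hy, inner_smul_left, inner_smul_right, Complex.conj_ofReal] at h1
  have h2 : ((t : ℂ) - (r : ℂ)) * ⟪x, y⟫_ℂ = 0 := by rw [sub_mul, h1, sub_self]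
  refine (mul_eq_zero.1 h2).resolve_left fun h3 => htr ?_
  exact_mod_cast sub_eq_zero.1 h3

theorem absOp_nonneg (F : E →L[ℂ] H) (x : E) : 0 ≤ ⟪x, absOp F x⟫_ℂ := by
  have h : (absOp F).IsPositive := (nonneg_iff_isPositive _).1 (CFC.sqrt_nonneg _)
  exact h.inner_nonneg_right x

theorem eq_zero_of_forall_eigenvector {T : E →L[ℂ] E} (hT : IsCompactOperator T)
    (hT' : IsSelfAdjoint T) {x : E} (hx : ∀ (μ : ℂ) (v : E), T v = μ • v → ⟪v, x⟫_ℂ = 0) :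
    x = 0 := by
  have hbot := orthogonalComplement_iSup_eigenspaces_eq_bot hT hT'.isSymmetric
  have hmem : x ∈ (⨆ μ, Module.End.eigenspace (T : Module.End ℂ E) μ)ᗮ := by
    rw [← Submodule.iInf_orthogonal, Submodule.mem_iInf]
    exact fun μ => (Submodule.mem_orthogonal _ _).2 fun v hv =>
      hx μ v (Module.End.mem_eigenspace_iff.1 hv)
  rw [hbot] at hmem
  exact (Submodule.mem_bot ℂ).1 hmem

theorem exists_pos_of_absOp_eq_smul {F : E →L[ℂ] H} {w : E} (hw0 : absOp F w ≠ 0) {c : ℂ}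
    (hw : absOp F w = c • w) : ∃ t : ℝ, 0 < t ∧ (t : ℂ) = c := by
  have hwne : w ≠ 0 := fun h => hw0 (by rw [h, map_zero])
  have h3 := absOp_nonneg F w
  rw [hw, inner_smul_right, inner_self_eq_norm_sq_complex] at h3
  have hpos : (0 : ℝ) < ‖w‖ ^ 2 := by positivity
  have h6 := Complex.nonneg_iff.1 h3
  rw [Complex.re_mul_ofReal, Complex.im_mul_ofReal] at h6
  have him : c.im = 0 := (mul_eq_zero.1 h6.2.symm).resolve_right hpos.ne'
  have hre : 0 ≤ c.re := nonneg_of_mul_nonneg_left h6.1 hpos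
  have hc : (c.re : ℂ) = c := Complex.ext (by simp) (by simp [him])
  refine ⟨c.re, lt_of_le_of_ne hre fun h => hw0 ?_, hc⟩
  rw [hw, ← hc, ← h, Complex.ofReal_zero, zero_smul]

/-- Applying `P = U* U` to the eigenvalue equation shows that `|F|` multiplies `P v` by `1 + μ`.
Since `|F|` is positive and injective on `ran P`, this factor is real and positive unless `P v = 0`.
-/
theorem IsPolarFactor.initialProj_of_eigenvector {F U : E →L[ℂ] H} (hU : IsPolarFactor F U)
    {μ : ℂ} {v : E} (hv : absOp F v - initialProj U v = μ • v) :
    initialProj U v = 0 ∨ ∃ t : ℝ, 0 < t ∧ initialProj U v ∈ singularSpace F t := by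
  have hP := hU.isStarProjection_initialProj
  refine or_iff_not_imp_left.2 fun hne => ?_
  have hMw : absOp F (initialProj U v) = (1 + μ) • initialProj U v := by
    have h2 := congrArg (initialProj U) hv
    rw [map_sub, hU.initialProj_absOp, map_smul, IsStarProjection.apply_apply hP] at h2
    rw [add_smul, one_smul, ← h2, hU.absOp_initialProj]
    abel
  have hM0 : absOp F (initialProj U v) ≠ 0 := by
    rwa [Ne, absOp_eq_zero_iff, ← hU.map_eq_zero_iff, map_eq_zero_iff_initialProj hP,
      IsStarProjection.apply_apply hP]
  obtain ⟨t, ht, htc⟩ := exists_pos_of_absOp_eq_smul hM0 hMw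
  exact ⟨t, ht, by rw [mem_singularSpace, htc, hMw]⟩

theorem exists_orthonormal_singularSpace {κ : Type*} [Countable κ] (e : HilbertBasis κ ℂ E)
    {ι : Type*} [Countable ι] {F : E →L[ℂ] H} {s : ι → ℝ} (hs : IsNonzeroSingularValues F s)
    {t : ℝ} (ht : 0 < t) : ∃ b : {j // s j = t} → E, Orthonormal ℂ b ∧
      (∀ i, b i ∈ singularSpace F t) ∧
      ∀ x ∈ singularSpace F t, (∀ i, ⟪b i, x⟫_ℂ = 0) → x = 0 := by
  have : CompleteSpace (singularSpace F t) := (isClosed_singularSpace F t).completeSpace_coe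
  obtain ⟨w, b, -⟩ := exists_hilbertBasis ℂ (singularSpace F t)
  have hb := isBasisOf_hilbertBasis b
  have : Countable w := countable_of_orthonormal e hb.orthonormal
  obtain ⟨σ⟩ : Nonempty ({j // s j = t} ≃ w) := by
    refine nonempty_equiv_of_card_eq ?_
    rw [← card_hilbertBasis_eq_dimENat b, ← hs.multiplicity t ht]
    rfl
  refine ⟨fun i => b (σ i), hb.orthonormal.comp σ σ.injective, fun i => (b (σ i)).2, ?_⟩
  intro x hx h0
  refine hb.eq_zero ?_ fun i => ?_
  · rwa [Submodule.starProjection_eq_self_iff]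
  · have := h0 (σ.symm i)
    simpa using this

theorem exists_orthonormal_eigenvectors {κ : Type*} [Countable κ] (e : HilbertBasis κ ℂ E)
    {ι : Type*} [Countable ι] {F : E →L[ℂ] H} {s : ι → ℝ} (hs : IsNonzeroSingularValues F s) :
    ∃ g : ι → E, Orthonormal ℂ g ∧ (∀ j, g j ∈ singularSpace F (s j)) ∧
      ∀ t : ℝ, 0 < t → ∀ x ∈ singularSpace F t, (∀ j, ⟪g j, x⟫_ℂ = 0) → x = 0 := by
  choose b hbo hbm hbt using fun (t : ℝ) (ht : 0 < t) =>
    exists_orthonormal_singularSpace e hs ht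
  -- The bases depend on `t` through their index types. Stating the choice for every `t` with `s i =
  -- t` lets `g i` and `g j` be compared inside one basis when `s i = s j`.
  obtain ⟨g, hg⟩ : ∃ g : ι → E, ∀ (t : ℝ) (ht : 0 < t) (i : ι) (hi : s i = t),
      g i = b t ht ⟨i, hi⟩ := by
    refine ⟨fun j => b (s j) (hs.pos j) ⟨j, rfl⟩, fun t ht i hi => ?_⟩
    subst hi
    rfl
  have hgm : ∀ j, g j ∈ singularSpace F (s j) := fun j => by
    rw [hg _ (hs.pos j) j rfl]
    exact hbm _ _ _
  refine ⟨g, ⟨fun j => ?_, fun i j hij => ?_⟩, hgm, fun t ht x hx h0 => ?_⟩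
  · rw [hg _ (hs.pos j) j rfl]
    exact (hbo _ _).1 _
  · by_cases hsij : s i = s j
    · change ⟪g i, g j⟫_ℂ = 0
      rw [hg _ (hs.pos j) i hsij, hg _ (hs.pos j) j rfl]
      exact (hbo _ _).2 fun h => hij (congrArg Subtype.val h)
    · exact inner_eq_zero_of_mem_singularSpace hsij (hgm i) (hgm j)
  · refine hbt t ht x hx ?_
    rintro ⟨i, hi⟩
    rw [← hg]
    exact h0 i

/-- If `|F|` is a compact perturbation of the support projection of `F`, then `|F|` is
diagonalized by an orthonormal basis of the orthogonal complement of `ker F`. -/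
theorem exists_singular_basis {κ : Type*} [Countable κ] (e : HilbertBasis κ ℂ E)
    {ι : Type*} [Countable ι] {F U : E →L[ℂ] H} (hU : IsPolarFactor F U)
    (hcpt : IsCompactOperator (absOp F - initialProj U))
    {s : ι → ℝ} (hs : IsNonzeroSingularValues F s) :
    ∃ g : ι → E, IsBasisOf g (initialProj U) ∧ ∀ j, absOp F (g j) = (s j : ℂ) • g j := by
  have hP := hU.isStarProjection_initialProj
  obtain ⟨g, hgo, hgm, hgt⟩ := exists_orthonormal_eigenvectors e hs
  refine ⟨g, isBasisOf_of_total hgo hP (fun i => hU.initialProj_of_mem (hs.pos i) (hgm i)) ?_,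
    fun j => mem_singularSpace.1 (hgm j)⟩
  intro x hPx hx
  -- The component of `x` in the eigenspace of `t` is orthogonal to every `g i`: to those with `s i
  -- = t` by the choice of `x`, to the others because eigenspaces are orthogonal.
  have h1 : ∀ t : ℝ, 0 < t → ∀ v ∈ singularSpace F t, ⟪v, x⟫_ℂ = 0 := by
    intro t ht
    have : CompleteSpace (singularSpace F t) := (isClosed_singularSpace F t).completeSpace_coe
    have h2 : (singularSpace F t).starProjection x = 0 := by
      refine hgt t ht _ (Submodule.starProjection_apply_mem _ _) fun i => ?_
      rw [← Submodule.inner_starProjection_left_eq_right]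
      by_cases hi : s i = t
      · rw [Submodule.starProjection_eq_self_iff.2 (hi ▸ hgm i)]
        exact hx i
      · rw [(Submodule.starProjection_apply_eq_zero_iff _).2, inner_zero_left]
        exact (Submodule.mem_orthogonal _ _).2 fun v hv =>
          inner_eq_zero_of_mem_singularSpace (Ne.symm hi) hv (hgm i)
    rw [Submodule.starProjection_apply_eq_zero_iff] at h2
    exact fun v hv => (Submodule.mem_orthogonal _ _).1 h2 v hv
  -- The eigenvectors of the compact self-adjoint operator `|F| - P` span a dense subspace. As `x =
  -- P x`, only the components `P v` of these vectors matter.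
  refine eq_zero_of_forall_eigenvector hcpt
    ((isSelfAdjoint_absOp F).sub hP.isSelfAdjoint) fun μ v hv => ?_
  rw [← hPx, ← IsStarProjection.inner_left hP]
  rcases hU.initialProj_of_eigenvector hv with h2 | ⟨t, ht, h2⟩
  · rw [h2, inner_zero_left]
  · exact h1 t ht _ h2

theorem mem_singularSpace_of_inner_eq_zero {ι : Type*} {F : E →L[ℂ] H} {P : E →L[ℂ] E}
    {s : ι → ℝ} {g : ι → E} (hg : IsBasisOf g P) (hgs : ∀ j, absOp F (g j) = (s j : ℂ) • g j)
    {t : ℝ} {w : E} (hw : P w = w) (h0 : ∀ j, s j ≠ t → ⟪g j, w⟫_ℂ = 0) :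
    w ∈ singularSpace F t := by
  rw [mem_singularSpace]
  have h1 := hg.hasSum w
  rw [hw] at h1
  refine (h1.mapL (absOp F)).unique ?_
  have h2 := h1.const_smul (t : ℂ)
  convert! h2 using 2 with j
  rw [map_smul, hgs, smul_comm]
  by_cases hj : s j = t
  · rw [hj]
  · rw [h0 j hj, zero_smul, smul_zero, smul_zero]

end Spectral

/-! ### Frames and their synthesis operators -/

section Frames

open ContinuousLinearMap

variable {E H : Type*}
  [NormedAddCommGroup E] [InnerProductSpace ℂ E] [CompleteSpace E]
  [NormedAddCommGroup H] [InnerProductSpace ℂ H] [CompleteSpace H]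

/-- The standard basis of `ℓ²` as a Hilbert basis. -/
def stdHilbertBasis : HilbertBasis ℕ ℂ EllTwo :=
  HilbertBasis.ofRepr (LinearIsometryEquiv.refl ℂ EllTwo)

theorem stdHilbertBasis_apply (i : ℕ) : stdHilbertBasis i = stdBasis i := by
  rw [← stdHilbertBasis.repr_symm_single]
  rfl

theorem sqDist_eq_hsNormSq {f x : ℕ → H} {F X : EllTwo →L[ℂ] H} (hF : IsSynthesis f F)
    (hX : IsSynthesis x X) : sqDist f x = hsNormSq (F - X) := by
  rw [sqDist, hsNormSq_eq_tsum _ stdHilbertBasis]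
  refine tsum_congr fun i => ?_
  rw [stdHilbertBasis_apply, sub_apply, hF i, hX i]

theorem IsSynthesis.hasSum {f : ℕ → H} {F : EllTwo →L[ℂ] H} (hF : IsSynthesis f F) (h : H) :
    HasSum (fun i => ‖⟪h, f i⟫_ℂ‖ ^ 2) (‖adjoint F h‖ ^ 2) := by
  have h1 : HasSum _ (‖adjoint F h‖ ^ 2) :=
    (isBasisOf_hilbertBasis_one stdHilbertBasis).hasSum_norm_sq (adjoint F h)
  convert! h1 using 3 with i
  rw [adjoint_inner_right, stdHilbertBasis_apply, hF i, norm_inner_symm]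

theorem IsParsevalFrameIn.isFrameIn {x : ℕ → H} {L : Submodule ℂ H} (h : IsParsevalFrameIn x L) :
    IsFrameIn x L := ⟨1, 1, one_pos, one_pos, h⟩

theorem IsSynthesis.adjoint_eq_zero {f : ℕ → H} {F : EllTwo →L[ℂ] H} (hF : IsSynthesis f F)
    {K : Submodule ℂ H} (hK : ∀ i, f i ∈ K) {h : H} (hh : h ∈ Kᗮ) : adjoint F h = 0 := by
  have h1 := hF.hasSum h
  have h2 : ∀ i, ⟪h, f i⟫_ℂ = 0 := fun i => (Submodule.mem_orthogonal' _ _).1 hh _ (hK i)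
  simp only [h2, norm_zero, ne_eq, OfNat.ofNat_ne_zero, not_false_eq_true, zero_pow] at h1
  simpa using h1.unique hasSum_zero

/-- The Parseval identity makes `X*` isometric on `L`, and `X*` vanishes on `Lᗮ`. So `X X*` is the
projection onto `L`, and then `X* X` is a projection too. -/
theorem IsParsevalFrameIn.isStarProjection {x : ℕ → H} {L : Submodule ℂ H}
    (h : IsParsevalFrameIn x L) {X : EllTwo →L[ℂ] H} (hX : IsSynthesis x X) :
    IsStarProjection (initialProj X) := by
  have : CompleteSpace L := h.isClosed.completeSpace_coe
  have hR : IsStarProjection L.starProjection := isStarProjection_starProjection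
  have h1 : initialProj (adjoint X) = L.starProjection := by
    refine initialProj_eq_of_norm hR fun v => ?_
    have h2 : adjoint X v = adjoint X (L.starProjection v) := by
      rw [← sub_eq_zero, ← map_sub]
      exact hX.adjoint_eq_zero h.mem (Submodule.sub_starProjection_mem_orthogonal v)
    have hm : L.starProjection v ∈ L := Submodule.starProjection_apply_mem _ v
    have h3 := h.lower _ hm
    have h4 := h.upper _ hm
    rw [(hX.hasSum _).tsum_eq, one_mul] at h3 h4
    rw [h2]
    exact (sq_eq_sq₀ (norm_nonneg _) (norm_nonneg _)).1 (le_antisymm h4 h3)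
  have h2 := isStarProjection_initialProj_adjoint (h1 ▸ hR : IsStarProjection _)
  rwa [adjoint_adjoint] at h2

theorem isParsevalFrameIn_range {X : EllTwo →L[ℂ] H} (hX : IsStarProjection (initialProj X)) :
    IsParsevalFrameIn (fun i => X (stdBasis i))
      (LinearMap.range (initialProj (adjoint X)).toLinearMap) := by
  have hR := isStarProjection_initialProj_adjoint hX
  have hs : IsSynthesis (fun i => X (stdBasis i)) X := fun i => rfl
  have hn : ∀ h ∈ LinearMap.range (initialProj (adjoint X)).toLinearMap,
      ‖adjoint X h‖ = ‖h‖ := fun h hh => by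
    rw [norm_map_of_isStarProjection hR, (IsStarProjection.mem_range_iff hR).1 hh]
  refine ⟨?_, fun i => ?_, fun h _ => (hs.hasSum h).summable, fun h hh => ?_, fun h hh => ?_⟩
  · have := hR.isIdempotentElem.isClosed_range
    simpa using this
  · rw [IsStarProjection.mem_range_iff hR, initialProj_apply, adjoint_adjoint,
      ← initialProj_apply, map_initialProj hX]
  · rw [(hs.hasSum h).tsum_eq, hn h hh, one_mul]
  · rw [(hs.hasSum h).tsum_eq, hn h hh, one_mul]

theorem synthesisOperator_apply_stdBasis {X : EllTwo →L[ℂ] H}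
    (hX : IsStarProjection (initialProj X)) :
    synthesisOperator (fun i => X (stdBasis i)) = X :=
  (isParsevalFrameIn_range hX).isFrameIn.isSynthesis.unique fun _ => rfl

/-- This is the lower frame inequality at the vector `U v`, which lies in `K`, since `F* U v = |F|
U* U v = |F| v`. The constant is the square root of the frame bound. -/
theorem IsFrameIn.exists_lower_bound {f : ℕ → H} {K : Submodule ℂ H} (hf : IsFrameIn f K)
    {F U : EllTwo →L[ℂ] H} (hF : IsSynthesis f F) (hU : IsPolarFactor F U) :
    ∃ c : ℝ, 0 < c ∧ ∀ v, c * ‖initialProj U v‖ ≤ ‖absOp F v‖ := by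
  obtain ⟨A, B, hA, -, hK⟩ := hf
  have : CompleteSpace K := hK.isClosed.completeSpace_coe
  have hP := hU.isStarProjection_initialProj
  have hUK : ∀ v, U v ∈ K := fun v => by
    rw [← Submodule.orthogonal_orthogonal K, Submodule.mem_orthogonal]
    intro h hh
    have h1 : adjoint U h = 0 := by
      rw [hU.adjoint_eq_zero_iff]
      exact hF.adjoint_eq_zero hK.mem hh
    rw [← adjoint_inner_left, h1, inner_zero_left]
  refine ⟨Real.sqrt A, Real.sqrt_pos.2 hA, fun v => ?_⟩
  have h1 := hK.lower _ (hUK v)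
  rw [(hF.hasSum _).tsum_eq, hU.adjoint_apply, ← initialProj_apply, hU.absOp_initialProj,
    norm_map_of_isStarProjection hP] at h1
  refine (sq_le_sq₀ (by positivity) (norm_nonneg _)).1 ?_
  rw [mul_pow, Real.sq_sqrt hA.le]
  exact h1

theorem norm_le_norm_absOp_add (F : E →L[ℂ] H) (z : E) : ‖z‖ ≤ ‖absOp F z + z‖ := by
  have h1 := norm_add_sq (𝕜 := ℂ) (absOp F z) z
  have h2 : 0 ≤ RCLike.re ⟪absOp F z, z⟫_ℂ := by
    rw [inner_absOp_left]
    exact (Complex.nonneg_iff.1 (absOp_nonneg F z)).1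
  refine (sq_le_sq₀ (norm_nonneg _) (norm_nonneg _)).1 ?_
  nlinarith [sq_nonneg ‖absOp F z‖]

theorem absOp_mul_absOp (F : E →L[ℂ] H) : absOp F * absOp F = adjoint F ∘L F := by
  refine CFC.sqrt_mul_sqrt_self _ ?_
  rw [ContinuousLinearMap.nonneg_iff_isPositive]
  exact ContinuousLinearMap.isPositive_adjoint_comp_self F

/-- With `M = |F|`, the operator `M²` is a Hilbert–Schmidt perturbation of a projection, so `M⁴ -
M²` is Hilbert–Schmidt. Since `M P = M` it factors as `M² (M + 1)(M - P)`, and the left factors are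
bounded below on `ran P`: `M` by `c` and `M + 1` by `1`. This accounts for the constant `c⁻²`. -/
theorem hsNormSq_absOp_sub_lt_top {F U X : E →L[ℂ] H} (hU : IsPolarFactor F U)
    (hX : IsStarProjection (initialProj X)) (hFX : hsNormSq (F - X) < ∞)
    {c : ℝ} (hc : 0 < c) (hlow : ∀ v, c * ‖initialProj U v‖ ≤ ‖absOp F v‖) :
    hsNormSq (absOp F - initialProj U) < ∞ := by
  have hP := hU.isStarProjection_initialProj
  set M := absOp F with hM
  set Q := initialProj X with hQ
  set W := M * M - Q with hW
  have hWfin : hsNormSq W < ∞ := by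
    have h1 : W = adjoint F ∘L (F - X) + adjoint (F - X) ∘L X := by
      rw [hW, absOp_mul_absOp, hQ, initialProj, map_sub]
      ext v
      simp only [sub_apply, add_apply, ContinuousLinearMap.comp_apply, map_sub]
      abel
    rw [h1]
    exact hsNormSq_add_lt_top (hsNormSq_comp_lt_top _ hFX)
      (hsNormSq_comp_lt_top' _ (by rwa [hsNormSq_adjoint]))
  have hQQ : Q * Q = Q := hX.isIdempotentElem.eq
  have h2 : M * M * (M * M) - M * M = Q * W + W * Q + W * W - W := by
    have h3 : M * M = Q + W := by rw [hW]; abel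
    rw [h3, add_mul, mul_add, mul_add, hQQ]
    abel
  have h4 : hsNormSq (M * M * (M * M) - M * M) < ∞ := by
    rw [h2]
    exact hsNormSq_sub_lt_top (hsNormSq_add_lt_top (hsNormSq_add_lt_top
      (hsNormSq_comp_lt_top Q hWfin) (hsNormSq_comp_lt_top' Q hWfin))
      (hsNormSq_comp_lt_top W hWfin)) hWfin
  have h5 : ∀ v, ‖(M - initialProj U) v‖ ≤
      ‖((((c ^ 2)⁻¹ : ℝ) : ℂ) • (M * M * (M * M) - M * M)) v‖ := by
    intro v
    set z := M v - initialProj U v with hz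
    have hPM : ∀ y, initialProj U (M y) = M y := hU.initialProj_absOp
    have hPz : initialProj U z = z := by
      rw [hz, map_sub, hPM, IsStarProjection.apply_apply hP]
    have h6 : (M * M * (M * M) - M * M) v = M (M (M z + z)) := by
      change M (M (M (M v))) - M (M v) = _
      rw [hz]
      simp only [map_add, map_sub, hU.absOp_initialProj, hM]
      abel
    have h7 : ∀ y, initialProj U y = y → c * ‖y‖ ≤ ‖M y‖ := fun y hy => by
      have := hlow y
      rwa [hy] at this
    have h8 := h7 (M (M z + z)) (hPM _)
    have h9 := h7 (M z + z) (by rw [map_add, hPM, hPz])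
    have h10 : ‖z‖ ≤ ‖M z + z‖ := norm_le_norm_absOp_add F z
    change ‖z‖ ≤ ‖(((c ^ 2)⁻¹ : ℝ) : ℂ) • (M * M * (M * M) - M * M) v‖
    rw [h6, norm_smul, Complex.norm_real, Real.norm_of_nonneg (by positivity),
      le_inv_mul_iff₀ (by positivity)]
    nlinarith
  refine (hsNormSq_mono h5).trans_lt ?_
  have h6 := hsNormSq_comp_lt_top
    ((((c ^ 2)⁻¹ : ℝ) : ℂ) • (1 : E →L[ℂ] E)) h4
  exact h6

theorem IsPolarFactor.hsNormSq_sub {F U : E →L[ℂ] H} (hU : IsPolarFactor F U) :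
    hsNormSq (F - U) = hsNormSq (absOp F - initialProj U) := by
  have hP := hU.isStarProjection_initialProj
  refine hsNormSq_congr fun v => ?_
  have h1 : (F - U) v = U (absOp F v - initialProj U v) := by
    rw [map_sub, hU.apply_absOp, map_initialProj hP]
    rfl
  rw [h1, norm_map_of_isStarProjection hP, map_sub, hU.initialProj_absOp,
    IsStarProjection.apply_apply hP]
  rfl

end Frames

/-! ### A rearrangement inequality for weighted sums -/

section Weighted

open Classical in
/-- A lower bound for weighted sums under lower bounds for the tails of the weights. -/
theorem sum_add_le_tsum_mul {ι : Type*} {w t : ι → ℝ≥0∞} {c : ℝ≥0∞} (hc : c ≠ ∞) {k : ℕ}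
    (S : Finset ι)
    (htail : ∀ S' ⊆ S, c * k ≤ c * S'.card + ∑' j, if j ∈ S' then 0 else t j) :
    ∀ τ, (∀ i ∈ S, w i ≤ τ) → S.card ≤ k →
      c * (∑ i ∈ S, w i + (k - S.card : ℕ) * τ) ≤ ∑' j, (if j ∈ S then w j else τ) * t j := by
  induction S using Finset.induction_on_max_value w with
  | empty =>
    intro τ _ _
    have h := htail ∅ (Finset.Subset.refl _)
    simp only [Finset.card_empty, Nat.cast_zero, mul_zero, Finset.notMem_empty, if_false,
      zero_add] at h
    simp only [Finset.sum_empty, Finset.card_empty, Nat.sub_zero, zero_add, Finset.notMem_empty,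
      if_false, ENNReal.tsum_mul_left]
    calc c * (k * τ) = τ * (c * k) := by ring
      _ ≤ _ := by gcongr
  | insert a S ha hmax ih =>
    intro τ hτ hcard
    have haτ : w a ≤ τ := hτ a (Finset.mem_insert_self _ _)
    rw [Finset.card_insert_of_notMem ha] at hcard
    obtain ⟨r, rfl⟩ := Nat.exists_eq_add_of_le hcard
    -- The largest weight `w a` serves as the threshold for the smaller set. Outside `insert a S`
    -- this loses `τ - w a` per unit of `t`, which the tail bound for `insert a S` recovers.
    have h1 := ih (fun S' hS' => htail S' (hS'.trans (Finset.subset_insert _ _))) (w a) hmax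
      (by omega)
    have h2 := htail (insert a S) (Finset.Subset.refl _)
    rw [Finset.card_insert_of_notMem ha, Nat.cast_add (S.card + 1) r, mul_add] at h2
    have h3 : c * r ≤ ∑' j, if j ∈ insert a S then 0 else t j :=
      (ENNReal.add_le_add_iff_left (ENNReal.mul_ne_top hc (ENNReal.natCast_ne_top _))).1 h2
    have h4 : ∀ j, (if j ∈ insert a S then w j else τ) * t j =
        (if j ∈ S then w j else w a) * t j +
          (τ - w a) * (if j ∈ insert a S then 0 else t j) := by
      intro j
      by_cases hja : j = a
      · subst hja; simp [ha]
      by_cases hj : j ∈ S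
      · simp [hj]
      · simp only [Finset.mem_insert, hja, hj, or_self, if_false]
        rw [← add_mul, add_tsub_cancel_of_le haτ]
    simp only [h4]
    rw [ENNReal.tsum_add, ENNReal.tsum_mul_left, Finset.sum_insert ha,
      Finset.card_insert_of_notMem ha]
    have e1 : S.card + 1 + r - S.card = r + 1 := by omega
    have e2 : S.card + 1 + r - (S.card + 1) = r := by omega
    rw [e1] at h1
    rw [e2]
    calc c * (w a + ∑ i ∈ S, w i + r * τ)
        = c * (∑ i ∈ S, w i + (r + 1 : ℕ) * w a) + (τ - w a) * (c * r) := by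
          conv_lhs => rw [← add_tsub_cancel_of_le haτ]
          push_cast
          ring
      _ ≤ _ := by gcongr

end Weighted

/-! ### The defect and its relation to the distance -/

section Deficit

open ContinuousLinearMap

variable {E H : Type*}
  [NormedAddCommGroup E] [InnerProductSpace ℂ E] [CompleteSpace E]
  [NormedAddCommGroup H] [InnerProductSpace ℂ H] [CompleteSpace H]

theorem eq_zero_of_hsNormSq {T : E →L[ℂ] H} (hT : hsNormSq T = 0) : T = 0 := by
  have h := enorm_opNorm_sq_le_hsNormSq T
  rw [hT, nonpos_iff_eq_zero, sq_eq_zero_iff, ← ofReal_norm,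
    ENNReal.ofReal_eq_zero] at h
  exact norm_le_zero_iff.1 h

theorem exists_isBasisOf_of_orthonormal {ι : Type*} {v : ι → E} (hv : Orthonormal ℂ v) :
    ∃ R : E →L[ℂ] E, IsStarProjection R ∧ IsBasisOf v R := by
  have hR : IsStarProjection (Submodule.span ℂ (Set.range v)).topologicalClosure.starProjection :=
    isStarProjection_starProjection
  refine ⟨_, hR, isBasisOf_of_total hv hR (fun i => ?_) fun x hx h0 => ?_⟩
  · exact Submodule.starProjection_eq_self_iff.2
      (Submodule.le_topologicalClosure _ (Submodule.subset_span ⟨i, rfl⟩))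
  · rw [Submodule.starProjection_eq_self_iff] at hx
    have h1 : x ∈ (Submodule.span ℂ (Set.range v)).topologicalClosureᗮ := by
      rw [Submodule.orthogonal_closure, Submodule.mem_orthogonal]
      intro u hu
      induction hu using Submodule.span_induction with
      | mem u hu => obtain ⟨i, rfl⟩ := hu; exact h0 i
      | zero => exact inner_zero_left _
      | add u u' _ _ h h' => rw [inner_add_left, h, h', add_zero]
      | smul c u _ h => rw [inner_smul_left, h, mul_zero]
    exact inner_self_eq_zero.1 ((Submodule.mem_orthogonal _ _).1 h1 x hx)

/-- The `v i` lie in the closed span of the `g j`, `j ∈ J`. With `R` the projection onto this span,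
the right side is the Hilbert–Schmidt norm of `T R`, which dominates the sum over any orthonormal
family. -/
theorem tsum_enorm_sq_le_tsum_subtype {ι κ : Type*} {g : ι → E} {P : E →L[ℂ] E}
    (hg : IsBasisOf g P) {J : Set ι} {v : κ → E} (hv : Orthonormal ℂ v) (hPv : ∀ i, P (v i) = v i)
    (hvJ : ∀ i, ∀ j ∉ J, ⟪g j, v i⟫_ℂ = 0) (T : E →L[ℂ] H) :
    ∑' i, ‖T (v i)‖ₑ ^ 2 ≤ ∑' j : J, ‖T (g j)‖ₑ ^ 2 := by
  obtain ⟨R, hR, hgR⟩ := exists_isBasisOf_of_orthonormal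
    (hg.orthonormal.comp (Subtype.val : J → ι) Subtype.val_injective)
  have hRv : ∀ i, R (v i) = v i := fun i => by
    have h1 := hg.hasSum (v i)
    rw [hPv] at h1
    refine (hgR.hasSum (v i)).unique ?_
    rw [← hasSum_subtype_iff_of_support_subset (s := J)] at h1
    · exact h1
    · intro j hj
      by_contra hjJ
      exact hj (by simp only [hvJ i j hjJ, zero_smul])
  have h2 : ∑' j : J, ‖T (g j)‖ₑ ^ 2 = hsNormSq (T ∘L R) := tsum_enorm_sq_eq_hsNormSq hgR hR T
  rw [h2]
  refine le_trans (le_of_eq ?_) (tsum_enorm_sq_le_hsNormSq hv (T ∘L R))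
  exact tsum_congr fun i => by rw [ContinuousLinearMap.comp_apply, hRv]

/-- The pointwise defect of the partial isometry `X` relative to `U`. On unit vectors `v` in the
initial space of `U` it is `2 - 2 Re ⟪U v, X v⟫`. -/
def defect (U X : E →L[ℂ] H) (v : E) : ℝ≥0∞ :=
  ‖(U - X) v‖ₑ ^ 2 + ‖(1 - initialProj X) v‖ₑ ^ 2

/-- As `F g = s U g` and `‖(1 - Q) g‖² = 1 - ‖X g‖²`, the added term cancels `‖X g‖²`, and both
sides equal `s² + 1 - 2 s Re ⟪U g, X g⟫`. -/
theorem defect_identity {F U X : E →L[ℂ] H} (hU : IsPolarFactor F U)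
    (hX : IsStarProjection (initialProj X)) {g : E} (hg1 : ‖g‖ = 1) (hPg : initialProj U g = g)
    {s : ℝ} (hs : 0 ≤ s) (hgs : absOp F g = (s : ℂ) • g) :
    ‖(F - X) g‖ₑ ^ 2 + ‖(1 - initialProj X) g‖ₑ ^ 2 =
      ‖(F - U) g‖ₑ ^ 2 + ENNReal.ofReal s * defect U X g := by
  have hF : F g = (s : ℂ) • U g := by rw [← hU.apply_absOp, hgs, map_smul]
  have hUg : ‖U g‖ = 1 := by
    rw [norm_map_of_isStarProjection hU.isStarProjection_initialProj, hPg, hg1]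
  have hQ : ‖(1 - initialProj X) g‖ ^ 2 = 1 - ‖X g‖ ^ 2 := by
    change ‖g - initialProj X g‖ ^ 2 = _
    rw [norm_sub_apply_sq hX, norm_map_of_isStarProjection hX, hg1, one_pow]
  have h1 : ‖(F - X) g‖ ^ 2 = s ^ 2 - 2 * (s * RCLike.re ⟪U g, X g⟫_ℂ) + ‖X g‖ ^ 2 := by
    rw [sub_apply, norm_sub_sq (𝕜 := ℂ), hF, norm_smul, hUg, inner_smul_left, Complex.conj_ofReal,
      Complex.norm_real, Real.norm_of_nonneg hs, mul_one]
    congr 3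
    simp
  have h2 : ‖(U - X) g‖ ^ 2 = 1 - 2 * RCLike.re ⟪U g, X g⟫_ℂ + ‖X g‖ ^ 2 := by
    rw [sub_apply, norm_sub_sq (𝕜 := ℂ), hUg, one_pow]
  have h3 : ‖(F - U) g‖ ^ 2 = (s - 1) ^ 2 := by
    have : (F - U) g = ((s - 1 : ℝ) : ℂ) • U g := by
      rw [sub_apply, hF]
      push_cast
      rw [sub_smul, one_smul]
    rw [this, norm_smul, hUg, mul_one, Complex.norm_real, Real.norm_eq_abs, sq_abs]
  simp only [defect, enorm_sq_eq_ofReal]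
  rw [← ENNReal.ofReal_add (by positivity) (by positivity),
    ← ENNReal.ofReal_add (by positivity) (by positivity), ← ENNReal.ofReal_mul hs,
    ← ENNReal.ofReal_add (by positivity) (by positivity)]
  congr 1
  rw [hQ, h1, h2, h3]
  ring

theorem tsum_defect {ι : Type*} {U X : E →L[ℂ] H} {P : E →L[ℂ] E} {g : ι → E}
    (hg : IsBasisOf g P) (hP : IsStarProjection P) :
    ∑' j, defect U X (g j) = hsNormSq ((U - X) ∘L P) + hsNormSq ((1 - initialProj X) ∘L P) := by
  simp only [defect]
  rw [ENNReal.tsum_add, tsum_enorm_sq_eq_hsNormSq hg hP, tsum_enorm_sq_eq_hsNormSq hg hP]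

/-- On `ker P` the operator `F` vanishes, so `F - X` contributes `‖X (1 - P)‖² = ‖(1 - P) Q‖²`. The
pair formula exchanges this for `‖(1 - Q) P‖²` and the two dimensions, after which everything is a
sum over `g`. The additive form avoids subtraction in `[0, ∞]`. -/
theorem hsNormSq_sub_add_dim {ι : Type*} {F U X : E →L[ℂ] H} (hU : IsPolarFactor F U)
    (hX : IsStarProjection (initialProj X)) {g : ι → E} (hg : IsBasisOf g (initialProj U))
    {s : ι → ℝ} (hs : ∀ j, 0 < s j) (hgs : ∀ j, absOp F (g j) = (s j : ℂ) • g j) :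
    hsNormSq (F - X) + dimENat (LinearMap.ker (initialProj X).toLinearMap ⊓
        LinearMap.range (initialProj U).toLinearMap) =
      hsNormSq (F - U) + ∑' j, ENNReal.ofReal (s j) * defect U X (g j) +
        dimENat (LinearMap.range (initialProj X).toLinearMap ⊓
          LinearMap.ker (initialProj U).toLinearMap) := by
  have hP := hU.isStarProjection_initialProj
  have h0 : ∀ v, U ((1 - initialProj U) v) = 0 := fun v => by
    change U (v - initialProj U v) = 0
    rw [map_sub, map_initialProj hP, sub_self]
  have h0F : ∀ v, F ((1 - initialProj U) v) = 0 := fun v => by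
    rw [← hU.map_eq_zero_iff, h0]
  have h1 : hsNormSq ((F - X) ∘L (1 - initialProj U)) =
      hsNormSq ((1 - initialProj U) ∘L initialProj X) := by
    rw [← hsNormSq_adjoint ((1 - initialProj U) ∘L initialProj X), adjoint_comp,
      hX.isSelfAdjoint.adjoint_eq, hP.one_sub.isSelfAdjoint.adjoint_eq]
    refine hsNormSq_congr fun v => ?_
    rw [ContinuousLinearMap.comp_apply, ContinuousLinearMap.comp_apply, sub_apply, h0F, zero_sub,
      norm_neg, norm_map_of_isStarProjection hX]
  have h2 : hsNormSq ((F - U) ∘L (1 - initialProj U)) = 0 := by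
    have : (F - U) ∘L (1 - initialProj U) = 0 := by
      ext v
      rw [ContinuousLinearMap.comp_apply, sub_apply, h0F, h0, sub_zero]
      rfl
    rw [this]
    simp [hsNormSq]
  have h3 := hsNormSq_pair hP hX
  rw [hsNormSq_eq_add hP (F - X), hsNormSq_eq_add hP (F - U), h1, h2, add_zero, add_assoc, h3,
    ← add_assoc, ← tsum_enorm_sq_eq_hsNormSq hg hP, ← tsum_enorm_sq_eq_hsNormSq hg hP,
    ← tsum_enorm_sq_eq_hsNormSq hg hP, ← ENNReal.tsum_add, ← ENNReal.tsum_add]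
  congr 1
  exact tsum_congr fun j => defect_identity hU hX (hg.orthonormal.1 j) (hg.apply_self j)
    (hs j).le (hgs j)

theorem norm_eq_zero_of_ker {X : E →L[ℂ] H} {v : E} (hv : initialProj X v = 0)
    (hX : IsStarProjection (initialProj X)) : X v = 0 :=
  (map_eq_zero_iff_initialProj hX v).2 hv

-- Orthogonality to the `g j` with `j ∈ S` costs at most `#S` dimensions of `N = ker Q ∩ ran P`. On
-- `N` the operator `X` is zero, so each remaining unit vector contributes 1 to both parts of the
-- defect.
open Classical in
theorem le_card_add_tsum_defect {ι : Type*} {U X : E →L[ℂ] H}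
    (hU : IsStarProjection (initialProj U))
    (hX : IsStarProjection (initialProj X)) {g : ι → E} (hg : IsBasisOf g (initialProj U))
    {k : ℕ} (hk1 : 1 ≤ k) (hk : k ≤ Module.finrank ℂ ↥(LinearMap.ker (initialProj X).toLinearMap ⊓
        LinearMap.range (initialProj U).toLinearMap)) (S : Finset ι) :
    2 * (k : ℝ≥0∞) ≤ 2 * S.card + ∑' j, if j ∈ S then 0 else defect U X (g j) := by
  set N := LinearMap.ker (initialProj X).toLinearMap ⊓
        LinearMap.range (initialProj U).toLinearMap with hN
  -- `finrank` is 0 on an infinite dimensional space, so `1 ≤ k` excludes that case.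
  have hfd : FiniteDimensional ℂ N := Module.finite_of_finrank_pos (by omega)
  let φ : N →ₗ[ℂ] (S → ℂ) := LinearMap.pi fun j => (innerSL ℂ (g j)).toLinearMap ∘ₗ N.subtype
  have hφ := φ.finrank_range_add_finrank_ker
  have hr : Module.finrank ℂ (LinearMap.range φ) ≤ S.card := by
    refine (Submodule.finrank_le _).trans ?_
    simp
  set r := Module.finrank ℂ (LinearMap.ker φ) with hrdef
  have hkr : k ≤ S.card + r := by omega
  let b := stdOrthonormalBasis ℂ (LinearMap.ker φ)
  let v : Fin r → E := fun i => ((b i : N) : E)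
  have hv : Orthonormal ℂ v :=
    (b.orthonormal.comp_linearIsometry (LinearMap.ker φ).subtypeₗᵢ).comp_linearIsometry N.subtypeₗᵢ
  have hvN : ∀ i, v i ∈ N := fun i => (b i : N).2
  have hPv : ∀ i, initialProj U (v i) = v i := fun i =>
    (IsStarProjection.mem_range_iff hU).1 (hvN i).2
  have hQv : ∀ i, initialProj X (v i) = 0 := fun i => (hvN i).1
  have hvJ : ∀ i, ∀ j ∉ {j | j ∉ S}, ⟪g j, v i⟫_ℂ = 0 := by
    intro i j hj
    have hj' : j ∈ S := not_not.1 hj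
    have h1 : φ (b i : N) = 0 := (b i).2
    exact congrFun h1 ⟨j, hj'⟩
  have h1 := tsum_enorm_sq_le_tsum_subtype hg hv hPv hvJ (U - X)
  have h2 := tsum_enorm_sq_le_tsum_subtype hg hv hPv hvJ (1 - initialProj X)
  have e1 : ∀ i, ‖(U - X) (v i)‖ₑ ^ 2 = 1 := fun i => by
    rw [sub_apply, norm_eq_zero_of_ker (hQv i) hX, sub_zero, enorm_sq_eq_ofReal,
      norm_map_of_isStarProjection hU, hPv, hv.1 i]
    simp
  have e2 : ∀ i, ‖(1 - initialProj X) (v i)‖ₑ ^ 2 = 1 := fun i => by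
    have : (1 - initialProj X) (v i) = v i := by
      change v i - initialProj X (v i) = v i
      rw [hQv, sub_zero]
    rw [this, enorm_sq_eq_ofReal, hv.1 i]
    simp
  simp only [e1, e2, tsum_fintype, Finset.sum_const, Finset.card_univ, Fintype.card_fin,
    nsmul_eq_mul, mul_one] at h1 h2
  have h3 : ∑' j, (if j ∈ S then 0 else defect U X (g j)) =
      ∑' j : {j | j ∉ S}, defect U X (g j) := by
    rw [tsum_subtype {j | j ∉ S} fun j => defect U X (g j)]
    refine tsum_congr fun j => ?_
    by_cases hj : j ∈ S <;> simp [hj]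
  rw [h3]
  simp only [defect]
  rw [ENNReal.tsum_add]
  calc 2 * (k : ℝ≥0∞) ≤ 2 * ((S.card + r : ℕ) : ℝ≥0∞) := by gcongr
    _ = 2 * S.card + (r + r) := by push_cast; ring
    _ ≤ _ := by gcongr

end Deficit

/-! ### Admissible operators and the operators `U - U R` -/

section Admissible

open ContinuousLinearMap

variable {E H : Type*}
  [NormedAddCommGroup E] [InnerProductSpace ℂ E] [CompleteSpace E]
  [NormedAddCommGroup H] [InnerProductSpace ℂ H] [CompleteSpace H]

theorem dimENat_eq_finrank (V : Submodule ℂ E) [FiniteDimensional ℂ V] :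
    dimENat V = Module.finrank ℂ V := by
  rw [dimENat, ← Module.finrank_eq_rank]
  simp

theorem finiteDimensional_of_dimENat_ne_top {V : Submodule ℂ E} (h : dimENat V ≠ ⊤) :
    FiniteDimensional ℂ V := by
  rw [dimENat, Ne, Cardinal.toENat_eq_top, not_le] at h
  exact Module.rank_lt_aleph0_iff.1 h

/-- `X` is a partial isometry, `F - X` is a Hilbert–Schmidt operator, and the initial projections
of `U` and `X` form a Fredholm pair of index `k`. -/
structure Admissible (F U : E →L[ℂ] H) (k : ℕ) (X : E →L[ℂ] H) : Prop where
  isStarProjection : IsStarProjection (initialProj X)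
  hsNormSq_lt_top : hsNormSq (F - X) < ∞
  isFredholmPair : IsFredholmPair (initialProj U) (initialProj X)
  pairIndex_eq : pairIndex (initialProj U) (initialProj X) = k

theorem Admissible.le_finrank {F U X : E →L[ℂ] H} {k : ℕ} (h : Admissible F U k X) :
    k ≤ Module.finrank ℂ ↥(LinearMap.ker (initialProj X).toLinearMap ⊓
        LinearMap.range (initialProj U).toLinearMap) := by
  have := h.pairIndex_eq
  rw [pairIndex] at this
  omega

theorem Admissible.finiteDimensional {F U X : E →L[ℂ] H} {k : ℕ} (h : Admissible F U k X)
    (hk : 1 ≤ k) : FiniteDimensional ℂ ↥(LinearMap.ker (initialProj X).toLinearMap ⊓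
        LinearMap.range (initialProj U).toLinearMap) :=
  Module.finite_of_finrank_pos (by have := h.le_finrank; omega)

/-- In `hsNormSq_sub_add_dim` the left side is finite, so the dimension on the right side must be
finite as well. -/
theorem Admissible.finiteDimensional_coker {ι : Type*} {F U X : E →L[ℂ] H} {k : ℕ}
    (h : Admissible F U k X) (hk : 1 ≤ k) (hU : IsPolarFactor F U) {g : ι → E}
    (hg : IsBasisOf g (initialProj U)) {s : ι → ℝ} (hs : ∀ j, 0 < s j)
    (hgs : ∀ j, absOp F (g j) = (s j : ℂ) • g j) :
    FiniteDimensional ℂ ↥(LinearMap.range (initialProj X).toLinearMap ⊓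
      LinearMap.ker (initialProj U).toLinearMap) := by
  have h1 := hsNormSq_sub_add_dim hU h.isStarProjection hg hs hgs
  have := h.finiteDimensional hk
  refine finiteDimensional_of_dimENat_ne_top fun htop => ?_
  rw [htop, dimENat_eq_finrank] at h1
  have h3 : hsNormSq (F - X) + ((Module.finrank ℂ ↥(LinearMap.ker (initialProj X).toLinearMap ⊓
      LinearMap.range (initialProj U).toLinearMap) : ℕ∞) : ℝ≥0∞) < ∞ :=
    ENNReal.add_lt_top.2 ⟨h.hsNormSq_lt_top, by simp⟩
  rw [h1] at h3
  simp at h3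

theorem Admissible.identity {ι : Type*} {F U X : E →L[ℂ] H} {k : ℕ} (h : Admissible F U k X)
    (hk : 1 ≤ k) (hU : IsPolarFactor F U) {g : ι → E} (hg : IsBasisOf g (initialProj U))
    {s : ι → ℝ} (hs : ∀ j, 0 < s j) (hgs : ∀ j, absOp F (g j) = (s j : ℂ) • g j) :
    hsNormSq (F - X) + k =
      hsNormSq (F - U) + ∑' j, ENNReal.ofReal (s j) * defect U X (g j) := by
  have h1 := hsNormSq_sub_add_dim hU h.isStarProjection hg hs hgs
  have := h.finiteDimensional hk
  have := h.finiteDimensional_coker hk hU hg hs hgs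
  rw [dimENat_eq_finrank, dimENat_eq_finrank] at h1
  have h4 := h.pairIndex_eq
  rw [pairIndex, sub_eq_iff_eq_add] at h4
  have h5 := Int.ofNat.inj h4
  rw [h5] at h1
  push_cast at h1
  rw [← add_assoc] at h1
  exact (ENNReal.add_left_inj (ENNReal.natCast_ne_top _)).1 h1

/-- Take `R` onto `N = ker Q ∩ ran P`. The total defect is `2 dim N ≥ 2k` plus the defect off `N`,
so `dim N = k` and `X = U` on the part of `ran P` orthogonal to `N`. The index then gives `ran Q ∩
ker P = 0`, and the pair formula gives `(1 - P) Q = 0`, so `X` vanishes on `ker P`. -/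
theorem Admissible.exists_eq_sub {ι : Type*} {F U X : E →L[ℂ] H} {k : ℕ}
    (h : Admissible F U k X) (hk : 1 ≤ k) (hpol : IsPolarFactor F U) {g : ι → E}
    (hg : IsBasisOf g (initialProj U)) {s : ι → ℝ} (hs : ∀ j, 0 < s j)
    (hgs : ∀ j, absOp F (g j) = (s j : ℂ) • g j)
    (hdef : ∑' j, defect U X (g j) ≤ 2 * k) :
    ∃ R : E →L[ℂ] E, IsStarProjection R ∧ (∀ x, initialProj U (R x) = R x) ∧
      hsNormSq R = k ∧ X = U - U ∘L R := by
  have hU := hpol.isStarProjection_initialProj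
  have hX := h.isStarProjection
  have hfd' := h.finiteDimensional_coker hk hpol hg hs hgs
  have hfd := h.finiteDimensional hk
  have hle := h.le_finrank
  have hidx := h.pairIndex_eq
  rw [pairIndex] at hidx
  set N := LinearMap.ker (initialProj X).toLinearMap ⊓
        LinearMap.range (initialProj U).toLinearMap with hN
  set R := N.starProjection with hRdef
  have hR : IsStarProjection R := isStarProjection_starProjection
  have hRN : ∀ x, R x ∈ N := fun x => Submodule.starProjection_apply_mem _ x
  have hPR : ∀ x, initialProj U (R x) = R x := fun x =>
    (IsStarProjection.mem_range_iff hU).1 (hRN x).2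
  have hQR : ∀ x, initialProj X (R x) = 0 := fun x => (hRN x).1
  have hXR : ∀ x, X (R x) = 0 := fun x => norm_eq_zero_of_ker (hQR x) hX
  have hRP : ∀ x, R (initialProj U x) = R x := (isStarProjection_sub hU hR hPR).2
  have hRn : hsNormSq R = (Module.finrank ℂ N : ℕ) := by
    rw [hsNormSq_starProjection hR, hRdef, Submodule.range_starProjection, dimENat_eq_finrank]
    simp
  rw [tsum_defect hg hU, hsNormSq_eq_add hR ((U - X) ∘L initialProj U),
    hsNormSq_eq_add hR ((1 - initialProj X) ∘L initialProj U)] at hdef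
  have e1 : hsNormSq (((U - X) ∘L initialProj U) ∘L R) = hsNormSq R := by
    refine hsNormSq_congr fun x => ?_
    simp only [ContinuousLinearMap.comp_apply, hPR, sub_apply, hXR, sub_zero]
    rw [norm_map_of_isStarProjection hU, hPR]
  have e2 : hsNormSq (((1 - initialProj X) ∘L initialProj U) ∘L R) = hsNormSq R := by
    refine hsNormSq_congr fun x => ?_
    simp only [ContinuousLinearMap.comp_apply, hPR, sub_apply, hQR, sub_zero]
    rfl
  rw [e1, e2, hRn] at hdef
  set a := hsNormSq (((U - X) ∘L initialProj U) ∘L (1 - R)) with ha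
  set c := hsNormSq (((1 - initialProj X) ∘L initialProj U) ∘L (1 - R)) with hc
  have hkn : (2 * k : ℝ≥0∞) ≤ 2 * (Module.finrank ℂ N : ℕ) := by gcongr
  have hsum : (2 * k : ℝ≥0∞) + (a + c) ≤ 2 * k := by
    refine le_trans ?_ hdef
    calc (2 * k : ℝ≥0∞) + (a + c) ≤ 2 * (Module.finrank ℂ N : ℕ) + (a + c) := by gcongr
      _ = _ := by ring
  have hfin : (2 * k : ℝ≥0∞) ≠ ∞ := by simp [ENNReal.mul_eq_top]
  have hac : a + c = 0 := by
    have : (2 * k : ℝ≥0∞) + (a + c) ≤ 2 * k + 0 := by rwa [add_zero]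
    exact nonpos_iff_eq_zero.1 ((ENNReal.add_le_add_iff_left hfin).1 this)
  obtain ⟨ha0, hc0⟩ := add_eq_zero.1 hac
  have hnk : Module.finrank ℂ N = k := by
    refine le_antisymm ?_ hle
    rw [ha0, hc0, add_zero, ← two_mul] at hdef
    have h2 : (Module.finrank ℂ N : ℝ≥0∞) ≤ k :=
      (ENNReal.mul_le_mul_iff_right (by norm_num) (by norm_num)).1 hdef
    exact_mod_cast h2
  have hN'0 : Module.finrank ℂ ↥(LinearMap.range (initialProj X).toLinearMap ⊓
      LinearMap.ker (initialProj U).toLinearMap) = 0 := by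
    rw [hnk] at hidx
    omega
  have ha1 := eq_zero_of_hsNormSq ha0
  have hc1 := eq_zero_of_hsNormSq hc0
  have hUX : ∀ x, X (initialProj U x) = U x - U (R x) := by
    intro x
    have h3 : (U - X) (initialProj U (x - R x)) = 0 := DFunLike.congr_fun ha1 x
    rw [map_sub, hPR, map_sub, sub_apply, sub_apply, hXR, sub_zero, map_initialProj hU,
      sub_right_comm, sub_eq_zero] at h3
    exact h3.symm
  have h1 : hsNormSq ((1 - initialProj X) ∘L initialProj U) = k := by
    rw [hsNormSq_eq_add hR, e2, ← hc, hc0, add_zero, hRn, hnk]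
  -- In the pair formula both `‖(1 - Q) P‖²` and `dim N` equal `k`, and they cancel.
  have h2 : hsNormSq ((1 - initialProj U) ∘L initialProj X) = 0 := by
    have hrel := hsNormSq_pair hU hX
    rw [h1, ← hN, dimENat_eq_finrank N, hnk, dimENat_eq_finrank, hN'0] at hrel
    have h3 : hsNormSq ((1 - initialProj U) ∘L initialProj X) + (k : ℝ≥0∞) = 0 + (k : ℝ≥0∞) := by
      simpa using hrel
    exact (ENNReal.add_left_inj (ENNReal.natCast_ne_top _)).1 h3
  have hPQ : ∀ x, initialProj U (initialProj X x) = initialProj X x := fun x => by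
    have h3 : initialProj X x - initialProj U (initialProj X x) = 0 :=
      DFunLike.congr_fun (eq_zero_of_hsNormSq h2) x
    exact (sub_eq_zero.1 h3).symm
  have hQP := (isStarProjection_sub hU hX hPQ).2
  refine ⟨R, hR, hPR, by rw [hRn, hnk], ?_⟩
  ext x
  change X x = U x - U (R x)
  rw [← hUX, ← map_initialProj hX (initialProj U x), hQP, map_initialProj hX]

theorem initialProj_sub_comp {U : E →L[ℂ] H} (hU : IsStarProjection (initialProj U))
    {R : E →L[ℂ] E} (hR : IsStarProjection R) (hPR : ∀ x, initialProj U (R x) = R x) :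
    initialProj (U - U ∘L R) = initialProj U - R := by
  obtain ⟨h1, hRP⟩ := isStarProjection_sub hU hR hPR
  refine initialProj_eq_of_norm h1 fun x => ?_
  change ‖U x - U (R x)‖ = ‖initialProj U x - R x‖
  rw [← map_sub, norm_map_of_isStarProjection hU, map_sub, hPR]

/-- The inclusion of `ran (P - R)` into `ran P` is a quasi-inverse: one composition is the identity,
the other differs from it by `-R`, of finite rank. -/
theorem isFredholmPair_sub {P R : E →L[ℂ] E} (hP : IsStarProjection P)
    (hR : IsStarProjection R) (hPR : ∀ x, P (R x) = R x)
    [FiniteDimensional ℂ (LinearMap.range R.toLinearMap)] : IsFredholmPair P (P - R) := by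
  obtain ⟨hQ, hRP⟩ := isStarProjection_sub hP hR hPR
  have hle : LinearMap.range (P - R).toLinearMap ≤ LinearMap.range P.toLinearMap := by
    rintro _ ⟨y, rfl⟩
    rw [IsStarProjection.mem_range_iff hP]
    change P (P y - R y) = P y - R y
    rw [map_sub, IsStarProjection.apply_apply hP, hPR]
  let v : LinearMap.range (P - R).toLinearMap →L[ℂ] LinearMap.range P.toLinearMap :=
    (LinearMap.range (P - R).toLinearMap).subtypeL.codRestrict _ fun x => hle x.2
  refine IsFredholm.of_isQuasiInverse (v := v) ⟨?_, ?_⟩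
  · refine LinearMap.FiniteRangeSetoid.equiv_iff_hasFiniteRange.2 ?_
    set T := v.toLinearMap ∘ₗ (pairOperator P (P - R)).toLinearMap - LinearMap.id with hT
    refine LinearMap.hasFiniteRange_iff_range.2 ?_
    refine Submodule.fg_of_fg_map_injective (LinearMap.range P.toLinearMap).subtype
      Subtype.val_injective ?_
    have hle2 : (LinearMap.range T).map (LinearMap.range P.toLinearMap).subtype ≤
        LinearMap.range R.toLinearMap := by
      rintro _ ⟨_, ⟨x, rfl⟩, rfl⟩
      refine ⟨-(x : E), ?_⟩
      have hx : P x = x := (IsStarProjection.mem_range_iff hP).1 x.2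
      change R (-(x : E)) = (P (P x) - R (P x)) - (x : E)
      rw [hx, hx, map_neg]
      abel
    have := Submodule.finiteDimensional_of_le hle2
    exact Module.Finite.iff_fg.1 this
  · have : (pairOperator P (P - R)).toLinearMap ∘ₗ v.toLinearMap = LinearMap.id := by
      ext x
      have hx : (P - R) (x : E) = x := (IsStarProjection.mem_range_iff hQ).1 x.2
      have hx2 : P (x : E) = x := (IsStarProjection.mem_range_iff hP).1 (hle x.2)
      change (P - R) (P (x : E)) = x
      rw [hx2, hx]
    refine LinearMap.FiniteRangeSetoid.equiv_iff_hasFiniteRange.2 ?_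
    rw [this, sub_self]
    exact LinearMap.HasFiniteRange.zero

theorem pairIndex_sub {P R : E →L[ℂ] E} (hP : IsStarProjection P)
    (hR : IsStarProjection R) (hPR : ∀ x, P (R x) = R x) :
    pairIndex P (P - R) = Module.finrank ℂ (LinearMap.range R.toLinearMap) := by
  obtain ⟨hQ, hRP⟩ := isStarProjection_sub hP hR hPR
  have h1 : LinearMap.ker (P - R).toLinearMap ⊓ LinearMap.range P.toLinearMap =
      LinearMap.range R.toLinearMap := by
    ext x
    rw [Submodule.mem_inf, IsStarProjection.mem_range_iff hP, IsStarProjection.mem_range_iff hR]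
    change P x - R x = 0 ∧ _ ↔ _
    constructor
    · rintro ⟨h2, h3⟩
      rw [← sub_eq_zero.1 h2, h3]
    · intro h2
      have h3 : P x = x := by rw [← h2, hPR]
      exact ⟨by rw [h3, h2, sub_self], h3⟩
  have h2 : LinearMap.range (P - R).toLinearMap ⊓ LinearMap.ker P.toLinearMap = ⊥ := by
    rw [Submodule.eq_bot_iff]
    rintro x ⟨h3, h4⟩
    rw [SetLike.mem_coe, IsStarProjection.mem_range_iff hQ] at h3
    have h4' : P x = 0 := h4
    rw [← h3, sub_apply, h4', ← hRP, h4', map_zero, sub_zero]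
  rw [pairIndex, h1, h2]
  simp

theorem finiteDimensional_range_of_hsNormSq {R : E →L[ℂ] E} (hR : IsStarProjection R)
    {k : ℕ} (hk : hsNormSq R = k) : FiniteDimensional ℂ (LinearMap.range R.toLinearMap) ∧
      Module.finrank ℂ (LinearMap.range R.toLinearMap) = k := by
  rw [hsNormSq_starProjection hR] at hk
  have h1 : dimENat (LinearMap.range R.toLinearMap) = k := by
    exact_mod_cast hk
  have h2 : FiniteDimensional ℂ (LinearMap.range R.toLinearMap) :=
    finiteDimensional_of_dimENat_ne_top (by rw [h1]; simp)
  refine ⟨h2, ?_⟩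
  rw [dimENat_eq_finrank] at h1
  exact_mod_cast h1

theorem admissible_sub_comp {F U : E →L[ℂ] H} (hU : IsStarProjection (initialProj U))
    (hFU : hsNormSq (F - U) < ∞) {R : E →L[ℂ] E} (hR : IsStarProjection R)
    (hPR : ∀ x, initialProj U (R x) = R x) {k : ℕ} (hk : hsNormSq R = k) :
    Admissible F U k (U - U ∘L R) := by
  have h1 := initialProj_sub_comp hU hR hPR
  obtain ⟨hfd, hrk⟩ := finiteDimensional_range_of_hsNormSq hR hk
  refine ⟨h1 ▸ (isStarProjection_sub hU hR hPR).1, ?_, ?_, ?_⟩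
  · have h2 : F - (U - U ∘L R) = (F - U) + U ∘L R := by abel
    rw [h2]
    exact hsNormSq_add_lt_top hFU (hsNormSq_comp_lt_top U (by rw [hk]; simp))
  · rw [h1]
    exact isFredholmPair_sub hU hR hPR
  · rw [h1, pairIndex_sub hU hR hPR, hrk]

theorem defect_sub_comp {U : E →L[ℂ] H} (hU : IsStarProjection (initialProj U))
    {R : E →L[ℂ] E} (hR : IsStarProjection R) (hPR : ∀ x, initialProj U (R x) = R x)
    {v : E} (hv : initialProj U v = v) : defect U (U - U ∘L R) v = 2 * ‖R v‖ₑ ^ 2 := by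
  rw [defect, initialProj_sub_comp hU hR hPR]
  have h1 : (U - (U - U ∘L R)) v = U (R v) := by
    change U v - (U v - U (R v)) = _
    abel
  have h2 : (1 - (initialProj U - R)) v = R v := by
    change v - (initialProj U v - R v) = _
    rw [hv]
    abel
  rw [h1, h2, enorm_sq_eq_ofReal (U (R v)), norm_map_of_isStarProjection hU, hPR,
    ← enorm_sq_eq_ofReal, two_mul]

end Admissible

/-! ### Optimal operators when a lowest set exists -/

section Optimal

open ContinuousLinearMap

variable {E H : Type*}
  [NormedAddCommGroup E] [InnerProductSpace ℂ E] [CompleteSpace E]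
  [NormedAddCommGroup H] [InnerProductSpace ℂ H] [CompleteSpace H]

/-- The orthonormal basis `g` of `(ker F)ᗮ` diagonalizes `|F|` with eigenvalues `s`, and `F` is
quadratically close to its polar factor `U`. -/
structure IsDiagonalization {ι : Type*} (F U : E →L[ℂ] H) (s : ι → ℝ) (g : ι → E) : Prop where
  polar : IsPolarFactor F U
  basis : IsBasisOf g (initialProj U)
  pos : ∀ j, 0 < s j
  eigen : ∀ j, absOp F (g j) = (s j : ℂ) • g j
  hsNormSq_lt_top : hsNormSq (F - U) < ∞

/-- `X` is an admissible operator that is closest to `F`. -/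
def IsOptimal (F U : E →L[ℂ] H) (k : ℕ) (X : E →L[ℂ] H) : Prop :=
  Admissible F U k X ∧ ∀ Y, Admissible F U k Y → hsNormSq (F - X) ≤ hsNormSq (F - Y)

/-- A projection of rank `k` below the initial projection of `U`. -/
structure IsSubProj (U : E →L[ℂ] H) (k : ℕ) (R : E →L[ℂ] E) : Prop where
  isStarProjection : IsStarProjection R
  apply_eq : ∀ x, initialProj U (R x) = R x
  hsNormSq_eq : hsNormSq R = k

theorem IsBasisOf.apply_of_apply {ι : Type*} {v : ι → E} {R P : E →L[ℂ] E} (h : IsBasisOf v R)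
    (hP : ∀ i, P (v i) = v i) (x : E) : P (R x) = R x := by
  refine ((h.hasSum x).mapL P).unique ?_
  simpa only [map_smul, hP] using h.hasSum x

theorem IsBasisOf.hsNormSq_eq {ι : Type*} {v : ι → E} {R : E →L[ℂ] E} (h : IsBasisOf v R)
    (hR : IsStarProjection R) : hsNormSq R = ENat.card ι := by
  have h1 := tsum_enorm_sq_eq_hsNormSq h hR R
  have h2 : R ∘L R = R := hR.isIdempotentElem.eq
  rw [h2] at h1
  rw [← h1]
  have h3 : ∀ i, ‖R (v i)‖ₑ ^ 2 = 1 := fun i => by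
    rw [h.apply_self, enorm_sq_eq_ofReal, h.orthonormal.1 i]; simp
  simp only [h3]
  rw [ENNReal.tsum_const, mul_one]

variable {ι : Type*} {F U X : E →L[ℂ] H} {s : ι → ℝ} {g : ι → E} {k : ℕ}

theorem IsDiagonalization.isStarProjection (h : IsDiagonalization F U s g) :
    IsStarProjection (initialProj U) := h.polar.isStarProjection_initialProj

theorem IsSubProj.tsum_enorm_sq {R : E →L[ℂ] E} (hR : IsSubProj U k R)
    (h : IsDiagonalization F U s g) : ∑' j, ‖R (g j)‖ₑ ^ 2 = k := by
  rw [tsum_enorm_sq_eq_hsNormSq h.basis h.isStarProjection, ← hR.hsNormSq_eq]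
  exact hsNormSq_congr fun x => by
    rw [ContinuousLinearMap.comp_apply,
      (isStarProjection_sub h.isStarProjection hR.isStarProjection hR.apply_eq).2]

theorem IsSubProj.enorm_sq_le (h : IsDiagonalization F U s g) {R : E →L[ℂ] E}
    (hR : IsSubProj U k R) (j : ι) : ‖R (g j)‖ₑ ^ 2 ≤ 1 := by
  have h1 := IsStarProjection.norm_apply_le hR.isStarProjection (g j)
  rw [h.basis.orthonormal.1 j] at h1
  rw [enorm_sq_eq_ofReal, ENNReal.ofReal_le_one]
  nlinarith [norm_nonneg (R (g j))]

theorem IsDiagonalization.hsNormSq_le_iff (h : IsDiagonalization F U s g) (hk : 1 ≤ k)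
    {Y : E →L[ℂ] H} (hX : Admissible F U k X) (hY : Admissible F U k Y) :
    hsNormSq (F - X) ≤ hsNormSq (F - Y) ↔
      ∑' j, ENNReal.ofReal (s j) * defect U X (g j) ≤
        ∑' j, ENNReal.ofReal (s j) * defect U Y (g j) := by
  rw [← ENNReal.add_le_add_iff_right (ENNReal.natCast_ne_top k),
    hX.identity hk h.polar h.basis h.pos h.eigen, hY.identity hk h.polar h.basis h.pos h.eigen,
    ENNReal.add_le_add_iff_left h.hsNormSq_lt_top.ne]

theorem IsSubProj.admissible (h : IsDiagonalization F U s g) {R : E →L[ℂ] E}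
    (hR : IsSubProj U k R) : Admissible F U k (U - U ∘L R) :=
  admissible_sub_comp h.isStarProjection h.hsNormSq_lt_top hR.isStarProjection hR.apply_eq
    hR.hsNormSq_eq

theorem IsSubProj.cost (h : IsDiagonalization F U s g) {R : E →L[ℂ] E} (hR : IsSubProj U k R) :
    ∑' j, ENNReal.ofReal (s j) * defect U (U - U ∘L R) (g j) =
      2 * ∑' j, ENNReal.ofReal (s j) * ‖R (g j)‖ₑ ^ 2 := by
  rw [← ENNReal.tsum_mul_left]
  refine tsum_congr fun j => ?_
  rw [defect_sub_comp h.isStarProjection hR.isStarProjection hR.apply_eq (h.basis.apply_self j)]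
  ring

open Classical in
theorem IsDiagonalization.exists_isSubProj (h : IsDiagonalization F U s g) (S : Finset ι) :
    ∃ R, IsSubProj U S.card R ∧ ∀ j, ‖R (g j)‖ₑ ^ 2 = if j ∈ S then 1 else 0 := by
  obtain ⟨R, hR, hb⟩ := exists_isBasisOf_of_orthonormal
    (h.basis.orthonormal.comp (Subtype.val : S → ι) Subtype.val_injective)
  refine ⟨R, ⟨hR, hb.apply_of_apply fun i => h.basis.apply_self _, ?_⟩, fun j => ?_⟩
  · rw [hb.hsNormSq_eq hR]
    simp
  · split_ifs with hj
    · have h1 : R (g j) = g j := hb.apply_self ⟨j, hj⟩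
      rw [h1, enorm_sq_eq_ofReal, h.basis.orthonormal.1 j]
      simp
    · rw [← hb.tsum_enorm_sq, ENNReal.tsum_eq_zero]
      rintro ⟨i, hi⟩
      have h1 : ⟪g i, g j⟫_ℂ = 0 := h.basis.orthonormal.2 fun hij => hj (hij ▸ hi)
      simp [h1]

open Classical in
theorem IsDiagonalization.exists_isSubProj_cost (h : IsDiagonalization F U s g) (S : Finset ι) :
    ∃ R, IsSubProj U S.card R ∧
      ∑' j, ENNReal.ofReal (s j) * ‖R (g j)‖ₑ ^ 2 = ∑ j ∈ S, ENNReal.ofReal (s j) := by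
  obtain ⟨R, hR, hRg⟩ := h.exists_isSubProj S
  refine ⟨R, hR, ?_⟩
  simp only [hRg, mul_ite, mul_one, mul_zero]
  rw [tsum_eq_sum (s := S) fun j hj => if_neg hj]
  exact Finset.sum_congr rfl fun j hj => if_pos hj

open Classical in
theorem Admissible.sum_add_le (hX : Admissible F U k X) (hk : 1 ≤ k)
    (h : IsDiagonalization F U s g) {w : ι → ℝ≥0∞} {S : Finset ι} {τ : ℝ≥0∞}
    (hτ : ∀ i ∈ S, w i ≤ τ) (hS : S.card ≤ k) :
    2 * (∑ i ∈ S, w i + (k - S.card : ℕ) * τ) ≤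
      ∑' j, (if j ∈ S then w j else τ) * defect U X (g j) :=
  sum_add_le_tsum_mul (by norm_num) S
    (fun S' _ => le_card_add_tsum_defect h.isStarProjection hX.isStarProjection h.basis hk
      hX.le_finrank S') τ hτ hS

theorem Admissible.two_mul_sum_le (hX : Admissible F U k X) (hk : 1 ≤ k)
    (h : IsDiagonalization F U s g) {w : ι → ℝ≥0∞} {S : Finset ι} (hS : S.card = k)
    (hlow : ∀ i ∈ S, ∀ j ∉ S, w i ≤ w j) :
    2 * ∑ i ∈ S, w i ≤ ∑' j, w j * defect U X (g j) := by
  classical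
  have hne : S.Nonempty := Finset.card_pos.1 (by omega)
  obtain ⟨m, hm, hmax⟩ := S.exists_max_image w hne
  have h1 := hX.sum_add_le hk h (w := w) (τ := w m) hmax hS.le
  rw [hS, Nat.sub_self, Nat.cast_zero, zero_mul, add_zero] at h1
  refine h1.trans (ENNReal.tsum_le_tsum fun j => ?_)
  gcongr
  split_ifs with hj
  · exact le_rfl
  · exact hlow m hm j hj

/-- Subtract the smallest weight `w m` from all weights. The lower bound still holds for the weights
`w j - w m`, so the part of the cost with constant weight `w m` is at most `w m * 2k`, and `w m >
0`. -/
theorem Admissible.tsum_defect_le (hX : Admissible F U k X) (hk : 1 ≤ k)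
    (h : IsDiagonalization F U s g) {S : Finset ι} (hS : S.card = k)
    (hlow : ∀ i ∈ S, ∀ j ∉ S, s i ≤ s j)
    (hcost : ∑' j, ENNReal.ofReal (s j) * defect U X (g j) ≤
      2 * ∑ i ∈ S, ENNReal.ofReal (s i)) :
    ∑' j, defect U X (g j) ≤ 2 * k := by
  have hne : S.Nonempty := Finset.card_pos.1 (by omega)
  obtain ⟨m, hm, hmin⟩ := S.exists_min_image s hne
  set w : ι → ℝ≥0∞ := fun j => ENNReal.ofReal (s j) with hw
  have hmle : ∀ j, w m ≤ w j := fun j => ENNReal.ofReal_le_ofReal <| by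
    by_cases hj : j ∈ S
    · exact hmin j hj
    · exact hlow m hm j hj
  have h1 := hX.two_mul_sum_le hk h (w := fun j => w j - w m) hS fun i hi j hj =>
    tsub_le_tsub_right (ENNReal.ofReal_le_ofReal (hlow i hi j hj)) _
  have hsplit : ∀ j, w j = w m + (w j - w m) := fun j => (add_tsub_cancel_of_le (hmle j)).symm
  have h2 : ∑' j, w j * defect U X (g j) =
      w m * ∑' j, defect U X (g j) + ∑' j, (w j - w m) * defect U X (g j) := by
    rw [← ENNReal.tsum_mul_left, ← ENNReal.tsum_add]
    refine tsum_congr fun j => ?_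
    conv_lhs => rw [hsplit j]
    rw [add_mul]
  have h3 : ∑ i ∈ S, w i = k * w m + ∑ i ∈ S, (w i - w m) := by
    rw [← hS, ← nsmul_eq_mul, ← Finset.sum_const, ← Finset.sum_add_distrib]
    exact Finset.sum_congr rfl fun j _ => hsplit j
  have hfin : 2 * ∑ i ∈ S, (w i - w m) ≠ ∞ := by
    refine ENNReal.mul_ne_top (by norm_num) (ENNReal.sum_ne_top.2 fun i _ => ?_)
    exact (tsub_le_self.trans_lt ENNReal.ofReal_lt_top).ne
  have h4 : w m * ∑' j, defect U X (g j) + 2 * ∑ i ∈ S, (w i - w m) ≤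
      w m * (2 * k) + 2 * ∑ i ∈ S, (w i - w m) := by
    calc _ ≤ w m * ∑' j, defect U X (g j) + ∑' j, (w j - w m) * defect U X (g j) := by gcongr
      _ ≤ 2 * ∑ i ∈ S, w i := h2 ▸ hcost
      _ = _ := by rw [h3]; ring
  have h5 := (ENNReal.add_le_add_iff_right hfin).1 h4
  refine (ENNReal.mul_le_mul_iff_right ?_ ENNReal.ofReal_ne_top).1 h5
  exact (ENNReal.ofReal_pos.2 (h.pos m)).ne'

/-- The operators closest to `F` are `U - U R` where `R` projects onto a `k`-dimensional subspace
of minimal weight. -/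
theorem IsDiagonalization.isOptimal_iff (h : IsDiagonalization F U s g) (hk : 1 ≤ k)
    {S : Finset ι} (hS : S.card = k) (hlow : ∀ i ∈ S, ∀ j ∉ S, s i ≤ s j) :
    IsOptimal F U k X ↔ ∃ R, IsSubProj U k R ∧
      ∑' j, ENNReal.ofReal (s j) * ‖R (g j)‖ₑ ^ 2 = ∑ i ∈ S, ENNReal.ofReal (s i) ∧
      X = U - U ∘L R := by
  have hlow' : ∀ i ∈ S, ∀ j ∉ S, ENNReal.ofReal (s i) ≤ ENNReal.ofReal (s j) :=
    fun i hi j hj => ENNReal.ofReal_le_ofReal (hlow i hi j hj)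
  constructor
  · rintro ⟨hX, hopt⟩
    -- The competitor is the projection onto the span of the `g j` with `j ∈ S`.
    obtain ⟨R₀, hR₀, hcost⟩ := h.exists_isSubProj_cost S
    rw [hS] at hR₀
    have h1 := (h.hsNormSq_le_iff hk hX (hR₀.admissible h)).1 (hopt _ (hR₀.admissible h))
    rw [hR₀.cost h, hcost] at h1
    obtain ⟨R, hR, hPR, hRk, rfl⟩ := hX.exists_eq_sub hk h.polar h.basis h.pos h.eigen
      (hX.tsum_defect_le hk h hS hlow h1)
    have hR' : IsSubProj U k R := ⟨hR, hPR, hRk⟩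
    have h2 := hX.two_mul_sum_le hk h hS hlow'
    rw [hR'.cost h] at h1 h2
    refine ⟨R, hR', le_antisymm ?_ ?_, rfl⟩
    · exact (ENNReal.mul_le_mul_iff_right (by norm_num) (by norm_num)).1 h1
    · exact (ENNReal.mul_le_mul_iff_right (by norm_num) (by norm_num)).1 h2
  · rintro ⟨R, hR, hcost, rfl⟩
    refine ⟨hR.admissible h, fun Y hY => ?_⟩
    rw [h.hsNormSq_le_iff hk (hR.admissible h) hY, hR.cost h, hcost]
    exact hY.two_mul_sum_le hk h hS hlow'

theorem IsDiagonalization.exists_isOptimal (h : IsDiagonalization F U s g) (hk : 1 ≤ k)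
    {S : Finset ι} (hS : S.card = k) (hlow : ∀ i ∈ S, ∀ j ∉ S, s i ≤ s j) :
    ∃ X, IsOptimal F U k X := by
  obtain ⟨R, hR, hcost⟩ := h.exists_isSubProj_cost S
  exact ⟨_, (h.isOptimal_iff hk hS hlow).2 ⟨R, hS ▸ hR, hcost, rfl⟩⟩

end Optimal

/-! ### Lowest indices as finite sets -/

section Lowest

theorem exists_isLowest_iff {ι : Type*} (s : ι → ℝ) (k : ℕ) :
    (∃ n : Fin k → ι, IsLowest s n) ↔
      ∃ S : Finset ι, S.card = k ∧ ∀ i ∈ S, ∀ j ∉ S, s i ≤ s j := by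
  constructor
  · rintro ⟨n, hn⟩
    refine ⟨Finset.univ.map ⟨n, hn.injective⟩, by simp, ?_⟩
    simp only [Finset.mem_map, Finset.mem_univ, Function.Embedding.coeFn_mk, true_and]
    rintro _ ⟨i, rfl⟩ j hj
    exact hn.le_other j (fun ⟨i, hi⟩ => hj ⟨i, hi⟩) i
  · rintro ⟨S, rfl, hS⟩
    let e : Fin S.card → ι := fun i => (S.equivFin.symm i : ι)
    have he : Function.Injective e := Subtype.val_injective.comp S.equivFin.symm.injective
    have hrange : ∀ j, j ∈ Set.range e ↔ j ∈ S := fun j =>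
      ⟨by rintro ⟨i, rfl⟩; exact (S.equivFin.symm i).2,
        fun hj => ⟨S.equivFin ⟨j, hj⟩, by simp [e]⟩⟩
    refine ⟨e ∘ Tuple.sort (s ∘ e), he.comp (Equiv.injective _), Tuple.monotone_sort (s ∘ e), ?_⟩
    intro j hj i
    rw [(Tuple.sort (s ∘ e)).surjective.range_comp, hrange] at hj
    exact hS _ ((hrange _).1 ⟨_, rfl⟩) j hj

end Lowest

/-! ### Necessity of the lowest indices -/

section Existence

open ContinuousLinearMap

variable {E H : Type*}
  [NormedAddCommGroup E] [InnerProductSpace ℂ E] [CompleteSpace E]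
  [NormedAddCommGroup H] [InnerProductSpace ℂ H] [CompleteSpace H]
  {ι : Type*} {F U X : E →L[ℂ] H} {s : ι → ℝ} {g : ι → E} {k : ℕ}

/-- If an optimal operator exists, then the infimum of the singular values outside a small lowest
set is attained. -/
theorem IsOptimal.exists_min (hX : IsOptimal F U k X) (hk : 1 ≤ k)
    (h : IsDiagonalization F U s g) {S : Finset ι} (hlow : ∀ i ∈ S, ∀ j ∉ S, s i ≤ s j)
    (hS : S.card < k) (hne : ∃ j, j ∉ S) : ∃ a ∉ S, ∀ b ∉ S, s a ≤ s b := by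
  classical
  by_contra! hcon
  set T : Set ℝ := s '' {j | j ∉ S} with hT
  have hTne : T.Nonempty := by
    obtain ⟨j, hj⟩ := hne
    exact ⟨s j, j, hj, rfl⟩
  have hTbdd : BddBelow T := ⟨0, by rintro _ ⟨j, -, rfl⟩; exact (h.pos j).le⟩
  set τ := sInf T with hτ
  have hτle : ∀ j ∉ S, τ ≤ s j := fun j hj => csInf_le hTbdd ⟨j, hj, rfl⟩
  have hτlt : ∀ j ∉ S, τ < s j := fun j hj => by
    obtain ⟨b, hb, hbj⟩ := hcon j hj
    exact (hτle b hb).trans_lt hbj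
  have hτS : ∀ i ∈ S, s i ≤ τ := fun i hi => le_csInf hTne (by
    rintro _ ⟨j, hj, rfl⟩
    exact hlow i hi j hj)
  have hτ0 : 0 ≤ τ := le_csInf hTne (by rintro _ ⟨j, -, rfl⟩; exact (h.pos j).le)
  -- A nonempty finite set of values near `τ` would contain a minimum, contrary to `hcon`.
  have hinf : ∀ ε > 0, {j | j ∉ S ∧ s j < τ + ε}.Infinite := by
    intro ε hε hfin
    have hne' : hfin.toFinset.Nonempty := by
      obtain ⟨_, ⟨j, hj, rfl⟩, hlt⟩ := exists_lt_of_csInf_lt hTne (lt_add_of_pos_right τ hε)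
      exact ⟨j, by simpa using ⟨hj, hlt⟩⟩
    obtain ⟨a, ha, hmin⟩ := hfin.toFinset.exists_min_image s hne'
    have ha' : a ∉ S ∧ s a < τ + ε := by simpa using ha
    obtain ⟨b, hb, hba⟩ := hcon a ha'.1
    exact absurd (hmin b (by simpa using ⟨hb, hba.trans ha'.2⟩)) (not_le.2 hba)
  set w : ι → ℝ≥0∞ := fun j => ENNReal.ofReal (s j) with hw
  set r := k - S.card with hr
  set bd : ℝ≥0∞ := 2 * (∑ i ∈ S, w i + (r : ℕ) * ENNReal.ofReal τ) with hbd
  have hbdfin : bd ≠ ∞ := by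
    refine ENNReal.mul_ne_top (by norm_num) (ENNReal.add_ne_top.2 ⟨?_, ?_⟩)
    · exact ENNReal.sum_ne_top.2 fun i _ => ENNReal.ofReal_ne_top
    · exact ENNReal.mul_ne_top (ENNReal.natCast_ne_top _) ENNReal.ofReal_ne_top
  -- Competitors built on `S` and `r` further indices with `s j` close to `τ` have cost arbitrarily
  -- close to `bd`.
  have hupper : ∑' j, w j * defect U X (g j) ≤ bd := by
    refine ENNReal.le_of_forall_pos_le_add fun ε hε _ => ?_
    have hr0 : 0 < r := by omega
    -- There are `r` extra indices, each counted with factor 2, so the total excess is `ε`.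
    set δ : ℝ := ε / (2 * r) with hδ
    have hδ0 : 0 < δ := by positivity
    obtain ⟨S', hS', hcard⟩ := (hinf δ hδ0).exists_subset_card_eq r
    have hdisj : Disjoint S S' := Finset.disjoint_left.2 fun j hj hj' => (hS' hj').1 hj
    obtain ⟨R, hR, hcost⟩ := h.exists_isSubProj_cost (S ∪ S')
    have hcardk : (S ∪ S').card = k := by
      rw [Finset.card_union_of_disjoint hdisj, hcard, hr]
      omega
    rw [hcardk] at hR
    have h1 := (h.hsNormSq_le_iff hk hX.1 (hR.admissible h)).1 (hX.2 _ (hR.admissible h))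
    rw [hR.cost h, hcost, Finset.sum_union hdisj] at h1
    refine h1.trans ?_
    have h2 : ∑ j ∈ S', ENNReal.ofReal (s j) ≤ r * (ENNReal.ofReal τ + ENNReal.ofReal δ) := by
      rw [← hcard, ← nsmul_eq_mul, ← Finset.sum_const]
      refine Finset.sum_le_sum fun j hj => ?_
      rw [← ENNReal.ofReal_add hτ0 hδ0.le]
      exact ENNReal.ofReal_le_ofReal (hS' hj).2.le
    have h3 : 2 * (r * ENNReal.ofReal δ) = (ε : ℝ≥0∞) := by
      rw [← ENNReal.ofReal_natCast r, ← ENNReal.ofReal_mul (by positivity),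
        show (2 : ℝ≥0∞) = ENNReal.ofReal 2 by simp, ← ENNReal.ofReal_mul (by positivity), hδ]
      have : 2 * ((r : ℝ) * (ε / (2 * r))) = ε := by
        have : (r : ℝ) ≠ 0 := by positivity
        field_simp
      rw [this, ENNReal.ofReal_coe_nnreal]
    calc 2 * (∑ j ∈ S, ENNReal.ofReal (s j) + ∑ j ∈ S', ENNReal.ofReal (s j))
        ≤ 2 * (∑ j ∈ S, w j + r * (ENNReal.ofReal τ + ENNReal.ofReal δ)) := by gcongr
      _ = bd + 2 * (r * ENNReal.ofReal δ) := by rw [hbd]; ring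
      _ = bd + ε := by rw [h3]
  have hlower := hX.1.sum_add_le hk h (w := w) (τ := ENNReal.ofReal τ)
    (fun i hi => ENNReal.ofReal_le_ofReal (hτS i hi)) hS.le
  set z := ∑' j, (if j ∈ S then 0 else w j - ENNReal.ofReal τ) * defect U X (g j) with hz
  have hsplit : ∑' j, w j * defect U X (g j) =
      ∑' j, (if j ∈ S then w j else ENNReal.ofReal τ) * defect U X (g j) + z := by
    rw [hz, ← ENNReal.tsum_add]
    refine tsum_congr fun j => ?_
    rw [← add_mul]
    congr 1
    split_ifs with hj
    · rw [add_zero]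
    · exact (add_tsub_cancel_of_le (ENNReal.ofReal_le_ofReal (hτle j hj))).symm
  -- `z` is the surplus of the cost over the one with weight `τ` outside `S`, and the latter is
  -- already at least `bd`. As `τ < s j` outside `S`, the defect vanishes there.
  have hz0 : z = 0 := by
    have h1 : bd + z ≤ bd + 0 := by
      rw [add_zero]
      refine le_trans ?_ hupper
      rw [hsplit]
      gcongr
    exact nonpos_iff_eq_zero.1 ((ENNReal.add_le_add_iff_left hbdfin).1 h1)
  rw [hz, ENNReal.tsum_eq_zero] at hz0
  have h2 : ∀ j, (if j ∈ S then 0 else defect U X (g j)) = 0 := fun j => by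
    have h3 := hz0 j
    split_ifs with hj
    · rfl
    · rw [if_neg hj, mul_eq_zero] at h3
      refine h3.resolve_left fun h4 => ?_
      rw [tsub_eq_zero_iff_le, ENNReal.ofReal_le_ofReal_iff hτ0] at h4
      exact absurd h4 (not_le.2 (hτlt j hj))
  have h3 := le_card_add_tsum_defect h.isStarProjection hX.1.isStarProjection h.basis hk
    hX.1.le_finrank S
  simp only [h2, tsum_zero, add_zero] at h3
  have h4 : (k : ℝ≥0∞) ≤ S.card :=
    (ENNReal.mul_le_mul_iff_right (by norm_num) (by norm_num)).1 h3
  have h5 : k ≤ S.card := by exact_mod_cast h4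
  omega

/-- Greedy construction: a lowest set with fewer than `k` elements is enlarged by a minimizer of `s`
on its complement, which is nonempty because `k` is at most the number of indices. -/
theorem IsOptimal.exists_lowest (hX : IsOptimal F U k X) (hk : 1 ≤ k)
    (h : IsDiagonalization F U s g) (hcard : (k : ℕ∞) ≤ ENat.card ι) :
    ∃ S : Finset ι, S.card = k ∧ ∀ i ∈ S, ∀ j ∉ S, s i ≤ s j := by
  classical
  have key : ∀ m ≤ k, ∃ S : Finset ι, S.card = m ∧ ∀ i ∈ S, ∀ j ∉ S, s i ≤ s j := by
    intro m
    induction m with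
    | zero => exact fun _ => ⟨∅, rfl, by simp⟩
    | succ m ih =>
      intro hm
      obtain ⟨S, hSm, hlow⟩ := ih (by omega)
      have hne : ∃ j, j ∉ S := by
        by_contra! hall
        have h1 : ENat.card ι = S.card := by
          rw [← Set.encard_univ, ← Set.encard_coe_eq_coe_finsetCard]
          congr 1
          ext j
          simp [hall j]
        rw [h1, hSm] at hcard
        have : k ≤ m := by exact_mod_cast hcard
        omega
      obtain ⟨a, ha, hmin⟩ := hX.exists_min hk h hlow (by omega) hne
      refine ⟨insert a S, by rw [Finset.card_insert_of_notMem ha, hSm], ?_⟩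
      intro i hi j hj
      rw [Finset.mem_insert, not_or] at hj
      rcases Finset.mem_insert.1 hi with rfl | hi
      · exact hmin j hj.2
      · exact hlow i hi j hj.2
  exact key k le_rfl

end Existence

/-! ### The equality case and the form of all minimizers -/

section Minimizers

open ContinuousLinearMap

/-- Because `∑ p j = #S`, the left sum exceeds the right one by `z`. Subtraction being truncated at
0, the first part of each term of `z` lives where `T < W j` and the second where `W j < T`; `z`
vanishes exactly when all these nonnegative terms do. -/
theorem tsum_mul_eq_iff {ι : Type*} {W p : ι → ℝ≥0∞} {T : ℝ≥0∞} (hW : ∀ j, W j ≠ ∞) (hT : T ≠ ∞)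
    {S : Finset ι} (hS : ∀ i ∈ S, W i ≤ T) (hSc : ∀ j ∉ S, T ≤ W j) (hp : ∀ j, p j ≤ 1)
    (hsum : ∑' j, p j = S.card) :
    ∑' j, W j * p j = ∑ i ∈ S, W i ↔
      (∀ j, W j < T → p j = 1) ∧ ∀ j, T < W j → p j = 0 := by
  set z := ∑' j, ((W j - T) * p j + (T - W j) * (1 - p j)) with hz
  have hD : ∑' j, (T - W j) = ∑ i ∈ S, (T - W i) :=
    tsum_eq_sum fun j hj => tsub_eq_zero_of_le (hSc j hj)
  have hDfin : ∑ i ∈ S, (T - W i) ≠ ∞ :=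
    ENNReal.sum_ne_top.2 fun i _ => (tsub_le_self.trans_lt hT.lt_top).ne
  have hSD : ∑ i ∈ S, W i + ∑ i ∈ S, (T - W i) = T * S.card := by
    rw [← Finset.sum_add_distrib, mul_comm, ← nsmul_eq_mul, ← Finset.sum_const]
    exact Finset.sum_congr rfl fun i hi => add_tsub_cancel_of_le (hS i hi)
  have hterm : ∀ j, W j * p j + (T - W j) =
      T * p j + ((W j - T) * p j + (T - W j) * (1 - p j)) := by
    intro j
    rcases le_total (W j) T with hj | hj
    · obtain ⟨d, rfl⟩ := exists_add_of_le hj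
      rw [ENNReal.add_sub_cancel_left (hW j), tsub_eq_zero_of_le hj, zero_mul, zero_add, add_mul,
        add_assoc, ← mul_add, add_tsub_cancel_of_le (hp j), mul_one]
    · obtain ⟨d, hd⟩ := exists_add_of_le hj
      rw [hd, ENNReal.add_sub_cancel_left hT, tsub_eq_zero_of_le le_self_add, zero_mul, add_zero,
        add_zero, add_mul]
  have hmain : ∑' j, W j * p j = ∑ i ∈ S, W i + z := by
    have h1 : ∑' j, (W j * p j + (T - W j)) =
        ∑' j, (T * p j + ((W j - T) * p j + (T - W j) * (1 - p j))) := tsum_congr hterm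
    rw [ENNReal.tsum_add, ENNReal.tsum_add, hD, ENNReal.tsum_mul_left, hsum, ← hSD, ← hz] at h1
    rw [← ENNReal.add_left_inj hDfin, h1]
    ring
  have hfin : ∑ i ∈ S, W i ≠ ∞ := ENNReal.sum_ne_top.2 fun i _ => hW i
  have h2 : ∑' j, W j * p j = ∑ i ∈ S, W i ↔ z = 0 := by
    rw [hmain]
    refine ⟨fun h => ?_, fun h => by rw [h, add_zero]⟩
    exact (ENNReal.add_right_inj hfin).1 (by rw [h, add_zero])
  rw [h2, hz, ENNReal.tsum_eq_zero]
  constructor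
  · intro h
    refine ⟨fun j hj => ?_, fun j hj => ?_⟩
    · have h3 := ((add_eq_zero.1 (h j)).2)
      rw [mul_eq_zero, tsub_eq_zero_iff_le, tsub_eq_zero_iff_le] at h3
      exact le_antisymm (hp j) (h3.resolve_left (not_le.2 hj))
    · have h3 := ((add_eq_zero.1 (h j)).1)
      rw [mul_eq_zero, tsub_eq_zero_iff_le] at h3
      exact h3.resolve_left (not_le.2 hj)
  · rintro ⟨h3, h4⟩ j
    rcases lt_trichotomy (W j) T with hj | hj | hj
    · rw [h3 j hj, tsub_self, mul_zero, tsub_eq_zero_of_le hj.le, zero_mul, add_zero]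
    · rw [hj, tsub_self, zero_mul, zero_mul, add_zero]
    · rw [h4 j hj, mul_zero, tsub_eq_zero_of_le hj.le, zero_mul, add_zero]

variable {E H : Type*}
  [NormedAddCommGroup E] [InnerProductSpace ℂ E] [CompleteSpace E]
  [NormedAddCommGroup H] [InnerProductSpace ℂ H] [CompleteSpace H]
  {ι : Type*} {F U X : E →L[ℂ] H} {s : ι → ℝ} {g : ι → E} {k : ℕ}

theorem enorm_sq_apply_eq_one_iff {R : E →L[ℂ] E} (hR : IsStarProjection R) {v : E}
    (hv : ‖v‖ = 1) : ‖R v‖ₑ ^ 2 = 1 ↔ R v = v := by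
  rw [enorm_sq_eq_ofReal, ENNReal.ofReal_eq_one]
  have h := norm_sq_eq_add hR v
  constructor
  · intro h1
    rw [hv, h1] at h
    have h2 : ‖v - R v‖ ^ 2 = 0 := by linarith
    rw [sq_eq_zero_iff, norm_eq_zero, sub_eq_zero] at h2
    exact h2.symm
  · intro h1
    rw [h1, hv, one_pow]

theorem enorm_sq_eq_zero_iff {V : Type*} [NormedAddCommGroup V] {v : V} :
    ‖v‖ₑ ^ 2 = 0 ↔ v = 0 := by
  rw [sq_eq_zero_iff, enorm_eq_zero]

/-- `R` projects onto a `k`-dimensional space between the spectral subspaces of `|F|` for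
`(0, σ)` and `(0, σ]`. -/
structure IsSpectralProj (U : E →L[ℂ] H) (s : ι → ℝ) (g : ι → E) (k : ℕ) (σ : ℝ)
    (R : E →L[ℂ] E) : Prop extends IsSubProj U k R where
  apply_of_lt : ∀ j, s j < σ → R (g j) = g j
  apply_of_gt : ∀ j, σ < s j → R (g j) = 0

theorem IsDiagonalization.isOptimal_iff_isSpectralProj (h : IsDiagonalization F U s g) (hk : 1 ≤ k)
    {S : Finset ι} (hS : S.card = k) {σ : ℝ} (hσ : 0 < σ) (hle : ∀ i ∈ S, s i ≤ σ)
    (hge : ∀ j ∉ S, σ ≤ s j) :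
    IsOptimal F U k X ↔ ∃ R, IsSpectralProj U s g k σ R ∧ X = U - U ∘L R := by
  rw [h.isOptimal_iff hk hS fun i hi j hj => (hle i hi).trans (hge j hj)]
  have key : ∀ R, IsSubProj U k R →
      (∑' j, ENNReal.ofReal (s j) * ‖R (g j)‖ₑ ^ 2 = ∑ i ∈ S, ENNReal.ofReal (s i) ↔
        (∀ j, s j < σ → R (g j) = g j) ∧ ∀ j, σ < s j → R (g j) = 0) := by
    intro R hR
    rw [tsum_mul_eq_iff (T := ENNReal.ofReal σ) (fun _ => ENNReal.ofReal_ne_top)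
      ENNReal.ofReal_ne_top (fun i hi => ENNReal.ofReal_le_ofReal (hle i hi))
      (fun j hj => ENNReal.ofReal_le_ofReal (hge j hj)) (hR.enorm_sq_le h)
      (by rw [hR.tsum_enorm_sq h, hS])]
    simp only [ENNReal.ofReal_lt_ofReal_iff hσ, ENNReal.ofReal_lt_ofReal_iff (h.pos _),
      enorm_sq_apply_eq_one_iff hR.isStarProjection (h.basis.orthonormal.1 _),
      enorm_sq_eq_zero_iff]
  constructor
  · rintro ⟨R, hR, hcost, rfl⟩
    obtain ⟨h1, h2⟩ := (key R hR).1 hcost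
    exact ⟨R, ⟨hR, h1, h2⟩, rfl⟩
  · rintro ⟨R, hR, rfl⟩
    exact ⟨R, hR.toIsSubProj, (key R hR.toIsSubProj).2 ⟨hR.apply_of_lt, hR.apply_of_gt⟩, rfl⟩

theorem IsBasisOf.ext {P : E →L[ℂ] E} (hg : IsBasisOf g P) {S T : E →L[ℂ] H}
    (hS : ∀ x, S (P x) = S x) (hT : ∀ x, T (P x) = T x) (hST : ∀ j, S (g j) = T (g j)) :
    S = T := by
  ext x
  rw [← hS, ← hT]
  refine ((hg.hasSum x).mapL S).unique ?_
  simpa only [map_smul, hST] using (hg.hasSum x).mapL T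

theorem IsSubProj.apply_initialProj (h : IsDiagonalization F U s g) {R : E →L[ℂ] E}
    (hR : IsSubProj U k R) (x : E) : R (initialProj U x) = R x :=
  (isStarProjection_sub h.isStarProjection hR.isStarProjection hR.apply_eq).2 x

/-- The spectral subspace of `|F|` for the eigenvalues `s j < σ`. -/
def spectralSubspace (F : E →L[ℂ] H) (s : ι → ℝ) (σ : ℝ) : Submodule ℂ E :=
  (⨆ j ∈ {j | s j < σ}, singularSpace F (s j)).topologicalClosure

instance (F : E →L[ℂ] H) (s : ι → ℝ) (σ : ℝ) : CompleteSpace (spectralSubspace F s σ) :=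
  (Submodule.isClosed_topologicalClosure _).completeSpace_coe

theorem mem_orthogonal_spectralSubspace {σ : ℝ} {x : E}
    (hx : ∀ j, s j < σ → ∀ v ∈ singularSpace F (s j), ⟪v, x⟫_ℂ = 0) :
    (spectralSubspace F s σ).starProjection x = 0 := by
  rw [Submodule.starProjection_apply_eq_zero_iff, spectralSubspace, Submodule.orthogonal_closure]
  have hle : ⨆ j ∈ {j | s j < σ}, singularSpace F (s j) ≤ (Submodule.span ℂ {x})ᗮ :=
    iSup₂_le fun j hj v hv => Submodule.mem_orthogonal_singleton_iff_inner_left.2 (hx j hj v hv)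
  exact Submodule.orthogonal_le hle
    (Submodule.le_orthogonal_orthogonal _ (Submodule.mem_span_singleton_self x))

theorem IsDiagonalization.mem_singularSpace (h : IsDiagonalization F U s g) (j : ι) :
    g j ∈ singularSpace F (s j) := FrameApprox.mem_singularSpace.2 (h.eigen j)

theorem IsDiagonalization.spectral_apply_lt (h : IsDiagonalization F U s g) {σ : ℝ} {j : ι}
    (hj : s j < σ) : (spectralSubspace F s σ).starProjection (g j) = g j := by
  rw [Submodule.starProjection_eq_self_iff]
  refine Submodule.le_topologicalClosure _ ?_
  exact Submodule.mem_iSup_of_mem j (Submodule.mem_iSup_of_mem hj (h.mem_singularSpace j))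

theorem IsDiagonalization.spectral_apply_ge (h : IsDiagonalization F U s g) {σ : ℝ} {j : ι}
    (hj : σ ≤ s j) : (spectralSubspace F s σ).starProjection (g j) = 0 :=
  mem_orthogonal_spectralSubspace fun _ hi _ hv =>
    inner_eq_zero_of_mem_singularSpace (hi.trans_le hj).ne hv (h.mem_singularSpace j)

theorem IsDiagonalization.spectral_initialProj (h : IsDiagonalization F U s g) (σ : ℝ) (x : E) :
    (spectralSubspace F s σ).starProjection (initialProj U x) =
      (spectralSubspace F s σ).starProjection x := by
  rw [← sub_eq_zero, ← map_sub]
  refine mem_orthogonal_spectralSubspace fun j _ v hv => ?_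
  rw [← h.polar.initialProj_of_mem (h.pos j) hv, IsStarProjection.inner_left h.isStarProjection,
    map_sub, IsStarProjection.apply_apply h.isStarProjection, sub_self, inner_zero_right]

theorem apply_comm_of_isStarProjection {P R : E →L[ℂ] E} (hP : IsStarProjection P)
    (hR : IsStarProjection R) (hRP : ∀ x, R (P x) = R x) (x : E) : P (R x) = R x := by
  refine ext_inner_left ℂ fun y => ?_
  rw [← IsStarProjection.inner_left hP, ← IsStarProjection.inner_left hR, hRP,
    IsStarProjection.inner_left hR]

open Classical in
theorem IsDiagonalization.hsNormSq_eq (h : IsDiagonalization F U s g) {σ : ℝ} {R E₁ : E →L[ℂ] E}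
    (hRP : ∀ x, R (initialProj U x) = R x) (hEP : ∀ x, E₁ (initialProj U x) = E₁ x)
    (hlt : ∀ j, s j < σ → R (g j) = g j ∧ E₁ (g j) = 0) (hge : ∀ j, σ ≤ s j → R (g j) = E₁ (g j)) :
    hsNormSq R = hsNormSq E₁ + ({j | s j < σ}.encard : ℝ≥0∞) := by
  have h1 : ∀ T : E →L[ℂ] E, (∀ x, T (initialProj U x) = T x) →
      hsNormSq T = ∑' j, ‖T (g j)‖ₑ ^ 2 := fun T hT => by
    rw [tsum_enorm_sq_eq_hsNormSq h.basis h.isStarProjection]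
    exact hsNormSq_congr fun x => by rw [ContinuousLinearMap.comp_apply, hT]
  have h2 : ({j | s j < σ}.encard : ℝ≥0∞) = ∑' j, if s j < σ then 1 else 0 := by
    rw [Set.encard, ← mul_one ((ENat.card {j | s j < σ} : ℕ∞) : ℝ≥0∞), ← ENNReal.tsum_const,
      tsum_subtype {j | s j < σ} fun _ => (1 : ℝ≥0∞)]
    exact tsum_congr fun j => rfl
  rw [h1 R hRP, h1 E₁ hEP, h2, ← ENNReal.tsum_add]
  refine tsum_congr fun j => ?_
  split_ifs with hj
  · rw [(hlt j hj).1, (hlt j hj).2, enorm_sq_eq_ofReal, h.basis.orthonormal.1 j]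
    simp
  · rw [hge j (not_lt.1 hj), add_zero]

theorem dimENat_add_encard_eq_iff {E₁ : E →L[ℂ] E} (hE : IsStarProjection E₁) (A : Set ι) :
    dimENat (LinearMap.range E₁.toLinearMap) + A.encard = k ↔
      hsNormSq E₁ + (A.encard : ℝ≥0∞) = k := by
  rw [hsNormSq_starProjection hE]
  norm_cast

theorem IsDiagonalization.isSpectralProj_iff (h : IsDiagonalization F U s g) {σ : ℝ}
    (hσ : 0 < σ) {R : E →L[ℂ] E} :
    IsSpectralProj U s g k σ R ↔ ∃ E₁ : E →L[ℂ] E, IsStarProjection E₁ ∧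
      LinearMap.range E₁.toLinearMap ≤ singularSpace F σ ∧
      dimENat (LinearMap.range E₁.toLinearMap) + {j | s j < σ}.encard = k ∧
      R = (spectralSubspace F s σ).starProjection + E₁ := by
  have hP := h.isStarProjection
  set E₀ := (spectralSubspace F s σ).starProjection with hE₀
  have hE₀p : IsStarProjection E₀ := isStarProjection_starProjection
  have hE₀P : ∀ x, E₀ (initialProj U x) = E₀ x := h.spectral_initialProj σ
  constructor
  · intro hR
    -- Both operators factor through `P`, so it suffices to compare them on the basis `g`. Then `E₁
    -- = R - E₀` is a projection.
    have hRE : ∀ x, R (E₀ x) = E₀ x := by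
      have : R ∘L E₀ = E₀ := by
        refine h.basis.ext (fun x => ?_) hE₀P fun j => ?_
        · rw [ContinuousLinearMap.comp_apply, hE₀P]; rfl
        · rw [ContinuousLinearMap.comp_apply]
          rcases lt_or_ge (s j) σ with hj | hj
          · rw [h.spectral_apply_lt hj, hR.apply_of_lt j hj]
          · rw [h.spectral_apply_ge hj, map_zero]
      exact DFunLike.congr_fun this
    obtain ⟨hE₁, hER⟩ := isStarProjection_sub hR.isStarProjection hE₀p hRE
    have hRP : ∀ x, R (initialProj U x) = R x := IsSubProj.apply_initialProj h hR.toIsSubProj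
    have hE₁P : ∀ x, (R - E₀) (initialProj U x) = (R - E₀) x := fun x => by
      rw [sub_apply, sub_apply, hRP, hE₀P]
    have hlt : ∀ j, s j < σ → R (g j) = g j ∧ (R - E₀) (g j) = 0 := fun j hj =>
      ⟨hR.apply_of_lt j hj, by
        rw [sub_apply, hR.apply_of_lt j hj, h.spectral_apply_lt hj, sub_self]⟩
    refine ⟨R - E₀, hE₁, ?_, ?_, by abel⟩
    · rintro _ ⟨x, rfl⟩
      -- `R - E₀` kills every `g j` with `s j ≠ σ`, so its range is orthogonal to these vectors.
      refine mem_singularSpace_of_inner_eq_zero h.basis h.eigen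
        (apply_comm_of_isStarProjection hP hE₁ hE₁P x) fun j hj => ?_
      change ⟪g j, (R - E₀) x⟫_ℂ = 0
      rw [← IsStarProjection.inner_left hE₁]
      rcases lt_or_gt_of_ne hj with hj | hj
      · rw [(hlt j hj).2, inner_zero_left]
      · rw [sub_apply, hR.apply_of_gt j hj, h.spectral_apply_ge hj.le, sub_zero, inner_zero_left]
    · rw [dimENat_add_encard_eq_iff hE₁, ← hR.hsNormSq_eq]
      refine (h.hsNormSq_eq hRP hE₁P hlt fun j hj => ?_).symm
      rw [sub_apply, h.spectral_apply_ge hj, sub_zero]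
  · rintro ⟨E₁, hE₁, hrange, hdim, rfl⟩
    have hmem : ∀ x, E₁ x ∈ singularSpace F σ := fun x => hrange ⟨x, rfl⟩
    have hPE₁ : ∀ x, initialProj U (E₁ x) = E₁ x := fun x =>
      h.polar.initialProj_of_mem hσ (hmem x)
    have hE₁P := (isStarProjection_sub hP hE₁ hPE₁).2
    have hE₁g : ∀ j, s j ≠ σ → E₁ (g j) = 0 := fun j hj => by
      have h1 : ⟪g j, E₁ (g j)⟫_ℂ = 0 :=
        inner_eq_zero_of_mem_singularSpace hj (h.mem_singularSpace j) (hmem _)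
      rw [← IsStarProjection.norm_sq_eq_inner hE₁] at h1
      have h2 : ‖E₁ (g j)‖ ^ 2 = 0 := by exact_mod_cast h1
      rwa [sq_eq_zero_iff, norm_eq_zero] at h2
    have hRP : ∀ x, (E₀ + E₁) (initialProj U x) = (E₀ + E₁) x := fun x => by
      rw [add_apply, add_apply, hE₀P, hE₁P]
    have h10 : ∀ x, E₁ (E₀ x) = 0 := by
      have : E₁ ∘L E₀ = 0 := by
        refine h.basis.ext (fun x => ?_) (fun x => rfl) fun j => ?_
        · rw [ContinuousLinearMap.comp_apply, hE₀P]; rfl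
        · rw [ContinuousLinearMap.comp_apply]
          rcases lt_or_ge (s j) σ with hj | hj
          · rw [h.spectral_apply_lt hj, hE₁g j hj.ne]; rfl
          · rw [h.spectral_apply_ge hj, map_zero]; rfl
      exact DFunLike.congr_fun this
    have h01 : ∀ x, E₀ (E₁ x) = 0 := fun x => by
      refine ext_inner_left ℂ fun y => ?_
      rw [← IsStarProjection.inner_left hE₀p, ← IsStarProjection.inner_left hE₁, h10,
        inner_zero_left, inner_zero_right]
    have hR : IsStarProjection (E₀ + E₁) := by
      refine isStarProjection_of_idempotent_inner (fun x => ?_) ?_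
      · simp only [add_apply, map_add, h10, h01, IsStarProjection.apply_apply hE₀p,
          IsStarProjection.apply_apply hE₁, add_zero, zero_add]
      · rw [map_add, hE₀p.isSelfAdjoint.adjoint_eq, hE₁.isSelfAdjoint.adjoint_eq]
    have hlt : ∀ j, s j < σ → (E₀ + E₁) (g j) = g j ∧ E₁ (g j) = 0 := fun j hj =>
      ⟨by rw [add_apply, h.spectral_apply_lt hj, hE₁g j hj.ne, add_zero], hE₁g j hj.ne⟩
    refine ⟨⟨hR, apply_comm_of_isStarProjection hP hR hRP, ?_⟩, fun j hj => (hlt j hj).1,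
      fun j hj => ?_⟩
    · rw [← (dimENat_add_encard_eq_iff hE₁ _).1 hdim]
      refine h.hsNormSq_eq hRP hE₁P hlt fun j hj => ?_
      rw [add_apply, h.spectral_apply_ge hj, zero_add]
    · rw [add_apply, h.spectral_apply_ge hj.le, hE₁g j hj.ne', add_zero]

end Minimizers

/-! ### Uniqueness and infinitude of minimizers -/

section Multiplicity

open ContinuousLinearMap

variable {E H : Type*}
  [NormedAddCommGroup E] [InnerProductSpace ℂ E] [CompleteSpace E]
  [NormedAddCommGroup H] [InnerProductSpace ℂ H] [CompleteSpace H]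
  {ι : Type*} {F U X : E →L[ℂ] H} {s : ι → ℝ} {g : ι → E} {k : ℕ} {σ : ℝ}

theorem encard_lt_add_encard_eq (s : ι → ℝ) (σ : ℝ) :
    {j | s j < σ}.encard + {j | s j = σ}.encard = {j | s j ≤ σ}.encard := by
  have hdisj : Disjoint {j | s j < σ} {j | s j = σ} :=
    Set.disjoint_left.2 fun j (h1 : s j < σ) h2 => h1.ne h2
  rw [← Set.encard_union_eq hdisj]
  congr 1
  ext j
  exact (le_iff_lt_or_eq (a := s j)).symm

-- The numbers `‖R g_j‖²` are at most 1, vanish unless `s j ≤ σ`, and sum to `k`. With only `k`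
-- indices available, each must equal 1.
open Classical in
theorem IsSpectralProj.apply_of_le {R : E →L[ℂ] E} (hR : IsSpectralProj U s g k σ R)
    (h : IsDiagonalization F U s g) (hcard : {j | s j ≤ σ}.encard = k) {j : ι} (hj : s j ≤ σ) :
    R (g j) = g j := by
  have hle : ∀ j, ‖R (g j)‖ₑ ^ 2 ≤ if s j ≤ σ then 1 else 0 := fun j => by
    split_ifs with hj
    · exact hR.enorm_sq_le h j
    · rw [hR.apply_of_gt j (not_le.1 hj)]
      simp
  have h1 : ∑' j, (if s j ≤ σ then (1 : ℝ≥0∞) else 0) = k := by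
    have h2 : ({j | s j ≤ σ}.encard : ℝ≥0∞) = k := by rw [hcard]; simp
    rw [← h2, Set.encard, ← mul_one ((ENat.card {j | s j ≤ σ} : ℕ∞) : ℝ≥0∞),
      ← ENNReal.tsum_const, tsum_subtype {j | s j ≤ σ} fun _ => (1 : ℝ≥0∞)]
    exact tsum_congr fun j => rfl
  have h3 : (k : ℝ≥0∞) + ∑' j, ((if s j ≤ σ then 1 else 0) - ‖R (g j)‖ₑ ^ 2) = k + 0 := by
    rw [← hR.tsum_enorm_sq h, ← ENNReal.tsum_add, add_zero, hR.tsum_enorm_sq h, ← h1]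
    exact tsum_congr fun j => add_tsub_cancel_of_le (hle j)
  have h4 := ENNReal.tsum_eq_zero.1 ((ENNReal.add_right_inj (ENNReal.natCast_ne_top k)).1 h3) j
  rw [if_pos hj, tsub_eq_zero_iff_le] at h4
  exact (enorm_sq_apply_eq_one_iff hR.isStarProjection (h.basis.orthonormal.1 j)).1
    (le_antisymm (hR.enorm_sq_le h j) h4)

theorem IsSpectralProj.eq {R R' : E →L[ℂ] E} (hR : IsSpectralProj U s g k σ R)
    (hR' : IsSpectralProj U s g k σ R') (h : IsDiagonalization F U s g)
    (hcard : {j | s j ≤ σ}.encard = k) : R = R' := by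
  refine h.basis.ext (IsSubProj.apply_initialProj h hR.toIsSubProj)
    (IsSubProj.apply_initialProj h hR'.toIsSubProj) fun j => ?_
  rcases le_or_gt (s j) σ with hj | hj
  · rw [hR.apply_of_le h hcard hj, hR'.apply_of_le h hcard hj]
  · rw [hR.apply_of_gt j hj, hR'.apply_of_gt j hj]

/-- Replacing `g b₀` by a multiple of `g b₀ + m g b₁` in the span of `g j`, `j ∈ S`, gives another
spectral projection. -/
theorem IsDiagonalization.exists_isSpectralProj (h : IsDiagonalization F U s g) {S : Finset ι}
    (hS : S.card = k) (hle : ∀ i ∈ S, s i ≤ σ) (hge : ∀ j ∉ S, σ ≤ s j) {b₀ b₁ : ι}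
    (hb₀ : b₀ ∈ S) (hb₁ : b₁ ∉ S) (hs₀ : s b₀ = σ) (hs₁ : s b₁ = σ) (m : ℕ) :
    ∃ R, IsSpectralProj U s g k σ R ∧
      R (g b₀ + (m : ℂ) • g b₁) = g b₀ + (m : ℂ) • g b₁ ∧
      R ((m : ℂ) • g b₀ - g b₁) = 0 := by
  classical
  have hg := orthonormal_iff_ite.1 h.basis.orthonormal
  have hbb : b₀ ≠ b₁ := fun hb => hb₁ (hb ▸ hb₀)
  set w := g b₀ + (m : ℂ) • g b₁ with hw
  have hw0 : ‖w‖ ≠ 0 := by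
    intro h0
    have h1 : ⟪g b₀, w⟫_ℂ = 1 := by
      rw [hw, inner_add_right, inner_smul_right, hg, hg, if_pos rfl, if_neg hbb, mul_zero, add_zero]
    rw [norm_eq_zero.1 h0, inner_zero_right] at h1
    exact zero_ne_one h1
  have hgw : ∀ j, j ≠ b₀ → j ≠ b₁ → ⟪w, g j⟫_ℂ = 0 := fun j hj₀ hj₁ => by
    rw [hw, inner_add_left, inner_smul_left, hg, hg, if_neg hj₀.symm, if_neg hj₁.symm, mul_zero,
      add_zero]
  let v : S → E := fun j => if (j : ι) = b₀ then ((‖w‖⁻¹ : ℝ) : ℂ) • w else g j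
  have hv₀ : v ⟨b₀, hb₀⟩ = ((‖w‖⁻¹ : ℝ) : ℂ) • w := if_pos rfl
  have hv : ∀ j : S, (j : ι) ≠ b₀ → v j = g j := fun j hj => if_neg hj
  have hSb₁ : ∀ j : S, (j : ι) ≠ b₁ := fun j hj => hb₁ (hj ▸ j.2)
  have hvo : Orthonormal ℂ v := by
    refine ⟨fun i => ?_, fun i j hij => ?_⟩
    · by_cases hi : (i : ι) = b₀
      · obtain rfl : i = ⟨b₀, hb₀⟩ := Subtype.ext hi
        rw [hv₀, norm_smul, Complex.norm_real, norm_inv, norm_norm, inv_mul_cancel₀ hw0]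
      · rw [hv i hi, h.basis.orthonormal.1]
    · change ⟪v i, v j⟫_ℂ = 0
      by_cases hi : (i : ι) = b₀
      · have hj : (j : ι) ≠ b₀ := fun hj => hij (Subtype.ext (hi.trans hj.symm))
        obtain rfl : i = ⟨b₀, hb₀⟩ := Subtype.ext hi
        rw [hv₀, hv j hj, inner_smul_left, hgw j hj (hSb₁ j), mul_zero]
      · by_cases hj : (j : ι) = b₀
        · obtain rfl : j = ⟨b₀, hb₀⟩ := Subtype.ext hj
          rw [hv₀, hv i hi, inner_smul_right, inner_eq_zero_symm.1 (hgw i hi (hSb₁ i)), mul_zero]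
        · rw [hv i hi, hv j hj]
          exact h.basis.orthonormal.2 fun h1 => hij (Subtype.ext h1)
  obtain ⟨R, hR, hb⟩ := exists_isBasisOf_of_orthonormal hvo
  have hPv : ∀ i, initialProj U (v i) = v i := fun i => by
    by_cases hi : (i : ι) = b₀
    · obtain rfl : i = ⟨b₀, hb₀⟩ := Subtype.ext hi
      rw [hv₀, map_smul, hw, map_add, map_smul, h.basis.apply_self, h.basis.apply_self]
    · rw [hv i hi, h.basis.apply_self]
  have horth : ∀ x, ⟪w, x⟫_ℂ = 0 → (∀ j ∈ S, j ≠ b₀ → ⟪g j, x⟫_ℂ = 0) → R x = 0 :=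
    fun x hx hgx => hb.apply_eq_zero fun i => by
      by_cases hi : (i : ι) = b₀
      · obtain rfl : i = ⟨b₀, hb₀⟩ := Subtype.ext hi
        rw [hv₀, inner_smul_left, hx, mul_zero]
      · rw [hv i hi, hgx i i.2 hi]
  refine ⟨R, ⟨⟨hR, hb.apply_of_apply hPv, ?_⟩, fun j hj => ?_, fun j hj => ?_⟩, ?_, ?_⟩
  · rw [hb.hsNormSq_eq hR]
    simp [hS]
  · have hjS : j ∈ S := by_contra fun hjS => absurd (hge j hjS) (not_le.2 hj)
    have h1 := hb.apply_self ⟨j, hjS⟩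
    rwa [hv _ fun hj₀ : j = b₀ => hj.ne (hj₀ ▸ hs₀)] at h1
  · have hjS : j ∉ S := fun hjS => absurd (hle j hjS) (not_le.2 hj)
    refine horth _ (hgw j (fun hj₀ => hjS (hj₀ ▸ hb₀)) fun hj₁ => hj.ne' (hj₁ ▸ hs₁)) ?_
    exact fun i hi _ => h.basis.orthonormal.2 fun hij => hjS (hij ▸ hi)
  · have h1 := hb.apply_self ⟨b₀, hb₀⟩
    rw [hv₀, map_smul] at h1
    exact smul_right_injective E (by simpa using hw0 : ((‖w‖⁻¹ : ℝ) : ℂ) ≠ 0) h1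
  · refine horth _ ?_ fun j hj hj₀ => ?_
    · rw [hw, inner_sub_right, inner_add_left, inner_add_left]
      simp only [inner_smul_left, inner_smul_right, hg, if_pos, if_neg hbb, if_neg hbb.symm]
      simp
    · rw [inner_sub_right, inner_smul_right, hg, hg, if_neg hj₀,
        if_neg (ne_of_mem_of_not_mem hj hb₁), mul_zero, sub_zero]

theorem IsDiagonalization.infinite_isSpectralProj (h : IsDiagonalization F U s g) {S : Finset ι}
    (hS : S.card = k) (hle : ∀ i ∈ S, s i ≤ σ) (hge : ∀ j ∉ S, σ ≤ s j) {b₀ b₁ : ι}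
    (hb₀ : b₀ ∈ S) (hb₁ : b₁ ∉ S) (hs₀ : s b₀ = σ) (hs₁ : s b₁ = σ) :
    {R | IsSpectralProj U s g k σ R}.Infinite := by
  choose R hR hfix hker using h.exists_isSpectralProj hS hle hge hb₀ hb₁ hs₀ hs₁
  refine Set.infinite_of_injective_forall_mem (f := R) (fun m n hmn => ?_) hR
  by_contra hne
  have h0 : (m : ℂ) - n ≠ 0 := sub_ne_zero.2 (by exact_mod_cast hne)
  -- If `R m = R n`, this projection fixes two independent vectors of the plane spanned by `g b₀`
  -- and `g b₁`, hence the whole plane, although it kills `m g b₀ - g b₁`.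
  have h1 : R m (g b₁) = g b₁ := by
    refine smul_right_injective E h0 ?_
    change ((m : ℂ) - n) • R m (g b₁) = ((m : ℂ) - n) • g b₁
    have h2 := hfix n
    rw [← hmn] at h2
    calc ((m : ℂ) - n) • R m (g b₁)
        = R m (g b₀ + (m : ℂ) • g b₁) - R m (g b₀ + (n : ℂ) • g b₁) := by
          simp only [map_add, map_smul, sub_smul]; abel
      _ = _ := by rw [hfix m, h2, sub_smul]; abel
  have h2 : R m (g b₀) = g b₀ := by
    have h3 := hfix m
    rw [map_add, map_smul, h1] at h3
    exact add_right_cancel h3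
  have h3 := hker m
  rw [map_sub, map_smul, h1, h2] at h3
  have h4 : ⟪g b₁, (m : ℂ) • g b₀ - g b₁⟫_ℂ = -1 := by
    classical
    have hg := orthonormal_iff_ite.1 h.basis.orthonormal
    rw [inner_sub_right, inner_smul_right, hg, hg, if_pos rfl,
      if_neg (ne_of_mem_of_not_mem hb₀ hb₁).symm, mul_zero, zero_sub]
  rw [h3, inner_zero_right] at h4
  norm_num at h4

theorem IsSubProj.eq_of_sub_comp_eq {R R' : E →L[ℂ] E} (hR : IsSubProj U k R)
    (hR' : IsSubProj U k R') (heq : U - U ∘L R = U - U ∘L R') : R = R' := by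
  have h1 : U ∘L R = U ∘L R' := sub_right_injective heq
  ext x
  rw [← hR.apply_eq, ← hR'.apply_eq, initialProj_apply, initialProj_apply]
  exact congrArg (adjoint U) (DFunLike.congr_fun h1 x)

theorem IsDiagonalization.subsingleton_isOptimal (h : IsDiagonalization F U s g) (hk : 1 ≤ k)
    {S : Finset ι} (hS : S.card = k) (hσ : 0 < σ) (hle : ∀ i ∈ S, s i ≤ σ)
    (hge : ∀ j ∉ S, σ ≤ s j) (hcard : {j | s j ≤ σ}.encard = k) :
    {X | IsOptimal F U k X}.Subsingleton := by
  intro X hX Y hY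
  obtain ⟨R, hR, rfl⟩ := (h.isOptimal_iff_isSpectralProj hk hS hσ hle hge).1 hX
  obtain ⟨R', hR', rfl⟩ := (h.isOptimal_iff_isSpectralProj hk hS hσ hle hge).1 hY
  rw [hR.eq hR' h hcard]

theorem IsDiagonalization.infinite_isOptimal (h : IsDiagonalization F U s g) (hk : 1 ≤ k)
    {S : Finset ι} (hS : S.card = k) (hσ : 0 < σ) (hle : ∀ i ∈ S, s i ≤ σ)
    (hge : ∀ j ∉ S, σ ≤ s j) (hmax : ∃ b ∈ S, s b = σ) (hcard : {j | s j ≤ σ}.encard ≠ k) :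
    {X | IsOptimal F U k X}.Infinite := by
  obtain ⟨b₀, hb₀, hs₀⟩ := hmax
  -- Otherwise `S` would be exactly the set of `j` with `s j ≤ σ`, which has the wrong size.
  obtain ⟨b₁, hb₁, hs₁⟩ : ∃ b₁, b₁ ∉ S ∧ s b₁ = σ := by
    by_contra! hcon
    refine hcard ?_
    rw [← hS, ← Set.encard_coe_eq_coe_finsetCard]
    congr 1
    ext j
    refine ⟨fun hj => by_contra fun hjS => hcon j hjS (le_antisymm hj (hge j hjS)), hle j⟩
  have hinj : Set.InjOn (fun R => U - U ∘L R) {R | IsSpectralProj U s g k σ R} :=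
    fun R hR R' hR' heq =>
      IsSubProj.eq_of_sub_comp_eq (IsSpectralProj.toIsSubProj hR)
        (IsSpectralProj.toIsSubProj hR') heq
  refine ((h.infinite_isSpectralProj hS hle hge hb₀ hb₁ hs₀ hs₁).image hinj).mono ?_
  rintro _ ⟨R, hR, rfl⟩
  exact (h.isOptimal_iff_isSpectralProj hk hS hσ hle hge).2 ⟨R, hR, rfl⟩

end Multiplicity

/-! ### Translation from sequences to operators -/

section Approximation

open ContinuousLinearMap

variable {H : Type*} [NormedAddCommGroup H] [InnerProductSpace ℂ H] [CompleteSpace H]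
  {f y : ℕ → H} {F : EllTwo →L[ℂ] H} {k : ℕ}

theorem injective_apply_stdBasis :
    Function.Injective fun (X : EllTwo →L[ℂ] H) i => X (stdBasis i) := fun X _ hXY =>
  IsSynthesis.unique (f := fun i => X (stdBasis i)) (fun _ => rfl) fun i => (congrFun hXY i).symm

/-- Sequences and their synthesis operators correspond bijectively here, so the optimization can be
carried out over operators alone. -/
theorem mem_closeParsevalIndex_iff (hf : IsSynthesis f (synthesisOperator f)) :
    y ∈ closeParsevalIndex f k ↔
      ∃ X, Admissible (synthesisOperator f) (polarFactor (synthesisOperator f)) k X ∧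
        y = fun i => X (stdBasis i) := by
  constructor
  · rintro ⟨⟨⟨L, hL⟩, hfin⟩, hpair, hidx⟩
    have hX := hL.isFrameIn.isSynthesis
    refine ⟨synthesisOperator y, ⟨hL.isStarProjection hX, ?_, hpair, hidx⟩, ?_⟩
    · rwa [← sqDist_eq_hsNormSq hf hX]
    · exact funext fun i => (hX i).symm
  · rintro ⟨X, hX, rfl⟩
    refine ⟨⟨⟨_, isParsevalFrameIn_range hX.isStarProjection⟩, ?_⟩, ?_⟩
    · rw [sqDist_eq_hsNormSq hf fun _ => rfl]
      exact hX.hsNormSq_lt_top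
    · rw [synthesisOperator_apply_stdBasis hX.isStarProjection]
      exact ⟨hX.isFredholmPair, hX.pairIndex_eq⟩

theorem isSymmetricApprox_iff (hf : IsSynthesis f (synthesisOperator f)) :
    IsSymmetricApprox f (closeParsevalIndex f k) y ↔
      ∃ X, IsOptimal (synthesisOperator f) (polarFactor (synthesisOperator f)) k X ∧
        y = fun i => X (stdBasis i) := by
  constructor
  · rintro ⟨hmem, -, hle⟩
    obtain ⟨X, hX, rfl⟩ := (mem_closeParsevalIndex_iff hf).1 hmem
    refine ⟨X, ⟨hX, fun Y hY => ?_⟩, rfl⟩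
    rw [← sqDist_eq_hsNormSq (x := fun i => X (stdBasis i)) hf fun _ => rfl,
      ← sqDist_eq_hsNormSq (x := fun i => Y (stdBasis i)) hf fun _ => rfl]
    exact hle _ ((mem_closeParsevalIndex_iff hf).2 ⟨Y, hY, rfl⟩)
  · rintro ⟨X, ⟨hX, hopt⟩, rfl⟩
    refine ⟨(mem_closeParsevalIndex_iff hf).2 ⟨X, hX, rfl⟩, ?_, fun x hx => ?_⟩
    · rw [sqDist_eq_hsNormSq hf fun _ => rfl]
      exact hX.hsNormSq_lt_top
    · obtain ⟨Y, hY, rfl⟩ := (mem_closeParsevalIndex_iff hf).1 hx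
      rw [sqDist_eq_hsNormSq (X := X) hf fun _ => rfl, sqDist_eq_hsNormSq (X := Y) hf fun _ => rfl]
      exact hopt Y hY

theorem setOf_isSymmetricApprox (hf : IsSynthesis f (synthesisOperator f)) :
    {y | IsSymmetricApprox f (closeParsevalIndex f k) y} =
      (fun (X : EllTwo →L[ℂ] H) i => X (stdBasis i)) ''
        {X | IsOptimal (synthesisOperator f) (polarFactor (synthesisOperator f)) k X} := by
  ext y
  rw [Set.mem_ofPred_eq, isSymmetricApprox_iff hf]
  exact exists_congr fun X => and_congr_right fun _ => eq_comm

theorem IsFrameIn.exists_isDiagonalization {K : Submodule ℂ H} (hf : IsFrameIn f K)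
    {ι : Type*} [Countable ι] {s : ι → ℝ} (hs : IsNonzeroSingularValues (synthesisOperator f) s)
    (hQ : (closeParseval f).Nonempty) :
    ∃ g, IsDiagonalization (synthesisOperator f) (polarFactor (synthesisOperator f)) s g := by
  obtain ⟨x, ⟨L, hL⟩, hx⟩ := hQ
  have hU := isPolarFactor_polarFactor (synthesisOperator f)
  have hX := hL.isFrameIn.isSynthesis
  rw [sqDist_eq_hsNormSq hf.isSynthesis hX] at hx
  obtain ⟨c, hc, hlow⟩ := hf.exists_lower_bound hf.isSynthesis hU
  have hfin := hsNormSq_absOp_sub_lt_top hU (hL.isStarProjection hX) hx hc hlow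
  obtain ⟨g, hg, hgs⟩ := exists_singular_basis stdHilbertBasis hU
    (isCompactOperator_of_hsNormSq_lt_top hfin) hs
  exact ⟨g, hU, hg, hs.pos, hgs, by rwa [hU.hsNormSq_sub]⟩

end Approximation

end FrameApprox

end

/-! ### The theorem on symmetric approximations of given index -/

theorem theorem4p8
    {H : Type*} [NormedAddCommGroup H] [InnerProductSpace ℂ H] [CompleteSpace H]
    [TopologicalSpace.SeparableSpace H] (hH : ¬ FiniteDimensional ℂ H)
    (K : Submodule ℂ H) (f : ℕ → H) (hf : FrameApprox.IsFrameIn f K)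
    (F U : FrameApprox.EllTwo →L[ℂ] H)
    (hF : F = FrameApprox.synthesisOperator f) (hU : U = FrameApprox.polarFactor F)
    {ι : Type*} [Countable ι] (s : ι → ℝ) (hs : FrameApprox.IsNonzeroSingularValues F s)
    (hQ : (FrameApprox.closeParseval f).Nonempty)
    (k : ℕ) (hk : 1 ≤ k) (hkα : (k : ℕ∞) ≤ ENat.card ι) :
    -- existence
    ((∃ y, FrameApprox.IsSymmetricApprox f (FrameApprox.closeParsevalIndex f k) y) ↔
      ∃ n : Fin k → ι, FrameApprox.IsLowest s n) ∧
    -- description of all symmetric approximations, and uniqueness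
    (∀ n : Fin k → ι, FrameApprox.IsLowest s n →
      ∀ σ : ℝ, σ = s (n ⟨k - 1, by omega⟩) →
      ∀ A B : Set ι, A = {j | s j < σ} → B = {j | s j = σ} →
      ∀ E₀ : FrameApprox.EllTwo →L[ℂ] FrameApprox.EllTwo,
        E₀ = (⨆ j ∈ A, FrameApprox.singularSpace F (s j)).topologicalClosure.starProjection →
      ({y | FrameApprox.IsSymmetricApprox f (FrameApprox.closeParsevalIndex f k) y} =
        {y | ∃ E₁ : FrameApprox.EllTwo →L[ℂ] FrameApprox.EllTwo, IsStarProjection E₁ ∧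
          LinearMap.range E₁.toLinearMap ≤ FrameApprox.singularSpace F σ ∧
          FrameApprox.dimENat (LinearMap.range E₁.toLinearMap) + A.encard = k ∧
          y = fun i => U (FrameApprox.stdBasis i) -
            U ((E₀ + E₁) (FrameApprox.stdBasis i))}) ∧
      ((∃! y, FrameApprox.IsSymmetricApprox f (FrameApprox.closeParsevalIndex f k) y) ↔
        A.encard + B.encard = k) ∧
      (A.encard + B.encard ≠ k →
        {y | FrameApprox.IsSymmetricApprox f (FrameApprox.closeParsevalIndex f k) y}.Infinite)) := by
  classical
  subst hF hU
  have hsyn := hf.isSynthesis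
  obtain ⟨g, hg⟩ := hf.exists_isDiagonalization hs hQ
  refine ⟨?_, ?_⟩
  · rw [FrameApprox.exists_isLowest_iff]
    constructor
    · rintro ⟨y, hy⟩
      obtain ⟨X, hX, -⟩ := (FrameApprox.isSymmetricApprox_iff hsyn).1 hy
      exact hX.exists_lowest hk hg hkα
    · rintro ⟨S, hS, hlow⟩
      obtain ⟨X, hX⟩ := hg.exists_isOptimal hk hS hlow
      exact ⟨_, (FrameApprox.isSymmetricApprox_iff hsyn).2 ⟨X, hX, rfl⟩⟩
  · rintro n hn σ hσ A B rfl rfl E₀ hE₀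
    set S : Finset ι := Finset.univ.map ⟨n, hn.injective⟩ with hSdef
    have hmem : ∀ j, j ∈ S ↔ ∃ i, n i = j := fun j => by simp [hSdef]
    have hS : S.card = k := by simp [hSdef]
    have hle : ∀ i ∈ S, s i ≤ σ := fun i hi => by
      obtain ⟨i, rfl⟩ := (hmem _).1 hi
      rw [hσ]
      -- Indices in `Fin k` start at 0, so `k - 1` is the last one and `σ` is the largest of the
      -- chosen values.
      exact hn.monotone (Fin.le_def.2 (Nat.le_sub_one_of_lt i.2))
    have hge : ∀ j ∉ S, σ ≤ s j := fun j hj => by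
      rw [hσ]
      exact hn.le_other j (fun hj' => hj ((hmem j).2 hj')) _
    have hσ0 : 0 < σ := hσ ▸ hs.pos _
    have hmax : ∃ b ∈ S, s b = σ := ⟨_, (hmem _).2 ⟨_, rfl⟩, hσ.symm⟩
    have hinf : {j | s j ≤ σ}.encard ≠ k →
        {y | FrameApprox.IsSymmetricApprox f (FrameApprox.closeParsevalIndex f k) y}.Infinite := by
      intro hcard
      rw [FrameApprox.setOf_isSymmetricApprox hsyn]
      exact (hg.infinite_isOptimal hk hS hσ0 hle hge hmax hcard).image
        FrameApprox.injective_apply_stdBasis.injOn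
    rw [FrameApprox.encard_lt_add_encard_eq]
    refine ⟨?_, ⟨?_, ?_⟩, hinf⟩
    · ext y
      rw [Set.mem_ofPred_eq, Set.mem_ofPred_eq, FrameApprox.isSymmetricApprox_iff hsyn]
      simp only [hg.isOptimal_iff_isSpectralProj hk hS hσ0 hle hge, hg.isSpectralProj_iff hσ0]
      constructor
      · rintro ⟨X, ⟨R, ⟨E₁, h1, h2, h3, rfl⟩, rfl⟩, rfl⟩
        refine ⟨E₁, h1, h2, h3, ?_⟩
        rw [hE₀]
        rfl
      · rintro ⟨E₁, h1, h2, h3, rfl⟩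
        refine ⟨_, ⟨_, ⟨E₁, h1, h2, h3, rfl⟩, rfl⟩, ?_⟩
        rw [hE₀]
        rfl
    · rintro ⟨y, hy, huniq⟩
      by_contra hcard
      -- Uniqueness would make the set of approximations finite.
      refine hinf hcard ((Set.finite_singleton y).subset fun z hz => huniq z hz)
    · intro hcard
      obtain ⟨X, hX⟩ := hg.exists_isOptimal hk hS fun i hi j hj => (hle i hi).trans (hge j hj)
      have hsub : {y | FrameApprox.IsSymmetricApprox f
          (FrameApprox.closeParsevalIndex f k) y}.Subsingleton := by
        rw [FrameApprox.setOf_isSymmetricApprox hsyn]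
        exact (hg.subsingleton_isOptimal hk hS hσ0 hle hge hcard).image _
      have hX' := (FrameApprox.isSymmetricApprox_iff hsyn).2 ⟨X, hX, rfl⟩
      exact ⟨_, hX', fun z hz => hsub hz hX'⟩
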